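/- Work with complex analytic supermanifolds. Let $\mathbb{P}^1_\Pi$ be the $\Pi$-projective line: the supermanifold of dimension $1|1$ over $\mathbb{P}^1$ covered by two copies of $\mathbb{C}^{1|1}$, with coordinates $(z|\theta)$ over $U_0$ and $(w|\psi)$ over $U_1$, whose points are the row spaces ($\Pi$-symmetric $1|1$-dimensional subspaces of $\mathbb{C}^{2|2}$) of the super big cells $$\mathcal{Z}_{U_0}=\left(\begin{array}{cc|cc}1&z&0&\theta\\ \hline 0&-\theta&1&z\end{array}\right),\qquad \mathcal{Z}_{U_1}=\left(\begin{array}{cc|cc}w&1&\psi&0\\ \hline -\psi&0&w&1\end{array}\right).$$ Two such matrices have the same row space iff they differ by left multiplication by an even invertible $1|1$ supermatrix, and this holds on $U_0\cap U_1$ if and only if $z=1/w$ and $\theta=-\psi/w^2$ (equivalently $w=1/z$, $\psi=-\theta/z^2$). Let $\mathcal{T}^*$ and $\mathcal{T}$ be the cotangent and tangent sheaves of $\mathbb{P}^1_\Pi$, let $\Pi$ be the parity change, $Sym^k$ the $k$-th supersymmetric power, and $\mathcal{B}er=\mathcal{B}er(\Pi\mathcal{T}^*)^*$ the Berezinian sheaf,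 a line bundle of rank $1|0$. Write $\mathcal{O}=\mathcal{O}_{\mathbb{P}^1_\Pi}$. The Large Hilbert Space of $\mathbb{P}^1_\Pi$ is the family of sheaves of $\mathcal{O}$-modules indexed by $k\in\mathbb{Z}$ $$\mathcal{LHS}_k=\begin{cases}Sym^k\,\Pi\mathcal{T}^* & k>0,\\ (\mathcal{O}\oplus\Pi\mathcal{B}er)\oplus\mathcal{B}er & k=0,\\ \Pi\big(\mathcal{B}er\otimes Sym^{|k|}\Pi\mathcal{T}\big)\oplus\big(\mathcal{B}er\otimes Sym^{|k|}\Pi\mathcal{T}\big) & k<0.\end{cases}$$ Then: 1. $\mathbb{P}^1_\Pi$ is the split supermanifold determined by the pair $(\mathbb{P}^1,\mathcal{O}_{\mathbb{P}^1}(-2))$, that is, $\mathcal{O}\cong\bigwedge^\bullet\mathcal{O}_{\mathbb{P}^1}(-2)=\mathcal{O}_{\mathbb{P}^1}\oplus\Pi\mathcal{O}_{\mathbb{P}^1}(-2)$ as sheaves of superalgebras, and it is Calabi–Yau: $\mathcal{B}er\cong\mathcal{O}$ as sheaves of $\mathcal{O}$-modules. 2. For every $k\ge 1$, as sheaves of $\mathcal{O}_{\mathbb{P}^1}$-modules,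 $$Sym^k\,\Pi\mathcal{T}^*\;\cong\;\mathcal{O}_{\mathbb{P}^1}(-2k-1)^{\oplus 2}\oplus\Pi\big(\mathcal{O}_{\mathbb{P}^1}(-2k)\oplus\mathcal{O}_{\mathbb{P}^1}(-2k-2)\big),$$ and $H^0(Sym^k\,\Pi\mathcal{T}^*)=0$, $H^1(Sym^k\,\Pi\mathcal{T}^*)\cong\mathbb{C}^{4k|4k}$. 3. As sheaves of $\mathcal{O}$-modules, $\mathcal{LHS}_k= Sym^k\,\Pi\mathcal{T}^*$ for $k>0$, $\mathcal{LHS}_0\cong(\mathcal{O}\oplus\Pi\mathcal{O})\oplus\mathcal{O}$, and $\mathcal{LHS}_k\cong\Pi\,Sym^{|k|}\Pi\mathcal{T}\oplus Sym^{|k|}\Pi\mathcal{T}$ for $k<0$. Here $H^0(\mathcal{O})\cong\mathbb{C}^{1|0}$, $H^1(\mathcal{O})\cong\mathbb{C}^{0|1}$, and, for $n\ge 1$, $H^0(Sym^n\,\Pi\mathcal{T})\cong\mathbb{C}^{4n|4n}$, $H^1(Sym^n\,\Pi\mathcal{T})=0$. Hence the Čech cohomology of the Large Hilbert Space is $$H^0(\mathcal{LHS}_k)\cong\begin{cases}0&k>0,\\(\mathbb{C}^{1|0}\oplus\mathbb{C}^{0|1})\oplus\mathbb{C}^{1|0}&k=0,\\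 \mathbb{C}^{4|k|\,|\,4|k|}\oplus\mathbb{C}^{4|k|\,|\,4|k|}&k<0,\end{cases}\qquad H^1(\mathcal{LHS}_k)\cong\begin{cases}\mathbb{C}^{4k|4k}&k>0,\\(\mathbb{C}^{0|1}\oplus\mathbb{C}^{1|0})\oplus\mathbb{C}^{0|1}&k=0,\\0&k<0.\end{cases}$$ -/

import Mathlib

open TopologicalSpace Topology

noncomputable section

namespace PiLine

/-! ### The Riemann sphere and its two standard charts -/

/-- The complex projective line, as the Riemann sphere. -/
abbrev PLine : Type := OnePoint ℂ

/-- The chart around infinity, with coordinate `w = 1 / z`; the chart around the origin is the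
inclusion of `ℂ`, with coordinate `z`. -/
def chart1 (w : ℂ) : PLine := if w = 0 then OnePoint.infty else ((w⁻¹ : ℂ) : PLine)

theorem chart1_of_ne {w : ℂ} (h : w ≠ 0) : chart1 w = ((w⁻¹ : ℂ) : PLine) := if_neg h

theorem continuous_chart1 : Continuous chart1 := by
  rw [continuous_iff_continuousAt]
  intro w
  rcases eq_or_ne w 0 with rfl | h
  · rw [← continuousWithinAt_compl_self]
    have h1 : Filter.Tendsto (fun w : ℂ => ((w⁻¹ : ℂ) : PLine)) (𝓝[≠] 0) (𝓝 OnePoint.infty) := by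
      refine OnePoint.tendsto_coe_infty.comp ?_
      rw [Filter.coclosedCompact_eq_cocompact, ← Metric.cobounded_eq_cocompact]
      exact Filter.tendsto_inv₀_nhdsNE_zero
    have h2 : chart1 0 = OnePoint.infty := if_pos rfl
    rw [ContinuousWithinAt, h2]
    refine h1.congr' ?_
    filter_upwards [self_mem_nhdsWithin] with w hw
    exact (chart1_of_ne hw).symm
  · have h1 : ContinuousAt (fun w : ℂ => ((w⁻¹ : ℂ) : PLine)) w :=
      OnePoint.continuous_coe.continuousAt.comp (continuousAt_inv₀ h)
    refine h1.congr ?_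
    filter_upwards [isOpen_ne.mem_nhds h] with w hw
    exact (chart1_of_ne hw).symm

/-- The part of `V` in the chart `U₀`, in the coordinate `z`. -/
def ch0 (V : Opens PLine) : Opens ℂ :=
  ⟨{z | (z : PLine) ∈ V}, V.isOpen.preimage OnePoint.continuous_coe⟩

/-- The part of `V` in the chart `U₁`, in the coordinate `w`. -/
def ch1 (V : Opens PLine) : Opens ℂ := ⟨{w | chart1 w ∈ V}, V.isOpen.preimage continuous_chart1⟩

/-- The overlap `U₀ ∩ U₁`, in the coordinate `w`. -/
def Cstar : Opens ℂ := ⟨{w | w ≠ 0}, isOpen_ne⟩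

/-- The part of `V` in the overlap `U₀ ∩ U₁`, in the coordinate `w`. -/
def ov (V : Opens PLine) : Opens ℂ := Cstar ⊓ ch1 V

theorem ch0_mono {U V : Opens PLine} (h : V ≤ U) : ch0 V ≤ ch0 U := fun _ hz => h hz

theorem ch1_mono {U V : Opens PLine} (h : V ≤ U) : ch1 V ≤ ch1 U := fun _ hz => h hz

theorem ov_mono {U V : Opens PLine} (h : V ≤ U) : ov V ≤ ov U := fun _ hz => ⟨hz.1, h hz.2⟩

theorem inv_mem_ch0 {V : Opens PLine} : ∀ w ∈ ov V, w⁻¹ ∈ ch0 V := fun w hw => by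
  have h : chart1 w ∈ V := hw.2
  rwa [chart1_of_ne hw.1] at h

/-! ### Holomorphic functions -/

/-- Extension by zero. -/
def extz {S : Opens ℂ} (f : S → ℂ) (z : ℂ) : ℂ := by
  classical exact if h : z ∈ S then f ⟨z, h⟩ else 0

theorem extz_of_mem {S : Opens ℂ} (f : S → ℂ) {z : ℂ} (h : z ∈ S) : extz f z = f ⟨z, h⟩ :=
  dif_pos h

/-- The holomorphic functions on an open subset of `ℂ`, as a subalgebra of all functions. -/
def holSubalgebra (S : Opens ℂ) : Subalgebra ℂ (S → ℂ) where
  carrier := {f | DifferentiableOn ℂ (extz f) S}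
  mul_mem' {f g} hf hg := (hf.mul hg).congr fun z hz => by
    simp [extz_of_mem _ (show z ∈ S from hz)]
  add_mem' {f g} hf hg := (hf.add hg).congr fun z hz => by
    simp [extz_of_mem _ (show z ∈ S from hz)]
  algebraMap_mem' c := (differentiableOn_const c).congr fun z hz => by
    simp [extz_of_mem _ (show z ∈ S from hz)]

/-- The algebra of holomorphic functions on an open subset of `ℂ`. -/
def Hol (S : Opens ℂ) : Type := holSubalgebra S

instance (S : Opens ℂ) : CommRing (Hol S) := inferInstanceAs (CommRing (holSubalgebra S))

instance (S : Opens ℂ) : Algebra ℂ (Hol S) := inferInstanceAs (Algebra ℂ (holSubalgebra S))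

/-- Composition with a holomorphic map. -/
def Hol.pull {S T : Opens ℂ} (φ : ℂ → ℂ) (hd : DifferentiableOn ℂ φ S)
    (hm : ∀ z ∈ S, φ z ∈ T) : Hol T →ₐ[ℂ] Hol S where
  toFun f := ⟨fun z => f.1 ⟨φ z, hm z z.2⟩, by
    have h : DifferentiableOn ℂ (extz f.1) T := f.2
    refine (DifferentiableOn.comp (t := T) h hd fun z hz => hm z hz).congr fun z hz => ?_
    simp [extz_of_mem _ (show z ∈ S from hz), extz_of_mem _ (hm z hz)]⟩
  map_one' := rfl
  map_mul' _ _ := rfl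
  map_zero' := rfl
  map_add' _ _ := rfl
  commutes' _ := rfl

/-- Restriction of holomorphic functions. -/
def Hol.res {S T : Opens ℂ} (h : S ≤ T) : Hol T →ₐ[ℂ] Hol S :=
  Hol.pull id differentiableOn_id h

/-- The pull-back `f ↦ (w ↦ f (1 / w))`. -/
def Hol.inv {S T : Opens ℂ} (h0 : S ≤ Cstar) (h : ∀ w ∈ S, w⁻¹ ∈ T) : Hol T →ₐ[ℂ] Hol S :=
  Hol.pull (fun w => w⁻¹) (fun _ hw => (differentiableAt_inv (h0 hw)).differentiableWithinAt) h

/-- The complex derivative. -/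
def Hol.deriv {S : Opens ℂ} (f : Hol S) : Hol S :=
  ⟨fun z => _root_.deriv (extz f.1) z, by
    have h : DifferentiableOn ℂ (_root_.deriv (extz f.1)) S := DifferentiableOn.deriv f.2 S.isOpen
    exact h.congr fun z hz => by simp [extz_of_mem _ (show z ∈ S from hz)]⟩

/-- The coordinate function. -/
def Hol.coord (S : Opens ℂ) : Hol S :=
  ⟨fun z => z, differentiableOn_id.congr fun z hz => by simp [extz_of_mem _ (show z ∈ S from hz)]⟩

/-- The function `w ↦ 1 / w` on the overlap. -/
def Hol.coordInv : Hol Cstar :=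
  Hol.inv (T := ⊤) le_rfl (fun _ _ => trivial) (Hol.coord ⊤)

theorem Hol.coord_mul_coordInv : Hol.coord Cstar * Hol.coordInv = 1 :=
  Subtype.ext (funext fun z => mul_inv_cancel₀ z.2)

/-- The unit `w ↦ w` of the algebra of holomorphic functions on the overlap. -/
def Hol.coordUnit : (Hol Cstar)ˣ :=
  ⟨Hol.coord Cstar, Hol.coordInv, Hol.coord_mul_coordInv,
    (mul_comm _ _).trans Hol.coord_mul_coordInv⟩

theorem Hol.glue {ι : Type} (T : ι → Opens ℂ) (S : Opens ℂ) (hT : ∀ i, T i ≤ S)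
    (hS : ∀ z ∈ S, ∃ i, z ∈ T i) (f : ∀ i, Hol (T i))
    (hf : ∀ i j z (hi : z ∈ T i) (hj : z ∈ T j), (f i).1 ⟨z, hi⟩ = (f j).1 ⟨z, hj⟩) :
    ∃ g : Hol S, ∀ i, Hol.res (hT i) g = f i := by
  classical
  choose k hk using fun z : S => hS z.1 z.2
  refine ⟨⟨fun z => (f (k z)).1 ⟨z, hk z⟩, ?_⟩,
    fun i => Subtype.ext (funext fun z => hf _ _ _ _ z.2)⟩
  intro z hz
  obtain ⟨i, hi⟩ := hS z hz
  have h1 : DifferentiableAt ℂ (extz (f i).1) z :=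
    DifferentiableOn.differentiableAt (s := T i) (f i).2 ((T i).isOpen.mem_nhds hi)
  refine (h1.congr_of_eventuallyEq ?_).differentiableWithinAt
  filter_upwards [(T i).isOpen.mem_nhds hi] with y hy
  rw [extz_of_mem _ (hT i hy), extz_of_mem _ (show y ∈ T i from hy)]
  exact hf _ _ _ _ _

theorem Hol.sep {ι : Type} {T : ι → Opens ℂ} {S : Opens ℂ} (hT : ∀ i, T i ≤ S)
    (hS : ∀ z ∈ S, ∃ i, z ∈ T i) {f g : Hol S}
    (h : ∀ i, Hol.res (hT i) f = Hol.res (hT i) g) : f = g := by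
  refine Subtype.ext (funext fun z => ?_)
  obtain ⟨i, hi⟩ := hS z.1 z.2
  exact congrFun (congrArg Subtype.val (h i)) ⟨z.1, hi⟩

/-! ### Superfunctions in one even and one odd variable -/

/-- Superfunctions `f₀ + f₁ θ` on an open subset of `ℂ`, with one odd variable `θ`: the exterior
algebra on one generator is the algebra of dual numbers, with `θ = DualNumber.eps`. -/
abbrev SF (S : Opens ℂ) : Type := DualNumber (Hol S)

/-- The even (`q = 0`) and the odd (`q = 1`) part of a trivial square-zero extension. -/
def dpart (R M : Type) [CommRing R] [Algebra ℂ R] [AddCommGroup M] [Module R M] [Module ℂ M]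
    (q : ZMod 2) :
    Submodule ℂ (TrivSqZeroExt R M) where
  carrier := {f | (q = 0 → f.snd = 0) ∧ (q = 1 → f.fst = 0)}
  add_mem' {a b} ha hb := ⟨fun h => by simp [ha.1 h, hb.1 h], fun h => by simp [ha.2 h, hb.2 h]⟩
  zero_mem' := by simp
  smul_mem' c x hx := ⟨fun h => by simp [hx.1 h], fun h => by simp [hx.2 h]⟩

theorem zmod2_cases (q : ZMod 2) : q = 0 ∨ q = 1 := by
  revert q; decide

theorem mem_dpart_zero {R M : Type} [CommRing R] [Algebra ℂ R] [AddCommGroup M] [Module R M]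
    [Module ℂ M] {f : TrivSqZeroExt R M} : f ∈ dpart R M 0 ↔ f.snd = 0 :=
  ⟨fun h => h.1 rfl, fun h => ⟨fun _ => h, fun h' => absurd h' (by decide)⟩⟩

theorem mem_dpart_one {R M : Type} [CommRing R] [Algebra ℂ R] [AddCommGroup M] [Module R M]
    [Module ℂ M] {f : TrivSqZeroExt R M} : f ∈ dpart R M 1 ↔ f.fst = 0 :=
  ⟨fun h => h.2 rfl, fun h => ⟨fun h' => absurd h' (by decide), fun _ => h⟩⟩

theorem isCompl_dpart (R M : Type) [CommRing R] [Algebra ℂ R] [AddCommGroup M] [Module R M]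
    [Module ℂ M] : IsCompl (dpart R M 0) (dpart R M 1) := by
  constructor
  · rw [Submodule.disjoint_def]
    intro x h0 h1
    exact TrivSqZeroExt.ext (mem_dpart_one.1 h1) (mem_dpart_zero.1 h0)
  · rw [codisjoint_iff, Submodule.eq_top_iff']
    intro x
    rw [← TrivSqZeroExt.inl_fst_add_inr_snd_eq x]
    exact Submodule.add_mem_sup (mem_dpart_zero.2 (by simp)) (mem_dpart_one.2 (by simp))

theorem dpart_mul {R M : Type} [CommRing R] [Algebra ℂ R] [AddCommGroup M] [Module R M]
    [Module Rᵐᵒᵖ M] [IsCentralScalar R M] [Module ℂ M] {p q : ZMod 2} {a b : TrivSqZeroExt R M}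
    (ha : a ∈ dpart R M p) (hb : b ∈ dpart R M q) : a * b ∈ dpart R M (p + q) := by
  rcases zmod2_cases p with rfl | rfl <;> rcases zmod2_cases q with rfl | rfl
  · rw [mem_dpart_zero] at ha hb
    rw [add_zero, mem_dpart_zero]; simp [ha, hb]
  · rw [mem_dpart_zero] at ha
    rw [mem_dpart_one] at hb
    rw [zero_add, mem_dpart_one]; simp [hb]
  · rw [mem_dpart_one] at ha
    rw [mem_dpart_zero] at hb
    rw [add_zero, mem_dpart_one]; simp [ha]
  · rw [mem_dpart_one] at ha hb
    rw [show (1 : ZMod 2) + 1 = 0 from by decide, mem_dpart_zero]; simp [ha, hb]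

/-- The pull-back of superfunctions `f₀ + f₁ θ ↦ α f₀ + (α f₁) c θ` along a change of coordinates
given by `α` on functions of the even variable, and which multiplies the odd variable by `c`. -/
def SF.pull {R R' : Type} [CommRing R] [Algebra ℂ R] [CommRing R'] [Algebra ℂ R']
    (α : R →ₐ[ℂ] R') (c : R') : DualNumber R →ₐ[ℂ] DualNumber R' :=
  AlgHom.ofLinearMap
    { toFun := fun f => TrivSqZeroExt.inl (α f.fst) + TrivSqZeroExt.inr (α f.snd * c)
      map_add' := fun x y => by ext <;> simp; ring
      map_smul' := fun r x => by ext <;> simp }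
    (by ext <;> simp) (fun x y => by ext <;> simp; ring)

@[simp] theorem SF.fst_pull {R R' : Type} [CommRing R] [Algebra ℂ R] [CommRing R'] [Algebra ℂ R']
    (α : R →ₐ[ℂ] R') (c : R') (f : DualNumber R) : (SF.pull α c f).fst = α f.fst := by
  simp [SF.pull]

@[simp] theorem SF.snd_pull {R R' : Type} [CommRing R] [Algebra ℂ R] [CommRing R'] [Algebra ℂ R']
    (α : R →ₐ[ℂ] R') (c : R') (f : DualNumber R) : (SF.pull α c f).snd = α f.snd * c := by
  simp [SF.pull]

theorem SF.pull_mem {R R' : Type} [CommRing R] [Algebra ℂ R] [CommRing R'] [Algebra ℂ R']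
    (α : R →ₐ[ℂ] R') (c : R') {q : ZMod 2} {f : DualNumber R} (hf : f ∈ dpart R R q) :
    SF.pull α c f ∈ dpart R' R' q :=
  ⟨fun h => by simp [hf.1 h], fun h => by simp [hf.2 h]⟩

/-- Restriction of superfunctions. -/
def SF.res {S T : Opens ℂ} (h : S ≤ T) : SF T →ₐ[ℂ] SF S := SF.pull (Hol.res h) 1

theorem SF.fst_res {S T : Opens ℂ} (h : S ≤ T) (f : SF T) :
    (SF.res h f).fst = Hol.res h f.fst := SF.fst_pull _ _ _

theorem SF.snd_res {S T : Opens ℂ} (h : S ≤ T) (f : SF T) :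
    (SF.res h f).snd = Hol.res h f.snd := (SF.snd_pull _ _ _).trans (mul_one _)

/-- The superfunction `a + b θ`. -/
def SF.mk {R : Type} (a b : R) : DualNumber R := (a, b)

theorem SF.fst_mk {R : Type} (a b : R) : (SF.mk a b).fst = a := rfl

theorem SF.snd_mk {R : Type} (a b : R) : (SF.mk a b).snd = b := rfl

theorem SF.res_res {S T W : Opens ℂ} (h : S ≤ T) (h' : T ≤ W) (f : SF W) :
    SF.res h (SF.res h' f) = SF.res (h.trans h') f := by
  refine TrivSqZeroExt.ext ?_ ?_
  · rw [SF.fst_res, SF.fst_res, SF.fst_res]; rfl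
  · rw [SF.snd_res, SF.snd_res, SF.snd_res]; rfl

theorem SF.res_refl {S : Opens ℂ} (f : SF S) : SF.res le_rfl f = f :=
  TrivSqZeroExt.ext (SF.fst_res _ _) (SF.snd_res _ _)

theorem SF.glue {ι : Type} (T : ι → Opens ℂ) (S : Opens ℂ) (hT : ∀ i, T i ≤ S)
    (hS : ∀ z ∈ S, ∃ i, z ∈ T i) (f : ∀ i, SF (T i))
    (hf : ∀ i j, SF.res inf_le_left (f i) = SF.res (inf_le_right : T i ⊓ T j ≤ T j) (f j)) :
    ∃ g : SF S, ∀ i, SF.res (hT i) g = f i := by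
  obtain ⟨g0, h0⟩ := Hol.glue T S hT hS (fun i => (f i).fst) fun i j z hi hj => by
    have := congrArg TrivSqZeroExt.fst (hf i j)
    rw [SF.fst_res, SF.fst_res] at this
    exact congrFun (congrArg Subtype.val this) ⟨z, hi, hj⟩
  obtain ⟨g1, h1⟩ := Hol.glue T S hT hS (fun i => (f i).snd) fun i j z hi hj => by
    have := congrArg TrivSqZeroExt.snd (hf i j)
    rw [SF.snd_res, SF.snd_res] at this
    exact congrFun (congrArg Subtype.val this) ⟨z, hi, hj⟩
  refine ⟨SF.mk g0 g1, fun i => TrivSqZeroExt.ext ?_ ?_⟩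
  · rw [SF.fst_res, SF.fst_mk]; exact h0 i
  · rw [SF.snd_res, SF.snd_mk]; exact h1 i

theorem SF.sep {ι : Type} {T : ι → Opens ℂ} {S : Opens ℂ} (hT : ∀ i, T i ≤ S)
    (hS : ∀ z ∈ S, ∃ i, z ∈ T i) {f g : SF S}
    (h : ∀ i, SF.res (hT i) f = SF.res (hT i) g) : f = g := by
  refine TrivSqZeroExt.ext (Hol.sep hT hS fun i => ?_) (Hol.sep hT hS fun i => ?_)
  · rw [← SF.fst_res, ← SF.fst_res, h i]
  · rw [← SF.snd_res, ← SF.snd_res, h i]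

/-- The even partial derivative `∂/∂w (f₀ + f₁ ψ) = f₀' + f₁' ψ`. -/
def SF.dEven {S : Opens ℂ} (f : SF S) : SF S :=
  SF.mk (Hol.deriv f.fst) (Hol.deriv f.snd)

/-- The odd partial derivative `∂/∂ψ (f₀ + f₁ ψ) = f₁`. -/
def SF.dOdd {S : Opens ℂ} (f : SF S) : SF S := SF.mk f.snd 0

/-! ### Linear algebra of `1|1` supermatrices

The index `0 : Fin 2` is even and the index `1 : Fin 2` is odd. -/

/-- The parities of a frame of rank `1|1`. -/
def par11 : Fin 2 → ZMod 2 := ![0, 1]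

/-- A matrix is an even supermatrix: the diagonal blocks are even, the off-diagonal ones odd. -/
def IsEvenMat {R ι : Type} [CommRing R] [Algebra ℂ R] (par : ι → ZMod 2)
    (M : Matrix ι ι (DualNumber R)) : Prop :=
  ∀ i j, M i j ∈ dpart R R (par i + par j)

/-- The parity transpose of a `1|1` supermatrix: `(A, B; C, D) ↦ (D, C; B, A)`. -/
def parityTranspose {A : Type} (M : Matrix (Fin 2) (Fin 2) A) : Matrix (Fin 2) (Fin 2) A :=
  !![M 1 1, M 1 0; M 0 1, M 0 0]

/-- The supertranspose of an even `1|1` supermatrix: `(A, B; C, D) ↦ (A, C; -B, D)`. -/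
def superTranspose {A : Type} [Neg A] (M : Matrix (Fin 2) (Fin 2) A) : Matrix (Fin 2) (Fin 2) A :=
  !![M 0 0, M 1 0; -M 0 1, M 1 1]

/-- The Berezinian of an even invertible `1|1` supermatrix:
`Ber (A, B; C, D) = det (A - B D⁻¹ C) det D⁻¹`. -/
def berezinian {A : Type} [CommRing A] (M : Matrix (Fin 2) (Fin 2) A) : A :=
  (M 0 0 - M 0 1 * Ring.inverse (M 1 1) * M 1 0) * Ring.inverse (M 1 1)

/-- The supersymmetric power of degree `k + 1` of an even `1|1` supermatrix. If the matrix `M` acts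
on a frame `(e | f)`, by `e ↦ M₀₀ e + M₀₁ f` and `f ↦ M₁₀ e + M₁₁ f`, this is the induced action
on the frame `(e^(k+1) | e^k f)` of the supersymmetric power, see `symPow_fst` and `symPow_snd`. -/
def symPow {A : Type} [CommRing A] (k : ℕ) (M : Matrix (Fin 2) (Fin 2) A) :
    Matrix (Fin 2) (Fin 2) A :=
  !![M 0 0 ^ (k + 1), (k + 1) * M 0 0 ^ k * M 0 1;
     M 0 0 ^ k * M 1 0, M 0 0 ^ k * M 1 1 - k * M 0 0 ^ (k - 1) * (M 0 1 * M 1 0)]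

/-- In an algebra with an even element `e` and an odd element `f` (so that `f ^ 2 = 0`, and `f`
anticommutes with odd scalars), the first row of `symPow k M` computes the image of `e ^ (k+1)`. -/
theorem symPow_fst {A B : Type} [CommRing A] [Ring B] (φ : A →+* B) (e f : B)
    (M : Matrix (Fin 2) (Fin 2) A) (k : ℕ) (he : ∀ a, e * φ a = φ a * e) (hef : f * e = e * f)
    (hf : f * f = 0) (h00 : f * φ (M 0 0) = φ (M 0 0) * f)
    (h01 : f * φ (M 0 1) = -(φ (M 0 1) * f)) :
    (φ (M 0 0) * e + φ (M 0 1) * f) ^ (k + 1) =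
      φ (symPow k M 0 0) * e ^ (k + 1) + φ (symPow k M 0 1) * (e ^ k * f) := by
  have hek : ∀ (n : ℕ) a, e ^ n * φ a = φ a * e ^ n := fun n a =>
    (Commute.pow_left (show Commute e (φ a) from he a) n).eq
  have hfe : ∀ n : ℕ, f * e ^ n = e ^ n * f := fun n =>
    (Commute.pow_right (show Commute f e from hef) n).eq
  induction k with
  | zero => simp [symPow]
  | succ k ih =>
    rw [pow_succ, ih]
    have h0 : ∀ x y : A, φ x * e ^ (k + 1) * (φ y * e) = φ (x * y) * e ^ (k + 1 + 1) := by
      intro x y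
      rw [map_mul, pow_succ e (k + 1), mul_assoc, ← mul_assoc (e ^ (k + 1)), hek]
      simp only [mul_assoc]
    have h1 : ∀ x y : A, φ x * e ^ (k + 1) * (φ y * f) = φ (x * y) * (e ^ (k + 1) * f) := by
      intro x y
      rw [map_mul, mul_assoc, ← mul_assoc (e ^ (k + 1)), hek]
      simp only [mul_assoc]
    have h2 : ∀ x : A, φ x * (e ^ k * f) * (φ (M 0 0) * e) =
        φ (x * M 0 0) * (e ^ (k + 1) * f) := by
      intro x
      rw [map_mul]
      calc φ x * (e ^ k * f) * (φ (M 0 0) * e) = φ x * (e ^ k * (f * φ (M 0 0)) * e) := by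
            simp only [mul_assoc]
        _ = φ x * ((e ^ k * φ (M 0 0)) * (f * e)) := by rw [h00]; simp only [mul_assoc]
        _ = _ := by rw [hek, hef, pow_succ]; simp only [mul_assoc]
    have h3 : ∀ x : A, φ x * (e ^ k * f) * (φ (M 0 1) * f) = 0 := by
      intro x
      calc φ x * (e ^ k * f) * (φ (M 0 1) * f) = φ x * (e ^ k * (f * φ (M 0 1)) * f) := by
            simp only [mul_assoc]
        _ = 0 := by rw [h01]; simp [mul_assoc, hf]
    rw [add_mul, mul_add, mul_add, h0, h1, h2, h3, add_zero, add_assoc, ← add_mul, ← map_add]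
    congr 3 <;> simp [symPow] <;> ring

/-- The second row of `symPow k M` computes the image of `e ^ k f`. -/
theorem symPow_snd {A B : Type} [CommRing A] [Ring B] (φ : A →+* B) (e f : B)
    (M : Matrix (Fin 2) (Fin 2) A) (k : ℕ) (he : ∀ a, e * φ a = φ a * e) (hef : f * e = e * f)
    (hf : f * f = 0) (h00 : f * φ (M 0 0) = φ (M 0 0) * f)
    (h01 : f * φ (M 0 1) = -(φ (M 0 1) * f)) (h10 : f * φ (M 1 0) = -(φ (M 1 0) * f))
    (h11 : f * φ (M 1 1) = φ (M 1 1) * f) :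
    (φ (M 0 0) * e + φ (M 0 1) * f) ^ k * (φ (M 1 0) * e + φ (M 1 1) * f) =
      φ (symPow k M 1 0) * e ^ (k + 1) + φ (symPow k M 1 1) * (e ^ k * f) := by
  cases k with
  | zero => simp [symPow]
  | succ k =>
    have hek : ∀ (n : ℕ) a, e ^ n * φ a = φ a * e ^ n := fun n a =>
      (Commute.pow_left (show Commute e (φ a) from he a) n).eq
    rw [symPow_fst φ e f M k he hef hf h00 h01]
    have h0 : ∀ x y : A, φ x * e ^ (k + 1) * (φ y * e) = φ (x * y) * e ^ (k + 1 + 1) := by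
      intro x y
      rw [map_mul, pow_succ e (k + 1), mul_assoc, ← mul_assoc (e ^ (k + 1)), hek]
      simp only [mul_assoc]
    have h1 : ∀ x y : A, φ x * e ^ (k + 1) * (φ y * f) = φ (x * y) * (e ^ (k + 1) * f) := by
      intro x y
      rw [map_mul, mul_assoc, ← mul_assoc (e ^ (k + 1)), hek]
      simp only [mul_assoc]
    have h2 : ∀ x : A, φ x * (e ^ k * f) * (φ (M 1 0) * e) =
        φ (-(x * M 1 0)) * (e ^ (k + 1) * f) := by
      intro x
      rw [map_neg, map_mul]
      calc φ x * (e ^ k * f) * (φ (M 1 0) * e) = φ x * (e ^ k * (f * φ (M 1 0)) * e) := by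
            simp only [mul_assoc]
        _ = -(φ x * ((e ^ k * φ (M 1 0)) * (f * e))) := by rw [h10]; simp [mul_assoc]
        _ = _ := by rw [hek, hef, pow_succ]; simp [mul_assoc]
    have h3 : ∀ x : A, φ x * (e ^ k * f) * (φ (M 1 1) * f) = 0 := by
      intro x
      calc φ x * (e ^ k * f) * (φ (M 1 1) * f) = φ x * (e ^ k * (f * φ (M 1 1)) * f) := by
            simp only [mul_assoc]
        _ = 0 := by rw [h11]; simp [mul_assoc, hf]
    rw [add_mul, mul_add, mul_add, h0, h1, h2, h3, add_zero, add_assoc, ← add_mul, ← map_add]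
    congr 3
    simp [symPow]
    ring

/-! ### Sheaves of superalgebras and of supermodules on the projective line -/

/-- A sheaf of supercommutative `ℂ`-superalgebras on the projective line whose underlying rings are
commutative (equivalently: any two odd sections have product zero, as is the case for
supermanifolds of odd dimension at most one). -/
structure SuperAlgSheaf where
  obj : Opens PLine → Type
  [commRing : ∀ U, CommRing (obj U)]
  [algebra : ∀ U, Algebra ℂ (obj U)]
  res : ∀ {U V : Opens PLine}, V ≤ U → obj U →ₐ[ℂ] obj V
  res_refl : ∀ {U : Opens PLine} (s : obj U), res le_rfl s = s
  res_res : ∀ {U V W : Opens PLine} (h : W ≤ V) (h' : V ≤ U) (s : obj U),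
    res h (res h' s) = res (h.trans h') s
  part : ZMod 2 → ∀ U, Submodule ℂ (obj U)
  isCompl : ∀ U, IsCompl (part 0 U) (part 1 U)
  res_mem : ∀ {U V : Opens PLine} (h : V ≤ U) (p : ZMod 2), ∀ s ∈ part p U, res h s ∈ part p V
  one_mem : ∀ U, (1 : obj U) ∈ part 0 U
  mul_mem : ∀ {U : Opens PLine} {p q : ZMod 2} {a b : obj U}, a ∈ part p U → b ∈ part q U →
    a * b ∈ part (p + q) U
  supercomm : ∀ {U : Opens PLine} {a b : obj U}, a ∈ part 1 U → b ∈ part 1 U → a * b = -(b * a)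
  glue : ∀ {ι : Type} (V : ι → Opens PLine) (s : ∀ i, obj (V i)),
    (∀ i j, res inf_le_left (s i) = res (inf_le_right : V i ⊓ V j ≤ V j) (s j)) →
    ∃! t : obj (⨆ i, V i), ∀ i, res (le_iSup V i) t = s i

attribute [instance] SuperAlgSheaf.commRing SuperAlgSheaf.algebra

/-- An isomorphism of sheaves of superalgebras. -/
structure SuperAlgSheaf.Iso (A B : SuperAlgSheaf) where
  equiv : ∀ U, A.obj U ≃ₐ[ℂ] B.obj U
  equiv_res : ∀ {U V : Opens PLine} (h : V ≤ U) (s : A.obj U),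
    equiv V (A.res h s) = B.res h (equiv U s)
  equiv_mem : ∀ (U : Opens PLine) (p : ZMod 2) (s : A.obj U),
    equiv U s ∈ B.part p U ↔ s ∈ A.part p U

/-- A homomorphism of sheaves of superalgebras. -/
structure SuperAlgSheaf.Hom (A B : SuperAlgSheaf) where
  hom : ∀ U, A.obj U →ₐ[ℂ] B.obj U
  hom_res : ∀ {U V : Opens PLine} (h : V ≤ U) (s : A.obj U),
    hom V (A.res h s) = B.res h (hom U s)
  hom_mem : ∀ (U : Opens PLine) (p : ZMod 2), ∀ s ∈ A.part p U, hom U s ∈ B.part p U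

/-- A sheaf of (left) supermodules over a sheaf of superalgebras. -/
structure SuperModSheaf (A : SuperAlgSheaf) where
  obj : Opens PLine → Type
  [addCommGroup : ∀ U, AddCommGroup (obj U)]
  [moduleC : ∀ U, Module ℂ (obj U)]
  [module : ∀ U, Module (A.obj U) (obj U)]
  [tower : ∀ U, IsScalarTower ℂ (A.obj U) (obj U)]
  res : ∀ {U V : Opens PLine}, V ≤ U → obj U →ₗ[ℂ] obj V
  res_smul : ∀ {U V : Opens PLine} (h : V ≤ U) (a : A.obj U) (s : obj U),
    res h (a • s) = A.res h a • res h s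
  res_refl : ∀ {U : Opens PLine} (s : obj U), res le_rfl s = s
  res_res : ∀ {U V W : Opens PLine} (h : W ≤ V) (h' : V ≤ U) (s : obj U),
    res h (res h' s) = res (h.trans h') s
  part : ZMod 2 → ∀ U, Submodule ℂ (obj U)
  isCompl : ∀ U, IsCompl (part 0 U) (part 1 U)
  res_mem : ∀ {U V : Opens PLine} (h : V ≤ U) (p : ZMod 2), ∀ s ∈ part p U, res h s ∈ part p V
  smul_mem : ∀ {U : Opens PLine} {p q : ZMod 2} {a : A.obj U} {s : obj U}, a ∈ A.part p U →
    s ∈ part q U → a • s ∈ part (p + q) U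
  glue : ∀ {ι : Type} (V : ι → Opens PLine) (s : ∀ i, obj (V i)),
    (∀ i j, res inf_le_left (s i) = res (inf_le_right : V i ⊓ V j ≤ V j) (s j)) →
    ∃! t : obj (⨆ i, V i), ∀ i, res (le_iSup V i) t = s i

attribute [instance] SuperModSheaf.addCommGroup SuperModSheaf.moduleC SuperModSheaf.module
  SuperModSheaf.tower

/-- An (even) isomorphism of sheaves of supermodules. -/
structure SuperModSheaf.Iso {A : SuperAlgSheaf} (F G : SuperModSheaf A) where
  equiv : ∀ U, F.obj U ≃ₗ[A.obj U] G.obj U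
  equiv_res : ∀ {U V : Opens PLine} (h : V ≤ U) (s : F.obj U),
    equiv V (F.res h s) = G.res h (equiv U s)
  equiv_mem : ∀ (U : Opens PLine) (p : ZMod 2) (s : F.obj U),
    equiv U s ∈ G.part p U ↔ s ∈ F.part p U

/-- A sheaf of superalgebras as a sheaf of supermodules over itself. -/
def SuperAlgSheaf.self (A : SuperAlgSheaf) : SuperModSheaf A where
  obj := A.obj
  res h := (A.res h).toLinearMap
  res_smul h a s := map_mul (A.res h) a s
  res_refl := A.res_refl
  res_res := A.res_res
  part := A.part
  isCompl := A.isCompl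
  res_mem := A.res_mem
  smul_mem ha hs := A.mul_mem ha hs
  glue := A.glue

/-- The parity change `Π F`. -/
def SuperModSheaf.parity {A : SuperAlgSheaf} (F : SuperModSheaf A) : SuperModSheaf A where
  obj := F.obj
  res := F.res
  res_smul := F.res_smul
  res_refl := F.res_refl
  res_res := F.res_res
  part p := F.part (p + 1)
  isCompl U := by
    rw [zero_add, show (1 : ZMod 2) + 1 = 0 from by decide]
    exact (F.isCompl U).symm
  res_mem h p := F.res_mem h (p + 1)
  smul_mem ha hs := by rw [add_assoc]; exact F.smul_mem ha hs
  glue := F.glue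

theorem isCompl_prod {M N : Type} [AddCommGroup M] [AddCommGroup N] [Module ℂ M] [Module ℂ N]
    {p q : Submodule ℂ M} {p' q' : Submodule ℂ N} (h : IsCompl p q) (h' : IsCompl p' q') :
    IsCompl (p.prod p') (q.prod q') := by
  constructor
  · rw [disjoint_iff, Submodule.prod_inf_prod, h.inf_eq_bot, h'.inf_eq_bot, Submodule.prod_bot]
  · rw [codisjoint_iff, Submodule.prod_sup_prod, h.sup_eq_top, h'.sup_eq_top, Submodule.prod_top]

/-- The direct sum of two sheaves of supermodules. -/
def SuperModSheaf.sum {A : SuperAlgSheaf} (F G : SuperModSheaf A) : SuperModSheaf A where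
  obj U := F.obj U × G.obj U
  res h := (F.res h).prodMap (G.res h)
  res_smul h a s := Prod.ext (F.res_smul h a s.1) (G.res_smul h a s.2)
  res_refl s := Prod.ext (F.res_refl s.1) (G.res_refl s.2)
  res_res h h' s := Prod.ext (F.res_res h h' s.1) (G.res_res h h' s.2)
  part p U := (F.part p U).prod (G.part p U)
  isCompl U := isCompl_prod (F.isCompl U) (G.isCompl U)
  res_mem h p s hs := ⟨F.res_mem h p _ hs.1, G.res_mem h p _ hs.2⟩
  smul_mem ha hs := ⟨F.smul_mem ha hs.1, G.smul_mem ha hs.2⟩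
  glue V s hs := by
    obtain ⟨t, ht, ht'⟩ := F.glue V (fun i => (s i).1) fun i j => congrArg Prod.fst (hs i j)
    obtain ⟨u, hu, hu'⟩ := G.glue V (fun i => (s i).2) fun i j => congrArg Prod.snd (hs i j)
    exact ⟨(t, u), fun i => Prod.ext (ht i) (hu i), fun y hy => Prod.ext
      (ht' _ fun i => congrArg Prod.fst (hy i)) (hu' _ fun i => congrArg Prod.snd (hy i))⟩

/-- Restriction of scalars along a homomorphism of sheaves of superalgebras. -/
def SuperModSheaf.restrictScalars {A B : SuperAlgSheaf} (φ : A.Hom B) (F : SuperModSheaf B) :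
    SuperModSheaf A where
  obj := F.obj
  module U := Module.compHom (F.obj U) (φ.hom U).toRingHom
  tower U := by
    let _ := Module.compHom (F.obj U) (φ.hom U).toRingHom
    refine ⟨fun c a s => ?_⟩
    change φ.hom U (c • a) • s = c • (φ.hom U a • s)
    rw [map_smul, smul_assoc]
  res := F.res
  res_smul h a s := by
    change F.res h (φ.hom _ a • s) = φ.hom _ (A.res h a) • F.res h s
    rw [F.res_smul, φ.hom_res]
  res_refl := F.res_refl
  res_res := F.res_res
  part := F.part
  isCompl := F.isCompl
  res_mem := F.res_mem
  smul_mem ha hs := F.smul_mem (φ.hom_mem _ _ _ ha) hs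
  glue := F.glue

/-! ### Čech cohomology -/

/-- An open covering of the projective line, indexed by the points (every open covering is refined
by one of these). -/
structure PtCover where
  nhd : PLine → Opens PLine
  mem : ∀ x, x ∈ nhd x

/-- Coverings are preordered by refinement, finer coverings being greater. -/
instance : Preorder PtCover where
  le 𝒰 𝒱 := ∀ x, 𝒱.nhd x ≤ 𝒰.nhd x
  le_refl _ _ := le_rfl
  le_trans _ _ _ h h' x := (h' x).trans (h x)

namespace SuperModSheaf

variable {A : SuperAlgSheaf} (F : SuperModSheaf A) (p : ZMod 2)

/-- Restriction of homogeneous sections of parity `p`. -/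
def resPart {U V : Opens PLine} (h : V ≤ U) : F.part p U →ₗ[ℂ] F.part p V :=
  (F.res h).restrict (F.res_mem h p)

/-- The parity `p` part of the zeroth cohomology: homogeneous global sections. -/
abbrev H0 : Type := F.part p ⊤

/-- Čech `0`-cochains of parity `p`. -/
abbrev C0 (𝒰 : PtCover) : Type := ∀ x, F.part p (𝒰.nhd x)

/-- Čech `1`-cochains of parity `p`. -/
abbrev C1 (𝒰 : PtCover) : Type := ∀ x y, F.part p (𝒰.nhd x ⊓ 𝒰.nhd y)

/-- The Čech differential `(d h)_{xy} = h_y - h_x`. -/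
def d0 (𝒰 : PtCover) : C0 F p 𝒰 →ₗ[ℂ] C1 F p 𝒰 where
  toFun h x y := F.resPart p inf_le_right (h y) - F.resPart p inf_le_left (h x)
  map_add' h h' := by funext x y; simp; abel
  map_smul' c h := by funext x y; simp [smul_sub]

/-- Čech `1`-cocycles of parity `p`: `f_{yz} - f_{xz} + f_{xy} = 0`. -/
def Z1 (𝒰 : PtCover) : Submodule ℂ (C1 F p 𝒰) where
  carrier := {f | ∀ x y z,
    F.resPart p (le_inf (inf_le_left.trans inf_le_right) inf_le_right :
        𝒰.nhd x ⊓ 𝒰.nhd y ⊓ 𝒰.nhd z ≤ 𝒰.nhd y ⊓ 𝒰.nhd z) (f y z)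
      - F.resPart p (le_inf (inf_le_left.trans inf_le_left) inf_le_right :
        𝒰.nhd x ⊓ 𝒰.nhd y ⊓ 𝒰.nhd z ≤ 𝒰.nhd x ⊓ 𝒰.nhd z) (f x z)
      + F.resPart p (inf_le_left :
        𝒰.nhd x ⊓ 𝒰.nhd y ⊓ 𝒰.nhd z ≤ 𝒰.nhd x ⊓ 𝒰.nhd y) (f x y) = 0}
  add_mem' {f g} hf hg x y z := by
    have h := congrArg₂ (· + ·) (hf x y z) (hg x y z)
    simp only [add_zero] at h
    rw [← h]
    simp only [Pi.add_apply, map_add]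
    abel
  zero_mem' x y z := by simp
  smul_mem' c f hf x y z := by
    have h := congrArg (c • ·) (hf x y z)
    simp only [smul_zero] at h
    rw [← h]
    simp only [Pi.smul_apply, map_smul, smul_add, smul_sub]

/-- The parity `p` part of the first Čech cohomology of a covering: cocycles modulo
coboundaries. -/
abbrev H1Cover (𝒰 : PtCover) : Type :=
  Z1 F p 𝒰 ⧸ (LinearMap.range (d0 F p 𝒰)).submoduleOf (Z1 F p 𝒰)

/-- The restriction of `1`-cochains to a finer covering. -/
def refineC1 {𝒰 𝒱 : PtCover} (h : 𝒰 ≤ 𝒱) : C1 F p 𝒰 →ₗ[ℂ] C1 F p 𝒱 where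
  toFun f x y := F.resPart p (inf_le_inf (h x) (h y)) (f x y)
  map_add' f g := by funext x y; simp
  map_smul' c f := by funext x y; simp

theorem resPart_resPart {U V W : Opens PLine} (h : W ≤ V) (h' : V ≤ U) (s : F.part p U) :
    F.resPart p h (F.resPart p h' s) = F.resPart p (h.trans h') s :=
  Subtype.ext (F.res_res h h' s)

theorem refineC1_mem {𝒰 𝒱 : PtCover} (h : 𝒰 ≤ 𝒱) : ∀ f ∈ Z1 F p 𝒰, refineC1 F p h f ∈ Z1 F p 𝒱 := by
  intro f hf x y z
  have := congrArg (F.resPart p (inf_le_inf (inf_le_inf (h x) (h y)) (h z))) (hf x y z)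
  simp only [map_add, map_sub, resPart_resPart, map_zero] at this
  simp only [refineC1, LinearMap.coe_mk, AddHom.coe_mk, resPart_resPart]
  exact this

/-- The map induced on the first Čech cohomology by a refinement. -/
def refineH1 (𝒰 𝒱 : PtCover) (h : 𝒰 ≤ 𝒱) : H1Cover F p 𝒰 →ₗ[ℂ] H1Cover F p 𝒱 :=
  Submodule.mapQ _ _ ((refineC1 F p h).restrict (refineC1_mem F p h)) (by
    rintro ⟨f, hf⟩ ⟨g, hg⟩
    refine ⟨fun x => F.resPart p (h x) (g x), ?_⟩
    change _ = refineC1 F p h f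
    have hg' : d0 F p 𝒰 g = f := hg
    rw [← hg']
    funext x y
    simp [d0, refineC1, resPart_resPart])

/-- The parity `p` part of the first Čech cohomology: the direct limit over all open coverings. -/
abbrev H1 : Type :=
  letI := Classical.decEq PtCover
  Module.DirectLimit (H1Cover F p) (refineH1 F p)

/-- `H⁰(F)` is isomorphic to the vector superspace `ℂ^{m|n}`. -/
def H0IsoC (m n : ℕ) : Prop :=
  Nonempty (F.H0 0 ≃ₗ[ℂ] (Fin m → ℂ)) ∧ Nonempty (F.H0 1 ≃ₗ[ℂ] (Fin n → ℂ))

/-- `H¹(F)` is isomorphic to the vector superspace `ℂ^{m|n}`. -/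
def H1IsoC (m n : ℕ) : Prop :=
  Nonempty (F.H1 0 ≃ₗ[ℂ] (Fin m → ℂ)) ∧ Nonempty (F.H1 1 ≃ₗ[ℂ] (Fin n → ℂ))

end SuperModSheaf

/-! ### The structure sheaf of the projective line and the sheaves `O(n)` -/

theorem mem_ov_iSup {ι : Type} (V : ι → Opens PLine) :
    ∀ z ∈ ov (⨆ i, V i), ∃ i, z ∈ ov (V i) := fun _ hz => by
  obtain ⟨i, hi⟩ := Opens.mem_iSup.1 hz.2
  exact ⟨i, hz.1, hi⟩

theorem mem_ch0_iSup {ι : Type} (V : ι → Opens PLine) :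
    ∀ z ∈ ch0 (⨆ i, V i), ∃ i, z ∈ ch0 (V i) := fun z hz => by
  obtain ⟨i, hi⟩ := Opens.mem_iSup.1 (show (z : PLine) ∈ ⨆ i, V i from hz)
  exact ⟨i, hi⟩

theorem mem_ch1_iSup {ι : Type} (V : ι → Opens PLine) :
    ∀ z ∈ ch1 (⨆ i, V i), ∃ i, z ∈ ch1 (V i) := fun z hz => by
  obtain ⟨i, hi⟩ := Opens.mem_iSup.1 (show chart1 z ∈ ⨆ i, V i from hz)
  exact ⟨i, hi⟩

/-- Pull-back of functions on `U₀ ∩ V` to the overlap. -/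
def Hol.ov0 (V : Opens PLine) : Hol (ch0 V) →ₐ[ℂ] Hol (ov V) := Hol.inv inf_le_left inv_mem_ch0

/-- Restriction of functions on `U₁ ∩ V` to the overlap. -/
def Hol.ov1 (V : Opens PLine) : Hol (ch1 V) →ₐ[ℂ] Hol (ov V) := Hol.res inf_le_right

/-- Restriction of functions on `U₀ ∩ U₁` to `U₀ ∩ U₁ ∩ V`. -/
def Hol.ovC (V : Opens PLine) : Hol Cstar →ₐ[ℂ] Hol (ov V) := Hol.res inf_le_left

/-- The sections of `O(n)` over `V`: pairs of a holomorphic function `f₀(z)` on `U₀ ∩ V` and a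
holomorphic function `f₁(w)` on `U₁ ∩ V` such that `f₁(w) = wⁿ f₀(1 / w)` on the overlap. -/
def OnPair (n : ℤ) (V : Opens PLine) : Set (Hol (ch0 V) × Hol (ch1 V)) :=
  {f | Hol.ov1 V f.2 = Hol.ovC V ((Hol.coordUnit ^ n : (Hol Cstar)ˣ) : Hol Cstar) * Hol.ov0 V f.1}

/-- Restriction of pairs of functions. -/
def Hol.resPair {U V : Opens PLine} (h : V ≤ U) :
    Hol (ch0 U) × Hol (ch1 U) →ₐ[ℂ] Hol (ch0 V) × Hol (ch1 V) :=
  AlgHom.prodMap (Hol.res (ch0_mono h)) (Hol.res (ch1_mono h))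

theorem OnPair_res {n : ℤ} {U V : Opens PLine} (h : V ≤ U) :
    ∀ f ∈ OnPair n U, Hol.resPair h f ∈ OnPair n V := fun f hf => by
  have := congrArg (Hol.res (ov_mono h)) (show Hol.ov1 U f.2 = _ from hf)
  rw [map_mul] at this
  exact this

theorem OnPair_glue {n : ℤ} {ι : Type} (V : ι → Opens PLine)
    (s : ∀ i, Hol (ch0 (V i)) × Hol (ch1 (V i))) (hm : ∀ i, s i ∈ OnPair n (V i))
    (hs : ∀ i j, Hol.resPair inf_le_left (s i) =
      Hol.resPair (inf_le_right : V i ⊓ V j ≤ V j) (s j)) :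
    ∃ t : Hol (ch0 (⨆ i, V i)) × Hol (ch1 (⨆ i, V i)), t ∈ OnPair n (⨆ i, V i) ∧
      (∀ i, Hol.resPair (le_iSup V i) t = s i) ∧
      ∀ t', (∀ i, Hol.resPair (le_iSup V i) t' = s i) → t' = t := by
  obtain ⟨t0, h0⟩ := Hol.glue _ _ (fun i => ch0_mono (le_iSup V i)) (mem_ch0_iSup V)
    (fun i => (s i).1)
    fun i j z hi hj => congrFun (congrArg (fun f => (Prod.fst f).1) (hs i j)) ⟨z, hi, hj⟩
  obtain ⟨t1, h1⟩ := Hol.glue _ _ (fun i => ch1_mono (le_iSup V i)) (mem_ch1_iSup V)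
    (fun i => (s i).2)
    fun i j z hi hj => congrFun (congrArg (fun f => (Prod.snd f).1) (hs i j)) ⟨z, hi, hj⟩
  have ht : ∀ i, Hol.resPair (le_iSup V i) (t0, t1) = s i := fun i => Prod.ext (h0 i) (h1 i)
  refine ⟨(t0, t1), ?_, ht, fun t' ht' => Prod.ext ?_ ?_⟩
  · refine Hol.sep (fun i => ov_mono (le_iSup V i)) (mem_ov_iSup V) fun i => ?_
    have := hm i
    rw [← ht i] at this
    rw [map_mul]
    exact this
  · exact Hol.sep (fun i => ch0_mono (le_iSup V i)) (mem_ch0_iSup V)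
      fun i => congrArg Prod.fst ((ht' i).trans (ht i).symm)
  · exact Hol.sep (fun i => ch1_mono (le_iSup V i)) (mem_ch1_iSup V)
      fun i => congrArg Prod.snd ((ht' i).trans (ht i).symm)

/-- The holomorphic functions on an open subset of the projective line: pairs of holomorphic
functions in the two charts which agree on the overlap. -/
def opSubalgebra (V : Opens PLine) : Subalgebra ℂ (Hol (ch0 V) × Hol (ch1 V)) :=
  AlgHom.equalizer ((Hol.ov1 V).comp (AlgHom.snd ℂ _ _)) ((Hol.ov0 V).comp (AlgHom.fst ℂ _ _))

theorem mem_opSubalgebra {V : Opens PLine} {f : Hol (ch0 V) × Hol (ch1 V)} :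
    f ∈ opSubalgebra V ↔ Hol.ov1 V f.2 = Hol.ov0 V f.1 := Iff.rfl

theorem mem_opSubalgebra_iff {V : Opens PLine} {f : Hol (ch0 V) × Hol (ch1 V)} :
    f ∈ opSubalgebra V ↔ f ∈ OnPair 0 V := by
  simp only [mem_opSubalgebra, OnPair, zpow_zero, Units.val_one, map_one, one_mul, Set.mem_ofPred_eq]

/-- The algebra of holomorphic functions on an open subset of the projective line. -/
def OP (V : Opens PLine) : Type := opSubalgebra V

instance (V : Opens PLine) : CommRing (OP V) := inferInstanceAs (CommRing (opSubalgebra V))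

instance (V : Opens PLine) : Algebra ℂ (OP V) := inferInstanceAs (Algebra ℂ (opSubalgebra V))

/-- The restriction maps of holomorphic functions. -/
def OP.res {U V : Opens PLine} (h : V ≤ U) : OP U →ₐ[ℂ] OP V :=
  ((Hol.resPair h).comp (opSubalgebra U).val).codRestrict (opSubalgebra V) fun f =>
    mem_opSubalgebra_iff.2 (OnPair_res h _ (mem_opSubalgebra_iff.1 f.2))

theorem OP.glue {ι : Type} (V : ι → Opens PLine) (s : ∀ i, OP (V i))
    (hs : ∀ i j, OP.res inf_le_left (s i) = OP.res (inf_le_right : V i ⊓ V j ≤ V j) (s j)) :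
    ∃! t : OP (⨆ i, V i), ∀ i, OP.res (le_iSup V i) t = s i := by
  obtain ⟨t, hm, ht, hu⟩ := OnPair_glue (n := 0) V (fun i => (s i).1)
    (fun i => mem_opSubalgebra_iff.1 (s i).2) fun i j => congrArg Subtype.val (hs i j)
  exact ⟨⟨t, mem_opSubalgebra_iff.2 hm⟩, fun i => Subtype.ext (ht i), fun y hy =>
    Subtype.ext (hu _ fun i => congrArg Subtype.val (hy i))⟩

/-- The grading of a purely even module. -/
def evenPart (M : Type) [AddCommGroup M] [Module ℂ M] (p : ZMod 2) : Submodule ℂ M :=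
  if p = 0 then ⊤ else ⊥

theorem evenPart_zero (M : Type) [AddCommGroup M] [Module ℂ M] : evenPart M 0 = ⊤ := if_pos rfl

theorem evenPart_one (M : Type) [AddCommGroup M] [Module ℂ M] : evenPart M 1 = ⊥ :=
  if_neg (by decide)

theorem isCompl_evenPart (M : Type) [AddCommGroup M] [Module ℂ M] :
    IsCompl (evenPart M 0) (evenPart M 1) := by
  rw [evenPart_zero, evenPart_one]; exact isCompl_top_bot

theorem evenPart_map {M N : Type} [AddCommGroup M] [Module ℂ M] [AddCommGroup N] [Module ℂ N]
    (f : M →ₗ[ℂ] N) (p : ZMod 2) : ∀ s ∈ evenPart M p, f s ∈ evenPart N p := fun s hs => by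
  rcases zmod2_cases p with rfl | rfl
  · rw [evenPart_zero]; trivial
  · rw [evenPart_one, Submodule.mem_bot] at hs ⊢
    rw [hs, map_zero]

theorem evenPart_smul {A M : Type} [CommRing A] [Algebra ℂ A] [AddCommGroup M] [Module ℂ M]
    [Module A M] {p q : ZMod 2} {a : A} {s : M} (ha : a ∈ evenPart A p) (hs : s ∈ evenPart M q) :
    a • s ∈ evenPart M (p + q) := by
  rcases zmod2_cases p with rfl | rfl
  · rcases zmod2_cases q with rfl | rfl
    · rw [add_zero, evenPart_zero]; trivial
    · rw [evenPart_one, Submodule.mem_bot] at hs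
      rw [hs, smul_zero]; exact zero_mem _
  · rw [evenPart_one, Submodule.mem_bot] at ha
    rw [ha, zero_smul]; exact zero_mem _

/-- The structure sheaf of the projective line, as a purely even sheaf of superalgebras. -/
def sheafOP : SuperAlgSheaf where
  obj := OP
  res := OP.res
  res_refl _ := rfl
  res_res _ _ _ := rfl
  part p V := evenPart (OP V) p
  isCompl V := isCompl_evenPart (OP V)
  res_mem h p := evenPart_map (OP.res h).toLinearMap p
  one_mem V := by rw [evenPart_zero]; trivial
  mul_mem {U _ _ _ _} ha hb := evenPart_smul (A := OP U) (M := OP U) ha hb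
  supercomm {U a b} ha hb := by
    rw [evenPart_one, Submodule.mem_bot] at ha
    rw [ha, zero_mul, mul_zero, neg_zero]
  glue := OP.glue

/-- The sections of `O(n)` as a module over the holomorphic functions. -/
def onSubmodule (n : ℤ) (V : Opens PLine) :
    Submodule (opSubalgebra V) (Hol (ch0 V) × Hol (ch1 V)) where
  carrier := OnPair n V
  add_mem' {f g} hf hg := by
    change Hol.ov1 V f.2 = _ at hf
    change Hol.ov1 V g.2 = _ at hg
    change Hol.ov1 V (f.2 + g.2) = _ * Hol.ov0 V (f.1 + g.1)
    rw [map_add, map_add, hf, hg, mul_add]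
  zero_mem' := by
    change Hol.ov1 V 0 = _ * Hol.ov0 V 0
    rw [map_zero, map_zero, mul_zero]
  smul_mem' a f hf := by
    have ha := mem_opSubalgebra.1 a.2
    change Hol.ov1 V f.2 = _ at hf
    change Hol.ov1 V (a.1.2 * f.2) = _ * Hol.ov0 V (a.1.1 * f.1)
    rw [map_mul, map_mul, hf, ha]
    ring

/-- The module of sections of `O(n)`. -/
def On (n : ℤ) (V : Opens PLine) : Type := onSubmodule n V

instance (n : ℤ) (V : Opens PLine) : AddCommGroup (On n V) :=
  inferInstanceAs (AddCommGroup (onSubmodule n V))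

instance (n : ℤ) (V : Opens PLine) : Module (OP V) (On n V) :=
  inferInstanceAs (Module (opSubalgebra V) (onSubmodule n V))

instance (n : ℤ) (V : Opens PLine) : Module ℂ (On n V) :=
  Module.compHom _ (algebraMap ℂ (OP V))

instance (n : ℤ) (V : Opens PLine) : IsScalarTower ℂ (OP V) (On n V) :=
  IsScalarTower.of_algebraMap_smul fun _ _ => rfl

/-- The restriction maps of `O(n)`. -/
def On.res {n : ℤ} {U V : Opens PLine} (h : V ≤ U) : On n U →ₗ[ℂ] On n V where
  toFun f := ⟨Hol.resPair h f.1, OnPair_res h _ f.2⟩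
  map_add' _ _ := rfl
  map_smul' _ _ := rfl

theorem On.res_smul {n : ℤ} {U V : Opens PLine} (h : V ≤ U) (a : OP U) (s : On n U) :
    On.res h (a • s) = OP.res h a • On.res h s := rfl

theorem On.glue {n : ℤ} {ι : Type} (V : ι → Opens PLine) (s : ∀ i, On n (V i))
    (hs : ∀ i j, On.res inf_le_left (s i) = On.res (inf_le_right : V i ⊓ V j ≤ V j) (s j)) :
    ∃! t : On n (⨆ i, V i), ∀ i, On.res (le_iSup V i) t = s i := by
  obtain ⟨t, hm, ht, hu⟩ := OnPair_glue (n := n) V (fun i => (s i).1)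
    (fun i => (s i).2) fun i j => congrArg Subtype.val (hs i j)
  exact ⟨⟨t, hm⟩, fun i => Subtype.ext (ht i), fun y hy =>
    Subtype.ext (hu _ fun i => congrArg Subtype.val (hy i))⟩

/-- The invertible sheaf `O(n)` on the projective line, purely even. -/
def sheafO (n : ℤ) : SuperModSheaf sheafOP where
  obj := On n
  module V := inferInstanceAs (Module (OP V) (On n V))
  tower V := inferInstanceAs (IsScalarTower ℂ (OP V) (On n V))
  res := On.res
  res_smul := On.res_smul
  res_refl _ := rfl
  res_res _ _ _ := rfl
  part p V := evenPart (On n V) p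
  isCompl V := isCompl_evenPart (On n V)
  res_mem h := evenPart_map (On.res h)
  smul_mem {U _ _ _ _} ha hs := evenPart_smul (A := OP U) (M := On n U) ha hs
  glue := On.glue

instance (n : ℤ) (V : Opens PLine) : Module (OP V)ᵐᵒᵖ (On n V) :=
  Module.compHom _ (RingEquiv.toOpposite (OP V)).symm.toRingHom

instance (n : ℤ) (V : Opens PLine) : IsCentralScalar (OP V) (On n V) := ⟨fun _ _ => rfl⟩

instance (n : ℤ) (V : Opens PLine) : IsScalarTower ℂ (OP V)ᵐᵒᵖ (On n V) :=
  ⟨fun c a s => smul_assoc c a.unop s⟩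

/-- Restriction for the split supermanifold, on each of the two summands. -/
def splitRes {n : ℤ} {U V : Opens PLine} (h : V ≤ U) :
    TrivSqZeroExt (OP U) (On n U) →ₐ[ℂ] TrivSqZeroExt (OP V) (On n V) :=
  AlgHom.ofLinearMap
    { toFun := fun f => TrivSqZeroExt.inl (OP.res h f.fst) + TrivSqZeroExt.inr (On.res h f.snd)
      map_add' := fun x y => by
        refine TrivSqZeroExt.ext ?_ ?_ <;> simp
      map_smul' := fun r x => by
        refine TrivSqZeroExt.ext ?_ ?_ <;> simp }
    (by refine TrivSqZeroExt.ext ?_ ?_ <;> simp)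
    (fun x y => by refine TrivSqZeroExt.ext ?_ ?_ <;> simp [On.res_smul])

theorem fst_splitRes {n : ℤ} {U V : Opens PLine} (h : V ≤ U) (f : TrivSqZeroExt (OP U) (On n U)) :
    (splitRes h f).fst = OP.res h f.fst := by simp [splitRes]

theorem snd_splitRes {n : ℤ} {U V : Opens PLine} (h : V ≤ U) (f : TrivSqZeroExt (OP U) (On n U)) :
    (splitRes h f).snd = On.res h f.snd := by simp [splitRes]

/-- The structure sheaf of the split supermanifold of dimension `1|1` determined by the pair
`(ℙ¹, O(n))`: the exterior algebra of `O(n)`, that is, `O ⊕ Π O(n)`, where the product of two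
sections of `O(n)` is zero. -/
def sheafSplit (n : ℤ) : SuperAlgSheaf where
  obj V := TrivSqZeroExt (OP V) (On n V)
  res := splitRes
  res_refl s := TrivSqZeroExt.ext (fst_splitRes _ s) (snd_splitRes _ s)
  res_res h h' s := TrivSqZeroExt.ext
    (by rw [fst_splitRes, fst_splitRes, fst_splitRes]; rfl)
    (by rw [snd_splitRes, snd_splitRes, snd_splitRes]; rfl)
  part p V := dpart (OP V) (On n V) p
  isCompl V := isCompl_dpart _ _
  res_mem h p s hs := ⟨fun hp => by rw [snd_splitRes, hs.1 hp, map_zero],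
    fun hp => by rw [fst_splitRes, hs.2 hp, map_zero]⟩
  one_mem _ := mem_dpart_zero.2 TrivSqZeroExt.snd_one
  mul_mem ha hb := dpart_mul ha hb
  supercomm ha hb := by
    rw [mem_dpart_one] at ha hb
    refine TrivSqZeroExt.ext ?_ ?_ <;> simp [ha, hb]
  glue V s hs := by
    obtain ⟨t, ht, ht'⟩ := OP.glue V (fun i => (s i).fst) fun i j => by
      rw [← fst_splitRes, hs i j, fst_splitRes]
    obtain ⟨u, hu, hu'⟩ := On.glue V (fun i => (s i).snd) fun i j => by
      rw [← snd_splitRes, hs i j, snd_splitRes]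
    refine ⟨TrivSqZeroExt.inl t + TrivSqZeroExt.inr u, fun i => TrivSqZeroExt.ext ?_ ?_,
      fun y hy => TrivSqZeroExt.ext ?_ ?_⟩
    · rw [fst_splitRes]; simpa using ht i
    · rw [snd_splitRes]; simpa using hu i
    · simpa using ht' y.fst fun i => by rw [← fst_splitRes, hy i]
    · simpa using hu' y.snd fun i => by rw [← snd_splitRes, hy i]

/-! ### The `Π`-projective line

The `Π`-projective line parametrizes the `1|1`-dimensional `Π`-symmetric subspaces of `ℂ^{2|2}`. It
is covered by two affine superspaces `ℂ^{1|1}`, with coordinates `(z | θ)` on `U₀` and `(w | ψ)` on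
`U₁`, a point being the row space of the corresponding big cell below. -/

/-- The big cell of the chart `U₀`, with columns `(e₁, e₂ | π e₁, π e₂)`. -/
def bigCell0 {A : Type} [CommRing A] (z θ : A) : Matrix (Fin 2) (Fin 4) A :=
  !![1, z, 0, θ; 0, -θ, 1, z]

/-- The big cell of the chart `U₁`, with columns `(e₁, e₂ | π e₁, π e₂)`. -/
def bigCell1 {A : Type} [CommRing A] (w ψ : A) : Matrix (Fin 2) (Fin 4) A :=
  !![w, 1, ψ, 0; -ψ, 0, w, 1]

/-- The even coordinate `w` of the chart `U₁`, on the overlap. -/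
def coordW : SF Cstar := SF.mk (Hol.coord Cstar) 0

/-- The odd coordinate `ψ` of the chart `U₁`, on the overlap. -/
def coordPsi : SF Cstar := SF.mk 0 1

/-- The even coordinate of the chart `U₀` in terms of those of `U₁`: `z = 1 / w`. -/
def coordZ : SF Cstar := SF.mk Hol.coordInv 0

/-- The odd coordinate of the chart `U₀` in terms of those of `U₁`: `θ = - ψ / w²`. -/
def coordTheta : SF Cstar := SF.mk 0 (-Hol.coordInv ^ 2)

theorem ov_le_Cstar (V : Opens PLine) : ov V ≤ Cstar := inf_le_left

theorem ov_le_ch1 (V : Opens PLine) : ov V ≤ ch1 V := inf_le_right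

/-- Change of coordinates from `U₀` to the overlap: `f(z, θ) ↦ f(1 / w, - ψ / w²)`. -/
def SF.ov0 (V : Opens PLine) : SF (ch0 V) →ₐ[ℂ] SF (ov V) :=
  SF.pull (Hol.ov0 V) (Hol.ovC V coordTheta.snd)

/-- Restriction of superfunctions on `U₁ ∩ V` to the overlap. -/
def SF.ov1 (V : Opens PLine) : SF (ch1 V) →ₐ[ℂ] SF (ov V) := SF.res (ov_le_ch1 V)

/-- Restriction of superfunctions on `U₀ ∩ U₁` to `U₀ ∩ U₁ ∩ V`. -/
def SF.ovC (V : Opens PLine) : SF Cstar →ₐ[ℂ] SF (ov V) := SF.res (ov_le_Cstar V)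

theorem SF.res_ov0 {U V : Opens PLine} (h : V ≤ U) (f : SF (ch0 U)) :
    SF.res (ov_mono h) (SF.ov0 U f) = SF.ov0 V (SF.res (ch0_mono h) f) := by
  refine TrivSqZeroExt.ext ?_ ?_
  · rw [SF.fst_res, SF.ov0, SF.ov0, SF.fst_pull, SF.fst_pull, SF.fst_res]; rfl
  · rw [SF.snd_res, SF.ov0, SF.ov0, SF.snd_pull, SF.snd_pull, SF.snd_res, map_mul]; rfl

theorem SF.res_ov1 {U V : Opens PLine} (h : V ≤ U) (f : SF (ch1 U)) :
    SF.res (ov_mono h) (SF.ov1 U f) = SF.ov1 V (SF.res (ch1_mono h) f) := by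
  exact (SF.res_res (ov_mono h) (ov_le_ch1 U) f).trans
    (SF.res_res (ov_le_ch1 V) (ch1_mono h) f).symm

theorem SF.res_ovC {U V : Opens PLine} (h : V ≤ U) (f : SF Cstar) :
    SF.res (ov_mono h) (SF.ovC U f) = SF.ovC V f := by
  exact SF.res_res (ov_mono h) (ov_le_Cstar U) f

/-- Restriction of pairs of superfunctions. -/
def SF.resPair {U V : Opens PLine} (h : V ≤ U) :
    SF (ch0 U) × SF (ch1 U) →ₐ[ℂ] SF (ch0 V) × SF (ch1 V) :=
  AlgHom.prodMap (SF.res (ch0_mono h)) (SF.res (ch1_mono h))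

/-- The homogeneous component of parity `q` of a superfunction. -/
def dproj {R : Type} [CommRing R] [Algebra ℂ R] (q : ZMod 2) : DualNumber R →ₗ[ℂ] DualNumber R where
  toFun f := SF.mk (if q = 0 then f.fst else 0) (if q = 0 then 0 else f.snd)
  map_add' x y := by
    by_cases hq : q = 0 <;> refine TrivSqZeroExt.ext ?_ ?_ <;> simp [SF.fst_mk, SF.snd_mk, hq]
  map_smul' c x := by
    by_cases hq : q = 0 <;> refine TrivSqZeroExt.ext ?_ ?_ <;> simp [SF.fst_mk, SF.snd_mk, hq]

theorem fst_dproj {R : Type} [CommRing R] [Algebra ℂ R] (q : ZMod 2) (f : DualNumber R) :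
    (dproj q f).fst = if q = 0 then f.fst else 0 := rfl

theorem snd_dproj {R : Type} [CommRing R] [Algebra ℂ R] (q : ZMod 2) (f : DualNumber R) :
    (dproj q f).snd = if q = 0 then 0 else f.snd := rfl

theorem dproj_mem {R : Type} [CommRing R] [Algebra ℂ R] (q : ZMod 2) (f : DualNumber R) :
    dproj q f ∈ dpart R R q :=
  ⟨fun h => by rw [snd_dproj, if_pos h], fun h => by rw [fst_dproj, h, if_neg (by decide)]⟩

theorem dproj_add {R : Type} [CommRing R] [Algebra ℂ R] (q : ZMod 2) (f : DualNumber R) :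
    dproj q f + dproj (1 + q) f = f := by
  rcases zmod2_cases q with rfl | rfl
  · refine TrivSqZeroExt.ext ?_ ?_ <;> simp [fst_dproj, snd_dproj]
  · have : (1 : ZMod 2) + 1 = 0 := by decide
    refine TrivSqZeroExt.ext ?_ ?_ <;> simp [fst_dproj, snd_dproj, this]

theorem dproj_pull {R R' : Type} [CommRing R] [Algebra ℂ R] [CommRing R'] [Algebra ℂ R']
    (α : R →ₐ[ℂ] R') (c : R') (q : ZMod 2) (f : DualNumber R) :
    SF.pull α c (dproj q f) = dproj q (SF.pull α c f) := by
  by_cases hq : q = 0 <;> refine TrivSqZeroExt.ext ?_ ?_ <;>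
    simp [fst_dproj, snd_dproj, SF.fst_pull, SF.snd_pull, hq]

theorem dproj_mul {R : Type} [CommRing R] [Algebra ℂ R] {q r : ZMod 2} (f : DualNumber R)
    {m : DualNumber R} (hm : m ∈ dpart R R r) : dproj q f * m = dproj (q + r) (f * m) := by
  have h11 : (1 : ZMod 2) + 1 = 0 := by decide
  rcases zmod2_cases r with rfl | rfl
  · rw [mem_dpart_zero] at hm
    by_cases hq : q = 0 <;> refine TrivSqZeroExt.ext ?_ ?_ <;>
      simp [fst_dproj, snd_dproj, hm, hq]
  · rw [mem_dpart_one] at hm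
    rcases zmod2_cases q with rfl | rfl <;> refine TrivSqZeroExt.ext ?_ ?_ <;>
      simp [fst_dproj, snd_dproj, hm, h11]

theorem dpart_disjoint {R : Type} [CommRing R] [Algebra ℂ R] {q : ZMod 2} {f : DualNumber R}
    (h : f ∈ dpart R R q) (h' : f ∈ dpart R R (1 + q)) : f = 0 := by
  rcases zmod2_cases q with rfl | rfl
  · rw [add_zero] at h'
    exact TrivSqZeroExt.ext (mem_dpart_one.1 h') (mem_dpart_zero.1 h)
  · rw [show (1 : ZMod 2) + 1 = 0 from by decide] at h'
    exact TrivSqZeroExt.ext (mem_dpart_one.1 h) (mem_dpart_zero.1 h')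

/-- The superfunctions on an open subset of the `Π`-projective line: pairs of superfunctions in the
two charts which agree on the overlap under the change of coordinates. -/
def oPiSubalgebra (V : Opens PLine) : Subalgebra ℂ (SF (ch0 V) × SF (ch1 V)) :=
  AlgHom.equalizer ((SF.ov1 V).comp (AlgHom.snd ℂ _ _)) ((SF.ov0 V).comp (AlgHom.fst ℂ _ _))

theorem mem_oPiSubalgebra {V : Opens PLine} {f : SF (ch0 V) × SF (ch1 V)} :
    f ∈ oPiSubalgebra V ↔ SF.ov1 V f.2 = SF.ov0 V f.1 := Iff.rfl

/-- The algebra of superfunctions on an open subset of the `Π`-projective line. -/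
def OPi (V : Opens PLine) : Type := oPiSubalgebra V

instance (V : Opens PLine) : CommRing (OPi V) := inferInstanceAs (CommRing (oPiSubalgebra V))

instance (V : Opens PLine) : Algebra ℂ (OPi V) := inferInstanceAs (Algebra ℂ (oPiSubalgebra V))

/-- The restriction maps of superfunctions. -/
def OPi.res {U V : Opens PLine} (h : V ≤ U) : OPi U →ₐ[ℂ] OPi V :=
  ((SF.resPair h).comp (oPiSubalgebra U).val).codRestrict (oPiSubalgebra V) fun f => by
    have := congrArg (SF.res (ov_mono h)) (mem_oPiSubalgebra.1 f.2)
    rw [SF.res_ov0 h, SF.res_ov1 h] at this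
    exact this

/-- The grading of the superfunctions. -/
def OPi.part (p : ZMod 2) (V : Opens PLine) : Submodule ℂ (OPi V) where
  carrier := {f | f.1.1 ∈ dpart (Hol (ch0 V)) (Hol (ch0 V)) p ∧
    f.1.2 ∈ dpart (Hol (ch1 V)) (Hol (ch1 V)) p}
  add_mem' hf hg := ⟨add_mem hf.1 hg.1, add_mem hf.2 hg.2⟩
  zero_mem' := ⟨zero_mem _, zero_mem _⟩
  smul_mem' c _ hf := ⟨Submodule.smul_mem _ c hf.1, Submodule.smul_mem _ c hf.2⟩

theorem SF.glue_pair {ι : Type} (V : ι → Opens PLine) (s : ∀ i, SF (ch0 (V i)) × SF (ch1 (V i)))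
    (hs : ∀ i j, SF.resPair inf_le_left (s i) =
      SF.resPair (inf_le_right : V i ⊓ V j ≤ V j) (s j)) :
    ∃! t : SF (ch0 (⨆ i, V i)) × SF (ch1 (⨆ i, V i)),
      ∀ i, SF.resPair (le_iSup V i) t = s i := by
  obtain ⟨t0, h0⟩ := SF.glue _ _ (fun i => ch0_mono (le_iSup V i)) (mem_ch0_iSup V)
    (fun i => (s i).1) fun i j => congrArg Prod.fst (hs i j)
  obtain ⟨t1, h1⟩ := SF.glue _ _ (fun i => ch1_mono (le_iSup V i)) (mem_ch1_iSup V)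
    (fun i => (s i).2) fun i j => congrArg Prod.snd (hs i j)
  refine ⟨(t0, t1), fun i => Prod.ext (h0 i) (h1 i), fun y hy => Prod.ext ?_ ?_⟩
  · exact SF.sep (fun i => ch0_mono (le_iSup V i)) (mem_ch0_iSup V) fun i =>
      (congrArg Prod.fst (hy i)).trans (h0 i).symm
  · exact SF.sep (fun i => ch1_mono (le_iSup V i)) (mem_ch1_iSup V) fun i =>
      (congrArg Prod.snd (hy i)).trans (h1 i).symm

/-- The structure sheaf of the `Π`-projective line. -/
def sheafOPi : SuperAlgSheaf where
  obj := OPi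
  res := OPi.res
  res_refl s := Subtype.ext (Prod.ext (SF.res_refl _) (SF.res_refl _))
  res_res h h' s := Subtype.ext (Prod.ext (SF.res_res _ _ _) (SF.res_res _ _ _))
  part := OPi.part
  isCompl V := by
    constructor
    · rw [Submodule.disjoint_def]
      intro x h0 h1
      exact Subtype.ext (Prod.ext (dpart_disjoint h0.1 h1.1) (dpart_disjoint h0.2 h1.2))
    · rw [codisjoint_iff, Submodule.eq_top_iff']
      intro x
      have hx : ∀ q, (dproj q x.1.1, dproj q x.1.2) ∈ oPiSubalgebra V := fun q => by
        have h := mem_oPiSubalgebra.1 x.2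
        rw [mem_oPiSubalgebra]
        simp only [SF.ov0, SF.ov1, SF.res] at h ⊢
        rw [dproj_pull, dproj_pull, h]
      have hs : x = (⟨_, hx 0⟩ + ⟨_, hx 1⟩ : oPiSubalgebra V) :=
        Subtype.ext (Prod.ext (dproj_add 0 _).symm (dproj_add 0 _).symm)
      rw [hs]
      exact Submodule.add_mem_sup ⟨dproj_mem _ _, dproj_mem _ _⟩ ⟨dproj_mem _ _, dproj_mem _ _⟩
  res_mem h p s hs := ⟨SF.pull_mem _ _ hs.1, SF.pull_mem _ _ hs.2⟩
  one_mem V := ⟨mem_dpart_zero.2 TrivSqZeroExt.snd_one, mem_dpart_zero.2 TrivSqZeroExt.snd_one⟩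
  mul_mem ha hb := ⟨dpart_mul ha.1 hb.1, dpart_mul ha.2 hb.2⟩
  supercomm {U a b} ha hb := by
    have h : ∀ {R : Type} [CommRing R] [Algebra ℂ R] {x y : DualNumber R}, x ∈ dpart R R 1 →
        y ∈ dpart R R 1 → x * y = -(y * x) := by
      intro R _ _ x y hx hy
      rw [mem_dpart_one] at hx hy
      refine TrivSqZeroExt.ext ?_ ?_ <;> simp [hx, hy]
    exact Subtype.ext (Prod.ext (h ha.1 hb.1) (h ha.2 hb.2))
  glue V s hs := by
    obtain ⟨t, ht, hu⟩ := SF.glue_pair V (fun i => (s i).1) fun i j => congrArg Subtype.val (hs i j)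
    refine ⟨⟨t, mem_oPiSubalgebra.2 ?_⟩, fun i => Subtype.ext (ht i), fun y hy =>
      Subtype.ext (hu _ fun i => congrArg Subtype.val (hy i))⟩
    refine SF.sep (fun i => ov_mono (le_iSup V i)) (mem_ov_iSup V) fun i => ?_
    rw [SF.res_ov0 (le_iSup V i), SF.res_ov1 (le_iSup V i)]
    have := mem_oPiSubalgebra.1 (s i).2
    rw [← ht i] at this
    exact this

theorem inl_mem_oPiSubalgebra {V : Opens PLine} {f : Hol (ch0 V) × Hol (ch1 V)}
    (hf : f ∈ opSubalgebra V) :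
    ((TrivSqZeroExt.inl f.1, TrivSqZeroExt.inl f.2) : SF (ch0 V) × SF (ch1 V)) ∈
      oPiSubalgebra V := by
  refine mem_oPiSubalgebra.2 (TrivSqZeroExt.ext ?_ ?_)
  · rw [SF.ov0, SF.fst_pull]
    exact (SF.fst_res _ _).trans (mem_opSubalgebra.1 hf)
  · rw [SF.ov0, SF.snd_pull, TrivSqZeroExt.snd_inl, map_zero, zero_mul]
    exact (SF.snd_res _ _).trans (map_zero _)

theorem eq_zero_of_mem_evenPart {M : Type} [AddCommGroup M] [Module ℂ M] {s : M}
    (hs : s ∈ evenPart M 1) : s = 0 := by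
  rwa [evenPart_one, Submodule.mem_bot] at hs

theorem inl_res {S T : Opens ℂ} (h : S ≤ T) (f : Hol T) :
    (TrivSqZeroExt.inl (Hol.res h f) : SF S) = SF.res h (TrivSqZeroExt.inl f) :=
  TrivSqZeroExt.ext (SF.fst_res h (TrivSqZeroExt.inl f)).symm
    ((SF.snd_res h (TrivSqZeroExt.inl f)).trans (map_zero _)).symm

/-- The projection of the `Π`-projective line to its reduced space: a holomorphic function is
regarded as a superfunction which does not depend on the odd coordinate. -/
def projHom : sheafOP.Hom sheafOPi where
  hom V :=
    { toFun := fun f => ⟨(TrivSqZeroExt.inl f.1.1, TrivSqZeroExt.inl f.1.2),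
        inl_mem_oPiSubalgebra f.2⟩
      map_one' := rfl
      map_mul' := fun f g => Subtype.ext (Prod.ext (TrivSqZeroExt.inl_mul _ _ _)
        (TrivSqZeroExt.inl_mul _ _ _))
      map_zero' := rfl
      map_add' := fun f g => Subtype.ext (Prod.ext (TrivSqZeroExt.inl_add _ _ _)
        (TrivSqZeroExt.inl_add _ _ _))
      commutes' := fun _ => rfl }
  hom_res h s := Subtype.ext (Prod.ext (inl_res (ch0_mono h) s.1.1) (inl_res (ch1_mono h) s.1.2))
  hom_mem V p s hs := by
    rcases zmod2_cases p with rfl | rfl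
    · exact ⟨mem_dpart_zero.2 rfl, mem_dpart_zero.2 rfl⟩
    · have h : s = (0 : OP V) := eq_zero_of_mem_evenPart (M := OP V) hs
      rw [h]
      exact ⟨mem_dpart_one.2 rfl, mem_dpart_one.2 rfl⟩

/-! ### Locally free sheaves on the `Π`-projective line -/

/-- A locally free sheaf on the `Π`-projective line, given by its transition matrix: it has frames
`(eᵢ)` over `U₀` and `(e'ⱼ)` over `U₁`, with `eᵢ` and `e'ᵢ` of parity `par i`, and on the overlap
`eᵢ = ∑ⱼ g i j • e'ⱼ`. -/
structure Bundle where
  ι : Type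
  [fintype : Fintype ι]
  [decidableEq : DecidableEq ι]
  par : ι → ZMod 2
  g : Matrix ι ι (SF Cstar)
  even : IsEvenMat par g
  unit : IsUnit g

attribute [instance] Bundle.fintype Bundle.decidableEq

namespace Bundle

variable (E : Bundle)

/-- Coefficients of sections with respect to the two frames. -/
abbrev Coef (V : Opens PLine) : Type := E.ι → SF (ch0 V) × SF (ch1 V)

/-- The sections `∑ᵢ fᵢ • eᵢ = ∑ⱼ f'ⱼ • e'ⱼ` over `V`, that is, `f'ⱼ = ∑ᵢ fᵢ g i j`. -/
def secSubmodule (V : Opens PLine) : Submodule (oPiSubalgebra V) (E.Coef V) where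
  carrier := {s | ∀ j, SF.ov1 V (s j).2 = ∑ i, SF.ov0 V (s i).1 * SF.ovC V (E.g i j)}
  add_mem' {s t} hs ht j := by
    change SF.ov1 V ((s j).2 + (t j).2) = ∑ i, SF.ov0 V ((s i).1 + (t i).1) * SF.ovC V (E.g i j)
    simp only [map_add, hs j, ht j, add_mul, Finset.sum_add_distrib]
  zero_mem' j := by
    change SF.ov1 V 0 = ∑ i, SF.ov0 V 0 * SF.ovC V (E.g i j)
    simp only [map_zero, zero_mul, Finset.sum_const_zero]
  smul_mem' a s hs j := by
    have ha := mem_oPiSubalgebra.1 a.2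
    change SF.ov1 V (a.1.2 * (s j).2) =
      ∑ i, SF.ov0 V (a.1.1 * (s i).1) * SF.ovC V (E.g i j)
    simp only [map_mul, hs j, ha, mul_assoc, Finset.mul_sum]

/-- The module of sections. -/
def Sec (V : Opens PLine) : Type := E.secSubmodule V

instance (V : Opens PLine) : AddCommGroup (E.Sec V) :=
  inferInstanceAs (AddCommGroup (E.secSubmodule V))

instance instModuleSec (V : Opens PLine) : Module (OPi V) (E.Sec V) :=
  (E.secSubmodule V).module

instance (V : Opens PLine) : Module ℂ (E.Sec V) :=
  Module.compHom _ (algebraMap ℂ (OPi V))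

instance instTowerSec (V : Opens PLine) : IsScalarTower ℂ (OPi V) (E.Sec V) :=
  IsScalarTower.of_algebraMap_smul fun _ _ => rfl

variable {E}

theorem Sec.smul_val {V : Opens PLine} (a : OPi V) (s : E.Sec V) (i : E.ι) :
    (a • s).1 i = a.1 * s.1 i := rfl

theorem Sec.csmul_val {V : Opens PLine} (c : ℂ) (s : E.Sec V) (i : E.ι) :
    (c • s).1 i = c • s.1 i := (Algebra.smul_def c (s.1 i)).symm

theorem res_mem {U V : Opens PLine} (h : V ≤ U) {s : E.Coef U} (hs : s ∈ E.secSubmodule U) :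
    (fun i => SF.resPair h (s i)) ∈ E.secSubmodule V := fun j => by
  have := congrArg (SF.res (ov_mono h)) (hs j)
  simp only [map_sum, map_mul, SF.res_ov0 h, SF.res_ov1 h, SF.res_ovC h] at this
  exact this

/-- The restriction of a section. -/
def Sec.resFun {U V : Opens PLine} (h : V ≤ U) (s : E.Sec U) : E.Sec V :=
  ⟨fun i => SF.resPair h (s.1 i), res_mem h s.2⟩

/-- The restriction maps. -/
def Sec.res {U V : Opens PLine} (h : V ≤ U) : E.Sec U →ₗ[ℂ] E.Sec V where
  toFun := Sec.resFun h
  map_add' s t := Subtype.ext (funext fun i => map_add (SF.resPair h) (s.1 i) (t.1 i))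
  map_smul' c s := Subtype.ext (funext fun i =>
    ((congrArg (SF.resPair h) (Sec.csmul_val c s i)).trans
      (map_smul (SF.resPair h) c (s.1 i))).trans (Sec.csmul_val c (Sec.resFun h s) i).symm)

theorem Sec.res_smul {U V : Opens PLine} (h : V ≤ U) (a : OPi U) (s : E.Sec U) :
    Sec.res h (a • s) = OPi.res h a • Sec.res h s :=
  Subtype.ext (funext fun i => map_mul (SF.resPair h) a.1 (s.1 i))

variable (E)

theorem Sec.ext {V : Opens PLine} {s t : E.Sec V} (h : ∀ i, (s.1 i).1 = (t.1 i).1)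
    (h' : ∀ i, (s.1 i).2 = (t.1 i).2) : s = t :=
  Subtype.ext (funext fun i => Prod.ext (h i) (h' i))

/-- The grading: `∑ᵢ fᵢ • eᵢ` has parity `p` if each `fᵢ` has parity `p + par i`. -/
def partSec (p : ZMod 2) (V : Opens PLine) : Submodule ℂ (E.Sec V) where
  carrier := {s | ∀ i, (s.1 i).1 ∈ dpart (Hol (ch0 V)) (Hol (ch0 V)) (p + E.par i) ∧
    (s.1 i).2 ∈ dpart (Hol (ch1 V)) (Hol (ch1 V)) (p + E.par i)}
  add_mem' hs ht i := ⟨add_mem (hs i).1 (ht i).1, add_mem (hs i).2 (ht i).2⟩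
  zero_mem' _ := ⟨zero_mem _, zero_mem _⟩
  smul_mem' c s hs i := by
    rw [Sec.csmul_val]
    exact ⟨Submodule.smul_mem _ c (hs i).1, Submodule.smul_mem _ c (hs i).2⟩

theorem dproj_mem_sec {V : Opens PLine} (p : ZMod 2) {s : E.Coef V} (hs : s ∈ E.secSubmodule V) :
    (fun i => ((dproj (p + E.par i) (s i).1, dproj (p + E.par i) (s i).2) :
      SF (ch0 V) × SF (ch1 V))) ∈ E.secSubmodule V := fun j => by
  have h1 : SF.ov1 V (dproj (p + E.par j) (s j).2) = dproj (p + E.par j) (SF.ov1 V (s j).2) :=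
    dproj_pull _ _ _ _
  have h2 : ∀ i, SF.ov0 V (dproj (p + E.par i) (s i).1) * SF.ovC V (E.g i j) =
      dproj (p + E.par j) (SF.ov0 V (s i).1 * SF.ovC V (E.g i j)) := fun i => by
    have h3 : SF.ov0 V (dproj (p + E.par i) (s i).1) = dproj (p + E.par i) (SF.ov0 V (s i).1) :=
      dproj_pull _ _ _ _
    have h4 : SF.ovC V (E.g i j) ∈ dpart (Hol (ov V)) (Hol (ov V)) (E.par i + E.par j) :=
      SF.pull_mem _ _ (E.even i j)
    rw [h3, dproj_mul _ h4, add_assoc, ← add_assoc (E.par i), CharTwo.add_self_eq_zero, zero_add]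
  change SF.ov1 V (dproj (p + E.par j) (s j).2) =
    ∑ i, SF.ov0 V (dproj (p + E.par i) (s i).1) * SF.ovC V (E.g i j)
  rw [h1, hs j, map_sum]
  exact Finset.sum_congr rfl fun i _ => (h2 i).symm

theorem isCompl_partSec (V : Opens PLine) : IsCompl (E.partSec 0 V) (E.partSec 1 V) := by
  constructor
  · rw [Submodule.disjoint_def]
    intro x h0 h1
    refine Sec.ext E (fun i => ?_) (fun i => ?_)
    · have h2 := (h0 i).1
      rw [zero_add] at h2
      exact dpart_disjoint h2 (h1 i).1
    · have h2 := (h0 i).2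
      rw [zero_add] at h2
      exact dpart_disjoint h2 (h1 i).2
  · rw [codisjoint_iff, Submodule.eq_top_iff']
    intro x
    let x0 : E.Sec V := ⟨_, E.dproj_mem_sec 0 x.2⟩
    let x1 : E.Sec V := ⟨_, E.dproj_mem_sec 1 x.2⟩
    have hs : x0 + x1 = x := by
      refine Sec.ext E (fun i => ?_) (fun i => ?_)
      · have h2 := dproj_add (0 + E.par i) (x.1 i).1
        rw [← add_assoc, add_zero] at h2
        exact h2
      · have h2 := dproj_add (0 + E.par i) (x.1 i).2
        rw [← add_assoc, add_zero] at h2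
        exact h2
    rw [← hs]
    exact Submodule.add_mem_sup (fun i => ⟨dproj_mem _ _, dproj_mem _ _⟩)
      (fun i => ⟨dproj_mem _ _, dproj_mem _ _⟩)

theorem res_mem_partSec {U V : Opens PLine} (h : V ≤ U) (p : ZMod 2) {s : E.Sec U}
    (hs : s ∈ E.partSec p U) : Sec.res h s ∈ E.partSec p V := fun i =>
  ⟨SF.pull_mem _ _ (hs i).1, SF.pull_mem _ _ (hs i).2⟩

theorem smul_mem_partSec {U : Opens PLine} {p q : ZMod 2} {a : OPi U} {s : E.Sec U}
    (ha : a ∈ OPi.part p U) (hs : s ∈ E.partSec q U) : a • s ∈ E.partSec (p + q) U := fun i => by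
  rw [Sec.smul_val, add_assoc]
  exact ⟨dpart_mul ha.1 (hs i).1, dpart_mul ha.2 (hs i).2⟩

theorem glue_sec {ι : Type} (V : ι → Opens PLine) (s : ∀ i, E.Sec (V i))
    (hs : ∀ i j, Sec.res inf_le_left (s i) = Sec.res (inf_le_right : V i ⊓ V j ≤ V j) (s j)) :
    ∃! t : E.Sec (⨆ i, V i), ∀ i, Sec.res (le_iSup V i) t = s i := by
  choose t ht hu using fun k => SF.glue_pair V (fun i => (s i).1 k) fun i j =>
    congrFun (congrArg Subtype.val (hs i j)) k
  refine ⟨⟨t, fun j => ?_⟩, fun i => Subtype.ext (funext fun k => ht k i), fun y hy =>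
    Subtype.ext (funext fun k => hu k _ fun i => congrFun (congrArg Subtype.val (hy i)) k)⟩
  refine SF.sep (fun i => ov_mono (le_iSup V i)) (mem_ov_iSup V) fun i => ?_
  simp only [map_sum, map_mul, SF.res_ov0 (le_iSup V i), SF.res_ov1 (le_iSup V i),
    SF.res_ovC (le_iSup V i)]
  have h1 : ∀ k, SF.resPair (le_iSup V i) (t k) = (s i).1 k := fun k => ht k i
  have h2 := (s i).2 j
  simp only [← h1] at h2
  exact h2

/-- The sheaf of sections. -/
def sheaf : SuperModSheaf sheafOPi where
  obj := E.Sec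
  module V := E.instModuleSec V
  tower V := E.instTowerSec V
  res h := Sec.res h
  res_smul {U V} h a s := Sec.res_smul (E := E) (U := U) (V := V) h a s
  res_refl _ := Sec.ext E (fun _ => SF.res_refl _) (fun _ => SF.res_refl _)
  res_res _ _ _ := Sec.ext E (fun _ => SF.res_res _ _ _) (fun _ => SF.res_res _ _ _)
  part := E.partSec
  isCompl := E.isCompl_partSec
  res_mem h p _ hs := E.res_mem_partSec h p hs
  smul_mem ha hs := E.smul_mem_partSec ha hs
  glue := E.glue_sec

end Bundle

/-! ### Tangent and cotangent sheaves of the `Π`-projective line -/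

theorem dpart_odd_mul_odd {R : Type} [CommRing R] [Algebra ℂ R] {a b : DualNumber R}
    (ha : a ∈ dpart R R 1) (hb : b ∈ dpart R R 1) : a * b = 0 := by
  rw [mem_dpart_one] at ha hb
  refine TrivSqZeroExt.ext ?_ ?_ <;> simp [ha, hb]

theorem dpart_one_mem (R : Type) [CommRing R] [Algebra ℂ R] :
    (1 : DualNumber R) ∈ dpart R R 0 := mem_dpart_zero.2 TrivSqZeroExt.snd_one

theorem dpart_pow_mem {R : Type} [CommRing R] [Algebra ℂ R] {a : DualNumber R}
    (ha : a ∈ dpart R R 0) (n : ℕ) : a ^ n ∈ dpart R R 0 := by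
  induction n with
  | zero => rw [pow_zero]; exact dpart_one_mem R
  | succ n ih => rw [pow_succ]; simpa using dpart_mul ih ha

theorem dpart_inverse_mem {R : Type} [CommRing R] [Algebra ℂ R] {a : DualNumber R}
    (ha : a ∈ dpart R R 0) : Ring.inverse a ∈ dpart R R 0 := by
  by_cases hu : IsUnit a
  · have h := congrArg TrivSqZeroExt.snd (Ring.mul_inverse_cancel a hu)
    rw [mem_dpart_zero] at ha ⊢
    have hf : IsUnit a.fst := hu.map (TrivSqZeroExt.fstHom R R R)
    have h2 : a.fst * (Ring.inverse a).snd = 0 := by simpa [ha] using h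
    exact (hf.mul_right_eq_zero).1 h2
  · rw [Ring.inverse_non_unit _ hu]; exact zero_mem _

section EvenMat

variable {R : Type} [CommRing R] [Algebra ℂ R] {M : Matrix (Fin 2) (Fin 2) (DualNumber R)}

theorem isEvenMat_par11 :
    IsEvenMat par11 M ↔ (M 0 0 ∈ dpart R R 0 ∧ M 0 1 ∈ dpart R R 1) ∧
      (M 1 0 ∈ dpart R R 1 ∧ M 1 1 ∈ dpart R R 0) := by
  have h : (1 : ZMod 2) + 1 = 0 := by decide
  simp [IsEvenMat, par11, Fin.forall_fin_two, h]

theorem IsEvenMat.isUnit_iff (h : IsEvenMat par11 M) :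
    IsUnit M ↔ IsUnit (M 0 0) ∧ IsUnit (M 1 1) := by
  obtain ⟨⟨h00, h01⟩, h10, h11⟩ := isEvenMat_par11.1 h
  rw [Matrix.isUnit_iff_isUnit_det, Matrix.det_fin_two, dpart_odd_mul_odd h01 h10, sub_zero,
    IsUnit.mul_iff]

theorem IsEvenMat.parityTranspose (h : IsEvenMat par11 M) :
    IsEvenMat par11 (parityTranspose M) := by
  obtain ⟨⟨h00, h01⟩, h10, h11⟩ := isEvenMat_par11.1 h
  exact isEvenMat_par11.2 ⟨⟨h11, h10⟩, h01, h00⟩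

theorem IsEvenMat.superTranspose (h : IsEvenMat par11 M) :
    IsEvenMat par11 (superTranspose M) := by
  obtain ⟨⟨h00, h01⟩, h10, h11⟩ := isEvenMat_par11.1 h
  exact isEvenMat_par11.2 ⟨⟨h00, h10⟩, neg_mem h01, h11⟩

theorem IsEvenMat.inv (h : IsEvenMat par11 M) : IsEvenMat par11 M⁻¹ := by
  obtain ⟨⟨h00, h01⟩, h10, h11⟩ := isEvenMat_par11.1 h
  have hd : Ring.inverse M.det ∈ dpart R R 0 := dpart_inverse_mem (by
    rw [Matrix.det_fin_two]
    exact sub_mem (by simpa using dpart_mul h00 h11) (by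
      rw [dpart_odd_mul_odd h01 h10]; exact zero_mem _))
  rw [Matrix.inv_def, Matrix.adjugate_fin_two]
  exact isEvenMat_par11.2 ⟨⟨by simpa using dpart_mul hd h11,
    by simpa using dpart_mul hd h01⟩, by simpa using dpart_mul hd h10,
    by simpa using dpart_mul hd h00⟩

theorem IsEvenMat.symPow (h : IsEvenMat par11 M) (k : ℕ) : IsEvenMat par11 (symPow k M) := by
  obtain ⟨⟨h00, h01⟩, h10, h11⟩ := isEvenMat_par11.1 h
  have hk : ((k : DualNumber R) + 1) ∈ dpart R R 0 := mem_dpart_zero.2 (by simp)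
  have h1 := dpart_pow_mem h00 k
  refine isEvenMat_par11.2 ⟨⟨dpart_pow_mem h00 _, ?_⟩, ?_, ?_⟩
  · simpa [PiLine.symPow] using dpart_mul (dpart_mul hk h1) h01
  · simpa [PiLine.symPow] using dpart_mul h1 h10
  · simpa [PiLine.symPow, dpart_odd_mul_odd h01 h10] using dpart_mul h1 h11

theorem isUnit_parityTranspose (h : IsEvenMat par11 M) (hu : IsUnit M) :
    IsUnit (parityTranspose M) :=
  h.parityTranspose.isUnit_iff.2 (h.isUnit_iff.1 hu).symm

theorem isUnit_superTranspose (h : IsEvenMat par11 M) (hu : IsUnit M) :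
    IsUnit (superTranspose M) :=
  h.superTranspose.isUnit_iff.2 (h.isUnit_iff.1 hu)

theorem isUnit_symPow (h : IsEvenMat par11 M) (hu : IsUnit M) (k : ℕ) : IsUnit (symPow k M) := by
  obtain ⟨⟨h00, h01⟩, h10, h11⟩ := isEvenMat_par11.1 h
  obtain ⟨u0, u1⟩ := h.isUnit_iff.1 hu
  refine (h.symPow k).isUnit_iff.2 ⟨u0.pow _, ?_⟩
  simpa [symPow, dpart_odd_mul_odd h01 h10] using (u0.pow k).mul u1

theorem berezinian_of_even (h : IsEvenMat par11 M) :
    berezinian M = M 0 0 * Ring.inverse (M 1 1) := by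
  obtain ⟨⟨h00, h01⟩, h10, h11⟩ := isEvenMat_par11.1 h
  rw [berezinian, mul_right_comm, dpart_odd_mul_odd h01 h10, zero_mul, sub_zero]

theorem inverse_berezinian_mem (h : IsEvenMat par11 M) :
    Ring.inverse (berezinian M) ∈ dpart R R 0 := by
  obtain ⟨⟨h00, h01⟩, h10, h11⟩ := isEvenMat_par11.1 h
  rw [berezinian_of_even h]
  exact dpart_inverse_mem (by simpa using dpart_mul h00 (dpart_inverse_mem h11))

theorem isUnit_inverse_berezinian (h : IsEvenMat par11 M) (hu : IsUnit M) :
    IsUnit (Ring.inverse (berezinian M)) := by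
  obtain ⟨u0, u1⟩ := h.isUnit_iff.1 hu
  rw [berezinian_of_even h]
  exact (u0.mul u1.ringInverse).ringInverse

end EvenMat

namespace Bundle

/-- The structure sheaf, as a bundle of rank `1|0`. -/
def trivial : Bundle where
  ι := Unit
  par _ := 0
  g := 1
  even _ _ := dpart_one_mem _
  unit := isUnit_one

/-- The tensor product of a bundle with the line bundle of rank `1|0` with transition function
`a`. -/
def twist (a : SF Cstar) (ha : a ∈ dpart (Hol Cstar) (Hol Cstar) 0) (hu : IsUnit a) (E : Bundle) :
    Bundle where
  ι := E.ι
  par := E.par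
  g := a • E.g
  even i j := by simpa using dpart_mul ha (E.even i j)
  unit := E.unit.smul hu.unit

/-- The supersymmetric power of degree `k` of the bundle of rank `1|1` with the given transition
matrix; for `k ≥ 1` it has rank `1|1`. -/
def sym (M : Matrix (Fin 2) (Fin 2) (SF Cstar)) (h : IsEvenMat par11 M) (hu : IsUnit M) :
    ℕ → Bundle
  | 0 => trivial
  | k + 1 =>
    { ι := Fin 2
      par := par11
      g := symPow k M
      even := h.symPow k
      unit := isUnit_symPow h hu k }

end Bundle

/-- The Jacobian of the change of coordinates: `dz = ∂z/∂w dw + ∂z/∂ψ dψ` and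
`dθ = ∂θ/∂w dw + ∂θ/∂ψ dψ`. -/
def jac : Matrix (Fin 2) (Fin 2) (SF Cstar) :=
  !![SF.dEven coordZ, SF.dOdd coordZ; SF.dEven coordTheta, SF.dOdd coordTheta]

theorem deriv_zero_eq {S : Opens ℂ} : Hol.deriv (0 : Hol S) = 0 := by
  refine Subtype.ext (funext fun z => ?_)
  have h : extz (0 : Hol S).1 = fun _ => 0 := by
    funext y
    by_cases hy : y ∈ S
    · exact extz_of_mem _ hy
    · exact dif_neg hy
  change _root_.deriv (extz (0 : Hol S).1) z = 0
  rw [h]; simp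

theorem deriv_coordInv : Hol.deriv Hol.coordInv = -Hol.coordInv ^ 2 := by
  refine Subtype.ext (funext fun z => ?_)
  have h : extz Hol.coordInv.1 =ᶠ[𝓝 (z : ℂ)] fun y => y⁻¹ := by
    filter_upwards [Cstar.isOpen.mem_nhds z.2] with y hy
    exact extz_of_mem _ hy
  change _root_.deriv (extz Hol.coordInv.1) z = -((z : ℂ)⁻¹) ^ 2
  rw [h.deriv_eq, deriv_inv]
  simp

theorem isEvenMat_jac : IsEvenMat par11 jac :=
  isEvenMat_par11.2 ⟨⟨mem_dpart_zero.2 deriv_zero_eq, mem_dpart_one.2 rfl⟩,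
    mem_dpart_one.2 deriv_zero_eq, mem_dpart_zero.2 rfl⟩

theorem isUnit_jac : IsUnit jac := by
  have hc : IsUnit (-Hol.coordInv ^ 2) :=
    ((Hol.coordUnit⁻¹).isUnit.pow 2).neg
  have h0 : ∀ x : SF Cstar, IsUnit x.fst → IsUnit x := fun x hx =>
    TrivSqZeroExt.isUnit_iff_isUnit_fst.2 hx
  refine isEvenMat_jac.isUnit_iff.2 ⟨h0 _ ?_, h0 _ ?_⟩
  · change IsUnit (Hol.deriv Hol.coordInv)
    rw [deriv_coordInv]; exact hc
  · exact hc

/-- The transition matrix of the cotangent sheaf `T*`, in the frames `(dz | dθ)`, `(dw | dψ)`. -/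
def matCotangent : Matrix (Fin 2) (Fin 2) (SF Cstar) := jac

/-- The transition matrix of `Π T*`, in the frames `(π dθ | π dz)`, `(π dψ | π dw)`. -/
def matPiCotangent : Matrix (Fin 2) (Fin 2) (SF Cstar) := parityTranspose matCotangent

/-- The transition matrix of the tangent sheaf `T`, in the frames `(∂_z | ∂_θ)`, `(∂_w | ∂_ψ)`. -/
def matTangent : Matrix (Fin 2) (Fin 2) (SF Cstar) := superTranspose matCotangent⁻¹

/-- The transition matrix of `Π T`, in the frames `(π ∂_θ | π ∂_z)`, `(π ∂_ψ | π ∂_w)`. -/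
def matPiTangent : Matrix (Fin 2) (Fin 2) (SF Cstar) := parityTranspose matTangent

theorem isEvenMat_piCotangent : IsEvenMat par11 matPiCotangent := isEvenMat_jac.parityTranspose

theorem isUnit_piCotangent : IsUnit matPiCotangent :=
  isUnit_parityTranspose isEvenMat_jac isUnit_jac

theorem isEvenMat_piTangent : IsEvenMat par11 matPiTangent :=
  isEvenMat_jac.inv.superTranspose.parityTranspose

theorem isUnit_piTangent : IsUnit matPiTangent :=
  isUnit_parityTranspose isEvenMat_jac.inv.superTranspose
    (isUnit_superTranspose isEvenMat_jac.inv
      (Matrix.isUnit_nonsing_inv_iff.2 isUnit_jac))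

/-- The supersymmetric power `Sym^k Π T*`. -/
def symPiCotangent (k : ℕ) : Bundle :=
  Bundle.sym matPiCotangent isEvenMat_piCotangent isUnit_piCotangent k

/-- The supersymmetric power `Sym^k Π T`. -/
def symPiTangent (k : ℕ) : Bundle :=
  Bundle.sym matPiTangent isEvenMat_piTangent isUnit_piTangent k

/-- The tensor product of a bundle with the Berezinian sheaf `Ber(Π T*)^*` of the `Π`-projective
line. -/
def berTensor (E : Bundle) : Bundle :=
  E.twist (Ring.inverse (berezinian matPiCotangent)) (inverse_berezinian_mem isEvenMat_piCotangent)
    (isUnit_inverse_berezinian isEvenMat_piCotangent isUnit_piCotangent)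

/-- The structure sheaf as a module over itself. -/
def sheafTriv : SuperModSheaf sheafOPi := sheafOPi.self

/-- The Berezinian sheaf `Ber(Π T*)^*` of the `Π`-projective line, of rank `1|0`. -/
def sheafBer : SuperModSheaf sheafOPi := (berTensor Bundle.trivial).sheaf

/-- The sheaf `Sym^k Π T*`. -/
def sheafSymPiCotangent (k : ℕ) : SuperModSheaf sheafOPi := (symPiCotangent k).sheaf

/-- The sheaf `Sym^k Π T`. -/
def sheafSymPiTangent (k : ℕ) : SuperModSheaf sheafOPi := (symPiTangent k).sheaf

/-- The sheaf of integral forms `Ber ⊗ Sym^k Π T`. -/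
def sheafIntegral (k : ℕ) : SuperModSheaf sheafOPi := (berTensor (symPiTangent k)).sheaf

/-- The Large Hilbert Space of the `Π`-projective line, in degree `k`: the differential forms
`Sym^k Π T*` for `k > 0`, the sum of the extended forms `O ⊕ Π Ber` and the integral forms `Ber`
for `k = 0`, and the sum of the inverse forms `Π (Ber ⊗ Sym^{-k} Π T)` and of the integral forms
`Ber ⊗ Sym^{-k} Π T` for `k < 0`. -/
def sheafLHS : ℤ → SuperModSheaf sheafOPi
  | Int.ofNat 0 => (sheafTriv.sum sheafBer.parity).sum sheafBer
  | Int.ofNat (k + 1) => sheafSymPiCotangent (k + 1)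
  | Int.negSucc k => (sheafIntegral (k + 1)).parity.sum (sheafIntegral (k + 1))

end PiLine

end

noncomputable section

namespace PiLine

section

open MeasureTheory Complex Set Filter

/-! ### The inhomogeneous Cauchy–Riemann equation -/

/-! The supergeometry is contained in one change of coordinates, `z = 1/w`, `θ = -ψ/w²`, which
`row_equivalent_iff` extracts from the big cells. Up to a sign, absorbed in one chart, coefficients
of the odd coordinate are sections of O(-2); this is the splitting `isoSplit`. The Jacobian
(`jac_eq`) is triangular with both diagonal entries equal to `-w⁻²`, so the Berezinian, which is
their quotient, equals 1. Hence twisting by the Berezinian sheaf changes nothing, and the integral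
forms are the symmetric powers of `Π T`.

The transition matrices of `Sym^k Π T*` and `Sym^k Π T` are again triangular: the diagonal is `ε wᵐ`
with m = -2k, respectively m = 2k, and the single off-diagonal entry is a nonzero multiple of `wᵐ⁻¹
ψ`. Expanding coefficients in the odd coordinate gives a sheaf of rank four on ℙ¹. Two of the four
functions decouple and give O(m) and O(m-2). The other two form an extension of O(m) by O(m-2) with
nonzero class, and the middle term of such an extension is O(m-1)². `IsTriangular.split` and
`splitInv` write this isomorphism down explicitly.

What remains is the cohomology of O(n). Čech cohomology is a limit over all coverings;
`H1_equiv_of_twoCover` computes it from two discs covering the sphere, provided that every cocycle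
is a coboundary on each disc. That is the first Cousin problem: split the cocycle smoothly by a
partition of unity, then correct the splitting by a solution of a ∂̄-equation. The solution
(`exists_dbar_eq`) is a convolution with 1/z, by the Cauchy–Pompeiu formula. H¹(O(n)) then consists
of the functions on an annulus modulo sums of functions extending to one of the discs. Laurent
splitting and Taylor expansion leave the span of z⁻¹, …, z^(n+1), and Liouville's theorem shows that
nothing more is killed. Liouville also shows that the global sections are the polynomials of degree
at most n. Adding up dimensions gives 4k|4k. -/

/-- Twice the Wirtinger derivative `∂f/∂z̄`. -/
def dbar (f : ℂ → ℂ) (z : ℂ) : ℂ := fderiv ℝ f z 1 + I * fderiv ℝ f z I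

theorem differentiableAt_of_dbar_eq_zero {f : ℂ → ℂ} {z : ℂ} (hf : DifferentiableAt ℝ f z)
    (h : dbar f z = 0) : DifferentiableAt ℂ f z := by
  refine differentiableAt_complex_iff_differentiableAt_real.2 ⟨hf, ?_⟩
  rw [dbar] at h
  have h2 : I * (fderiv ℝ f z 1 + I * fderiv ℝ f z I) = 0 := by rw [h, mul_zero]
  rw [mul_add, ← mul_assoc, I_mul_I] at h2
  rw [smul_eq_mul]
  linear_combination -h2

theorem dbar_eq_zero {f : ℂ → ℂ} {z : ℂ} (hf : DifferentiableAt ℂ f z) : dbar f z = 0 := by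
  have h := (differentiableAt_complex_iff_differentiableAt_real.1 hf).2
  rw [dbar, h, smul_eq_mul, ← mul_assoc, I_mul_I]
  ring

theorem dbar_sub {f g : ℂ → ℂ} {z : ℂ} (hf : DifferentiableAt ℝ f z)
    (hg : DifferentiableAt ℝ g z) : dbar (fun z => f z - g z) z = dbar f z - dbar g z := by
  have h : fderiv ℝ (fun z => f z - g z) z = fderiv ℝ f z - fderiv ℝ g z := fderiv_sub hf hg
  rw [dbar, dbar, dbar, h]
  simp only [_root_.sub_apply]
  ring

theorem dbar_congr {f g : ℂ → ℂ} {z : ℂ} (h : f =ᶠ[𝓝 z] g) : dbar f z = dbar g z := by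
  rw [dbar, dbar, h.fderiv_eq]

theorem contDiffAt_dbar {f : ℂ → ℂ} {z : ℂ} (hf : ContDiffAt ℝ 2 f z) :
    ContDiffAt ℝ 1 (dbar f) z := by
  have h : ContDiffAt ℝ 1 (fderiv ℝ f) z := hf.fderiv_right (by norm_num)
  exact (h.clm_apply contDiffAt_const).add (contDiffAt_const.mul (h.clm_apply contDiffAt_const))

/-- The function `‖x‖⁻¹ exp(-‖x‖)` is integrable because its integral has a known nonzero value,
while a non-integrable function has integral 0 by convention. Multiplying by the continuous function
`exp ‖x‖` preserves local integrability. -/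
theorem locallyIntegrable_inv : LocallyIntegrable (fun z : ℂ => z⁻¹) := by
  have h0 : Integrable (fun x : ℂ => ‖x‖ ^ (-1 : ℝ) * Real.exp (-‖x‖ ^ (1 : ℝ))) := by
    by_contra h
    have h1 := Complex.integral_rpow_mul_exp_neg_rpow (p := 1) (q := -1) le_rfl (by norm_num)
    rw [integral_undef h] at h1
    norm_num at h1
  have h1 : LocallyIntegrable (fun x : ℂ => Real.exp ‖x‖ *
      (‖x‖ ^ (-1 : ℝ) * Real.exp (-‖x‖ ^ (1 : ℝ)))) := by
    exact LocallyIntegrable.continuous_mul (Real.continuous_exp.comp continuous_norm)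
      h0.locallyIntegrable
  refine h1.mono (measurable_inv.aestronglyMeasurable) (ae_of_all _ fun x => ?_)
  rw [Real.rpow_one, Real.rpow_neg_one, mul_left_comm, ← Real.exp_add]
  simp

/-- The derivative of a function in the radial direction `v = 1` or the angular direction
`v = I`, in polar coordinates. -/
def polarDeriv (G : ℂ → ℂ) (v : ℂ) (p : ℝ × ℝ) : ℂ :=
  fderiv ℝ G (p.1 * exp (p.2 * I)) (exp (p.2 * I) * v)

theorem continuous_polarDeriv {G : ℂ → ℂ} (hG : ContDiff ℝ 1 G) (v : ℂ) :
    Continuous (polarDeriv G v) := by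
  have h : Continuous (fderiv ℝ G) := hG.continuous_fderiv one_ne_zero
  unfold polarDeriv
  refine (h.comp ?_).clm_apply ?_ <;> fun_prop

theorem polarDeriv_eq_zero {G : ℂ → ℂ} {R : ℝ} (hR : ∀ z, R < ‖z‖ → fderiv ℝ G z = 0)
    (v : ℂ) {p : ℝ × ℝ} (hp : R < p.1) : polarDeriv G v p = 0 := by
  rw [polarDeriv, hR, _root_.zero_apply]
  rw [norm_mul, norm_exp_ofReal_mul_I, mul_one, norm_real]
  exact hp.trans_le (le_abs_self _)

/-- The half-infinite strip can be replaced by a compact rectangle, since the derivative vanishes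
for radius greater than R. -/
theorem integrableOn_polarDeriv {G : ℂ → ℂ} (hG : ContDiff ℝ 1 G) {R : ℝ}
    (hR : ∀ z, R < ‖z‖ → fderiv ℝ G z = 0) (v : ℂ) :
    IntegrableOn (polarDeriv G v) (Ioi (0 : ℝ) ×ˢ Ioo (-Real.pi) Real.pi)
      (volume.prod volume) := by
  have h : IntegrableOn (polarDeriv G v) (Icc 0 R ×ˢ Icc (-Real.pi) Real.pi)
      (volume.prod volume) :=
    (continuous_polarDeriv hG v).continuousOn.integrableOn_compact (isCompact_Icc.prod isCompact_Icc)
  refine h.of_forall_sdiff_eq_zero (measurableSet_Ioi.prod measurableSet_Ioo) ?_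
  rintro ⟨r, θ⟩ ⟨⟨h1, h2⟩, h3⟩
  refine polarDeriv_eq_zero hR v (lt_of_not_ge fun h4 => h3 ⟨⟨le_of_lt h1, h4⟩, h2.1.le, h2.2.le⟩)

theorem hasDerivAt_radial {G : ℂ → ℂ} (hG : ContDiff ℝ 1 G) (r θ : ℝ) :
    HasDerivAt (fun r : ℝ => G (r * exp (θ * I))) (polarDeriv G 1 (r, θ)) r := by
  have h1 : HasDerivAt (fun r : ℝ => (r : ℂ) * exp (θ * I)) (exp (θ * I) * 1) r := by
    simpa using (ofRealCLM.hasDerivAt (x := r)).mul_const (exp (θ * I))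
  exact (hG.differentiable one_ne_zero _).hasFDerivAt.comp_hasDerivAt r h1

theorem hasDerivAt_angular {G : ℂ → ℂ} (hG : ContDiff ℝ 1 G) (r θ : ℝ) :
    HasDerivAt (fun θ : ℝ => G (r * exp (θ * I))) (r * polarDeriv G I (r, θ)) θ := by
  have h1 : HasDerivAt (fun θ : ℝ => (r : ℂ) * exp (θ * I)) ((r : ℂ) * (exp (θ * I) * I)) θ := by
    have h2 : HasDerivAt (fun θ : ℝ => (θ : ℂ) * I) I θ := by
      simpa using (ofRealCLM.hasDerivAt (x := θ)).mul_const I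
    exact (h2.cexp).const_mul _
  have h3 := (hG.differentiable one_ne_zero _).hasFDerivAt.comp_hasDerivAt θ h1
  have h4 : ∀ (L : ℂ →L[ℝ] ℂ) (v : ℂ), L (r * v) = r * L v := fun L v => by
    rw [← real_smul, map_smul, real_smul]
  rw [h4] at h3
  exact h3

/-- The Cauchy–Pompeiu formula at the origin. -/
theorem integral_inv_mul_dbar {G : ℂ → ℂ} (hG : ContDiff ℝ 1 G) (hc : HasCompactSupport G) :
    ∫ z, z⁻¹ * dbar G z = -(2 * Real.pi) * G 0 := by
  obtain ⟨R, hR0, hR⟩ : ∃ R : ℝ, 0 < R ∧ ∀ z, R < ‖z‖ → z ∉ tsupport G := by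
    obtain ⟨R, hR0, hR⟩ := hc.isBounded.exists_pos_norm_le
    exact ⟨R, hR0, fun z hz hz' => absurd (hR z hz') (not_le.2 hz)⟩
  have hR1 : ∀ z, R < ‖z‖ → fderiv ℝ G z = 0 := fun z hz => by
    by_contra h
    exact hR z hz (support_fderiv_subset ℝ h)
  have hR2 : ∀ z, R < ‖z‖ → G z = 0 := fun z hz => image_eq_zero_of_notMem_tsupport (hR z hz)
  rw [← Complex.integral_comp_polarCoord_symm, polarCoord_target]
  -- The area factor r cancels the modulus of `z⁻¹`, and the remaining phase `exp(-iθ)` rotates the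
  -- frame (1, I) into the radial and angular directions. The integrand is thus a sum of two
  -- derivatives along coordinate lines.
  have h1 : ∀ p ∈ Ioi (0 : ℝ) ×ˢ Ioo (-Real.pi) Real.pi,
      p.1 • ((Complex.polarCoord.symm p)⁻¹ * dbar G (Complex.polarCoord.symm p)) =
        polarDeriv G 1 p + I * polarDeriv G I p := by
    rintro ⟨r, θ⟩ ⟨hr, -⟩
    have hr : (r : ℂ) ≠ 0 := ofReal_ne_zero.2 (ne_of_gt hr)
    have h2 : Complex.polarCoord.symm (r, θ) = r * exp (θ * I) := by
      rw [Complex.polarCoord_symm_apply, exp_mul_I, ofReal_cos, ofReal_sin]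
    have hL : ∀ (L : ℂ →L[ℝ] ℂ) (a b : ℝ), L (a + b * I) = a * L 1 + b * L I := by
      intro L a b
      have : (a + b * I : ℂ) = a • (1 : ℂ) + b • I := by simp
      rw [this, map_add, map_smul, map_smul, real_smul, real_smul]
    have he : exp (θ * I) = (Real.cos θ : ℂ) + (Real.sin θ : ℂ) * I := by
      rw [exp_mul_I, ofReal_cos, ofReal_sin]
    have hei : exp (θ * I) * I = ((-Real.sin θ : ℝ) : ℂ) + (Real.cos θ : ℂ) * I := by
      rw [he, ofReal_neg]
      linear_combination (Real.sin θ : ℂ) * I_mul_I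
    have hinv : (exp (θ * I))⁻¹ = (Real.cos θ : ℂ) - (Real.sin θ : ℂ) * I := by
      rw [← exp_neg, ← neg_mul, ← ofReal_neg, exp_mul_I, ← ofReal_cos, ← ofReal_sin, Real.cos_neg,
        Real.sin_neg, ofReal_neg]
      ring
    rw [h2, polarDeriv, polarDeriv, mul_one, dbar, hei]
    dsimp only
    set L := fderiv ℝ G (r * exp (θ * I)) with hLdef
    rw [he, hL, hL, ← he, mul_inv, hinv, real_smul, ofReal_neg]
    field_simp
    linear_combination (-(Real.sin θ : ℂ) * L I) * I_mul_I
  rw [setIntegral_congr_fun (measurableSet_Ioi.prod measurableSet_Ioo) h1]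
  have hi1 := integrableOn_polarDeriv hG hR1 1
  have hi2 := integrableOn_polarDeriv hG hR1 I
  change ∫ p in _, _ ∂(volume.prod volume) = _
  rw [integral_add hi1 (hi2.const_mul I), integral_const_mul]
  have h3 : ∫ p in Ioi (0 : ℝ) ×ˢ Ioo (-Real.pi) Real.pi, polarDeriv G I p
      ∂(volume.prod volume) = 0 := by
    rw [setIntegral_prod _ hi2]
    refine setIntegral_eq_zero_of_forall_eq_zero fun r hr => ?_
    rw [← integral_Ioc_eq_integral_Ioo, ← intervalIntegral.integral_of_le
      (by linarith [Real.pi_pos])]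
    -- It is r times the integrand that is an exact θ-derivative; its integral over a full circle
    -- vanishes, and r can be divided out as it is positive.
    have h4 : ∫ θ in -Real.pi..Real.pi, (r : ℂ) * polarDeriv G I (r, θ) = 0 := by
      rw [intervalIntegral.integral_eq_sub_of_hasDerivAt
        (fun θ _ => hasDerivAt_angular hG r θ)]
      · rw [exp_pi_mul_I, ofReal_neg, neg_mul, exp_neg, exp_pi_mul_I]
        norm_num
      · refine Continuous.intervalIntegrable ?_ _ _
        exact continuous_const.mul ((continuous_polarDeriv hG I).comp (by fun_prop))
    rw [intervalIntegral.integral_const_mul] at h4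
    exact (mul_eq_zero.1 h4).resolve_left (ofReal_ne_zero.2 (ne_of_gt hr))
  have h5 : ∫ p in Ioi (0 : ℝ) ×ˢ Ioo (-Real.pi) Real.pi, polarDeriv G 1 p
      ∂(volume.prod volume) = -(2 * Real.pi) * G 0 := by
    have hi3 : Integrable (polarDeriv G 1)
      ((volume.restrict (Ioi 0)).prod (volume.restrict (Ioo (-Real.pi) Real.pi))) := by
      rw [Measure.prod_restrict]; exact hi1
    rw [← Measure.prod_restrict, integral_prod_symm _ hi3]
    -- On each ray the fundamental theorem of calculus leaves only the value at the origin, as `G`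
    -- vanishes at radius R + 1.
    have h6 : ∀ θ : ℝ, ∫ r in Ioi (0 : ℝ), polarDeriv G 1 (r, θ) = -G 0 := by
      intro θ
      have h7 : ∫ r in Ioi (0 : ℝ), polarDeriv G 1 (r, θ) =
          ∫ r in (0 : ℝ)..(R + 1), polarDeriv G 1 (r, θ) := by
        rw [intervalIntegral.integral_of_le (by linarith)]
        refine (setIntegral_eq_of_subset_of_forall_sdiff_eq_zero measurableSet_Ioi
          (fun r hr => hr.1) ?_)
        rintro r ⟨hr, hr'⟩
        refine polarDeriv_eq_zero hR1 1 ?_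
        by_contra h8
        exact hr' ⟨hr, by dsimp only at h8; linarith⟩
      rw [h7, intervalIntegral.integral_eq_sub_of_hasDerivAt
        (fun r _ => hasDerivAt_radial hG r θ)]
      · rw [hR2, ofReal_zero, zero_mul, zero_sub]
        rw [norm_mul, norm_exp_ofReal_mul_I, mul_one, norm_real]
        exact lt_of_lt_of_le (by linarith) (le_abs_self _)
      · refine Continuous.intervalIntegrable ?_ _ _
        exact (continuous_polarDeriv hG 1).comp (by fun_prop)
    simp_rw [h6]
    rw [setIntegral_const, Measure.real, Real.volume_Ioo, ENNReal.toReal_ofReal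
      (by linarith [Real.pi_pos]), real_smul]
    push_cast
    ring
  rw [h3, h5, mul_zero, add_zero]

/-- The equation `∂u/∂z̄ = g` for a compactly supported `g` has a solution which vanishes at
infinity. -/
theorem exists_dbar_eq {g : ℂ → ℂ} (hg : ContDiff ℝ 1 g) (hc : HasCompactSupport g) :
    ∃ u : ℂ → ℂ, ContDiff ℝ 1 u ∧ (∀ z, dbar u z = g z) ∧ Tendsto u (cocompact ℂ) (𝓝 0) := by
  let L := ContinuousLinearMap.mul ℝ ℂ
  -- The kernel 1/z is a fundamental solution up to the constant 2π, which is divided out at the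
  -- end.
  let u := convolution (fun z : ℂ => z⁻¹) g L volume
  have hu : ContDiff ℝ 1 u := hc.contDiff_convolution_right (n := 1) L locallyIntegrable_inv hg
  have hdu : ∀ z, dbar u z = 2 * Real.pi * g z := by
    intro z
    have h1 := (hc.hasFDerivAt_convolution_right L locallyIntegrable_inv hg z).fderiv
    have hex : ConvolutionExistsAt (fun z : ℂ => z⁻¹) (fderiv ℝ g) z (L.precompR ℂ) volume :=
      (hc.fderiv ℝ).convolutionExists_right _ locallyIntegrable_inv
        (hg.continuous_fderiv one_ne_zero) z
    have h2 : ∀ v, fderiv ℝ u z v = ∫ t, t⁻¹ * fderiv ℝ g (z - t) v := by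
      intro v
      rw [h1, convolution, ContinuousLinearMap.integral_apply hex]
      rfl
    have h3 : ∀ v, Integrable fun t => t⁻¹ * fderiv ℝ g (z - t) v := fun v =>
      (ContinuousLinearMap.apply ℝ ℂ v).integrable_comp hex
    -- Differentiation under the convolution falls on `g`. Reflecting and translating by z brings
    -- the point of interest to the origin, where the Cauchy–Pompeiu formula applies; the reflection
    -- accounts for the sign.
    let G : ℂ → ℂ := fun t => g (z - t)
    have hG : ContDiff ℝ 1 G := hg.comp (contDiff_const.sub contDiff_id)
    have hGc : HasCompactSupport G := hc.comp_homeomorph (Homeomorph.subLeft z)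
    have h4 : ∀ t v, fderiv ℝ G t v = - fderiv ℝ g (z - t) v := by
      intro t v
      have h5 : HasFDerivAt (fun t : ℂ => z - t) (-ContinuousLinearMap.id ℝ ℂ) t := by
        simpa using (hasFDerivAt_id t).const_sub z
      have := ((hg.differentiable one_ne_zero (z - t)).hasFDerivAt.comp t h5).fderiv
      change fderiv ℝ G t = _ at this
      rw [this]; simp
    have h5 := integral_inv_mul_dbar hG hGc
    have h6 : ∀ t, t⁻¹ * dbar G t =
        -(t⁻¹ * fderiv ℝ g (z - t) 1 + I * (t⁻¹ * fderiv ℝ g (z - t) I)) := by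
      intro t; rw [dbar, h4, h4]; ring
    simp_rw [h6] at h5
    rw [integral_neg, integral_add (h3 1) ((h3 I).const_mul I), integral_const_mul, ← h2, ← h2]
      at h5
    simp only [G, sub_zero] at h5
    rw [dbar]
    linear_combination -h5
  obtain ⟨R, hR0, hR⟩ := hc.isBounded.exists_pos_norm_le
  obtain ⟨C, hC⟩ := hc.exists_bound_of_continuous hg.continuous
  have hlim : Tendsto u (cocompact ℂ) (𝓝 0) := by
    have hgi : Integrable g := hg.continuous.integrable_of_hasCompactSupport hc
    -- With the support of `g` in the disc of radius R, the kernel is bounded by `(‖z‖ - R)⁻¹`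
    -- wherever `g` is nonzero, which gives the decay at infinity.
    have hb : ∀ z, R < ‖z‖ → ‖u z‖ ≤ (‖z‖ - R)⁻¹ * ∫ t, ‖g t‖ := by
      intro z hz
      have h1 : u z = ∫ t, (z - t)⁻¹ * g t := by
        change convolution _ _ _ _ z = _
        rw [convolution_eq_swap]; rfl
      rw [h1, ← integral_const_mul]
      refine norm_integral_le_of_norm_le (hgi.norm.const_mul _) (ae_of_all _ fun t => ?_)
      rw [norm_mul]
      by_cases ht : t ∈ tsupport g
      · refine mul_le_mul_of_nonneg_right ?_ (norm_nonneg _)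
        rw [norm_inv]
        refine inv_anti₀ (by linarith) ?_
        have := norm_sub_norm_le z t
        have := hR t ht
        linarith
      · rw [image_eq_zero_of_notMem_tsupport ht]; simp
    refine squeeze_zero_norm' (a := fun z => (‖z‖ - R)⁻¹ * ∫ t, ‖g t‖) ?_ ?_
    · filter_upwards [tendsto_norm_cocompact_atTop.eventually_gt_atTop R] with z hz using hb z hz
    · have h1 : Tendsto (fun z : ℂ => ‖z‖ - R) (cocompact ℂ) atTop :=
        tendsto_atTop_add_const_right _ _ tendsto_norm_cocompact_atTop
      simpa using h1.inv_tendsto_atTop.mul_const (∫ t, ‖g t‖)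
  have hpi : (2 * Real.pi : ℂ) ≠ 0 := by simp [Real.pi_ne_zero]
  refine ⟨fun z => (2 * Real.pi : ℂ)⁻¹ * u z, contDiff_const.mul hu, fun z => ?_, ?_⟩
  · have h : fderiv ℝ (fun z => (2 * Real.pi : ℂ)⁻¹ * u z) z = (2 * Real.pi : ℂ)⁻¹ • fderiv ℝ u z :=
      fderiv_const_mul (hu.differentiable one_ne_zero z) _
    have h2 := hdu z
    rw [dbar] at h2 ⊢
    rw [h]
    simp only [_root_.smul_apply, smul_eq_mul]
    rw [← mul_left_inj' hpi]
    field_simp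
    linear_combination h2
  · simpa using hlim.const_mul ((2 * Real.pi : ℂ)⁻¹)

end

section

open Complex Set Filter Metric

/-! ### The first Cousin problem and Laurent splittings -/

theorem contDiffAt_real_of_differentiableOn {f : ℂ → ℂ} {s : Set ℂ} (hs : IsOpen s)
    (hf : DifferentiableOn ℂ f s) {z : ℂ} (hz : z ∈ s) (n : ℕ) : ContDiffAt ℝ n f z :=
  ((hf.analyticAt (hs.mem_nhds hz)).contDiffAt (n := n)).restrict_scalars ℝ

/-- Every cocycle of smooth functions on an open covering of the plane is a coboundary. -/
theorem exists_smooth_splitting {ι : Type} (U : ι → Set ℂ) (hU : ∀ i, IsOpen (U i))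
    (hcov : ∀ z, ∃ i, z ∈ U i) (f : ι → ι → ℂ → ℂ)
    (hf : ∀ i j, ∀ z ∈ U i ∩ U j, ContDiffAt ℝ 2 (f i j) z)
    (hc : ∀ i j k, ∀ z ∈ U i ∩ U j ∩ U k, f j k z - f i k z + f i j z = 0) :
    ∃ h : ι → ℂ → ℂ, (∀ i, ∀ z ∈ U i, ContDiffAt ℝ 2 (h i) z) ∧
      ∀ i j, ∀ z ∈ U i ∩ U j, h j z - h i z = f i j z := by
  obtain ⟨φ, hφ⟩ := SmoothPartitionOfUnity.exists_isSubordinate (modelWithCornersSelf ℝ ℂ)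
    (isClosed_univ (X := ℂ)) U hU (fun z _ => mem_iUnion.2 (hcov z))
  -- The standard homotopy: where `φ k` is nonzero the cocycle identity gives `f k j - f k i = f i
  -- j`, and the weights sum to 1.
  refine ⟨fun i z => ∑ᶠ k, φ k z • f k i z, fun i z hz => ?_, fun i j z hz => ?_⟩
  · exact φ.contDiffAt_finsum fun k hk => hf k i z ⟨hφ k hk, hz⟩
  · have hfin : ∀ g : ι → ℂ, (Function.support fun k => φ k z • g k).Finite := fun g =>
      (φ.locallyFinite.point_finite z).subset fun k hk hk' => hk (by simp [hk'])
    dsimp only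
    rw [← finsum_sub_distrib (hfin _) (hfin _)]
    have h1 : ∀ k, φ k z • f k j z - φ k z • f k i z = φ k z • f i j z := fun k => by
      by_cases hk : φ k z = 0
      · simp [hk]
      · have hkU : z ∈ U k := hφ k (subset_tsupport _ hk)
        rw [← smul_sub, ← sub_eq_zero, ← smul_sub]
        have := hc k i j z ⟨⟨hkU, hz.1⟩, hz.2⟩
        rw [show f k j z - f k i z - f i j z = -(f i j z - f k j z + f k i z) by ring, this]
        simp
    rw [finsum_congr h1, ← finsum_smul, φ.sum_eq_one (mem_univ z), one_smul]

/-- The first Cousin problem on a disc, for an open covering of the plane. -/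
theorem exists_holomorphic_splitting {ι : Type} (U : ι → Set ℂ) (hU : ∀ i, IsOpen (U i))
    (hcov : ∀ z, ∃ i, z ∈ U i) (f : ι → ι → ℂ → ℂ)
    (hf : ∀ i j, DifferentiableOn ℂ (f i j) (U i ∩ U j))
    (hc : ∀ i j k, ∀ z ∈ U i ∩ U j ∩ U k, f j k z - f i k z + f i j z = 0) {R : ℝ} (hR : 0 < R) :
    ∃ h : ι → ℂ → ℂ, (∀ i, DifferentiableOn ℂ (h i) (U i ∩ ball 0 R)) ∧
      ∀ i j, ∀ z ∈ U i ∩ U j, h j z - h i z = f i j z := by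
  obtain ⟨h, hh, hd⟩ := exists_smooth_splitting U hU hcov f
    (fun i j z hz => contDiffAt_real_of_differentiableOn ((hU i).inter (hU j)) (hf i j) hz 2) hc
  have hdiff : ∀ i, ∀ z ∈ U i, DifferentiableAt ℝ (h i) z := fun i z hz =>
    (hh i z hz).differentiableAt (by norm_num)
  choose k hk using hcov
  -- The differences `h j - h i` are holomorphic, so the functions `dbar (h i)` agree on overlaps
  -- and define one global function. The choice of index `k z` is therefore immaterial.
  let g : ℂ → ℂ := fun z => dbar (h (k z)) z
  have hg : ∀ i, ∀ z ∈ U i, g z = dbar (h i) z := by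
    intro i z hz
    have hz' : z ∈ U i ∩ U (k z) := ⟨hz, hk z⟩
    have hnhds := ((hU i).inter (hU (k z))).mem_nhds hz'
    have h1 : dbar (fun y => h (k z) y - h i y) z = 0 := by
      rw [dbar_congr (g := f i (k z))]
      · exact dbar_eq_zero ((hf i (k z)).differentiableAt hnhds)
      · filter_upwards [hnhds] with y hy using hd i (k z) y hy
    rw [dbar_sub (hdiff _ z (hk z)) (hdiff i z hz)] at h1
    exact sub_eq_zero.1 h1
  have hgs : ContDiff ℝ 1 g := by
    refine contDiff_iff_contDiffAt.2 fun z => ?_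
    refine (contDiffAt_dbar (hh (k z) z (hk z))).congr_of_eventuallyEq ?_
    filter_upwards [(hU (k z)).mem_nhds (hk z)] with y hy using hg _ y hy
  -- The cutoff makes the right-hand side compactly supported and leaves it unchanged on the disc of
  -- radius R. Subtracting the same `u` from all `h i` keeps their differences and makes them
  -- holomorphic on that disc.
  let χ : ContDiffBump (0 : ℂ) := ⟨R, R + 1, hR, by linarith⟩
  have hχ : ContDiff ℝ 1 fun z => (χ z : ℂ) := ofRealCLM.contDiff.comp χ.contDiff
  obtain ⟨u, hu, hdu, -⟩ := exists_dbar_eq (hχ.mul hgs)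
    ((χ.hasCompactSupport.comp_left (g := fun x : ℝ => (x : ℂ)) ofReal_zero).mul_right)
  refine ⟨fun i z => h i z - u z, fun i z hz => ?_, fun i j z hz => ?_⟩
  · refine (differentiableAt_of_dbar_eq_zero ?_ ?_).differentiableWithinAt
    · exact (hdiff i z hz.1).sub (hu.differentiable one_ne_zero z)
    · rw [dbar_sub (hdiff i z hz.1) (hu.differentiable one_ne_zero z), hdu, hg i z hz.1,
        χ.one_of_mem_closedBall (ball_subset_closedBall hz.2)]
      simp
  · rw [sub_sub_sub_cancel_right, hd i j z hz]

/-- A holomorphic function on the annulus `1/2 < |z| < 2` is the sum of a holomorphic function on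
the disc `|z| < 2` and of a holomorphic function of `1 / z` vanishing at infinity. -/
theorem exists_laurent_splitting {r : ℂ → ℂ} (hr : DifferentiableOn ℂ r {z | 1 / 2 < ‖z‖ ∧ ‖z‖ < 2}) :
    ∃ a c : ℂ → ℂ, DifferentiableOn ℂ a (ball 0 2) ∧ DifferentiableOn ℂ c (ball 0 2) ∧
      ∀ z : ℂ, 1 / 2 < ‖z‖ → ‖z‖ < 2 → r z = a z + z⁻¹ * c z⁻¹ := by
  have hopen : IsOpen {z : ℂ | 1 / 2 < ‖z‖ ∧ ‖z‖ < 2} :=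
    (isOpen_lt continuous_const continuous_norm).inter (isOpen_lt continuous_norm continuous_const)
  have hrd : ∀ z : ℂ, 1 / 2 < ‖z‖ → ‖z‖ < 2 → DifferentiableAt ℂ r z := fun z h1 h2 =>
    hr.differentiableAt (hopen.mem_nhds ⟨h1, h2⟩)
  have hrs : ∀ z : ℂ, 1 / 2 < ‖z‖ → ‖z‖ < 2 → ContDiffAt ℝ 2 r z := fun z h1 h2 =>
    contDiffAt_real_of_differentiableOn hopen hr ⟨h1, h2⟩ 2
  -- The cutoff function `b₀ = χ r` is `r` for |z| < 1 and 0 for |z| > 3/2. It is a smooth first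
  -- approximation to the part of `r` that should live outside the small disc.
  let χ : ContDiffBump (0 : ℂ) := ⟨1, 3 / 2, one_pos, by norm_num⟩
  let b₀ : ℂ → ℂ := fun z => (χ z : ℂ) * r z
  have hlt : ∀ x : ℝ, IsOpen {z : ℂ | ‖z‖ < x} := fun x => isOpen_lt continuous_norm continuous_const
  have hgt : ∀ x : ℝ, IsOpen {z : ℂ | x < ‖z‖} := fun x => isOpen_lt continuous_const continuous_norm
  have hχ1 : ∀ z : ℂ, ‖z‖ < 1 → χ z = 1 := fun z hz =>
    χ.one_of_mem_closedBall (by simpa using hz.le)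
  have hχ0 : ∀ z : ℂ, 3 / 2 < ‖z‖ → χ z = 0 := fun z hz =>
    χ.zero_of_le_dist (by simpa using hz.le)
  have hb0 : ∀ z : ℂ, 3 / 2 < ‖z‖ → b₀ =ᶠ[𝓝 z] fun _ => 0 := fun z hz => by
    filter_upwards [(hgt _).mem_nhds hz] with y hy
    simp [b₀, hχ0 y hy]
  have hb1 : ∀ z : ℂ, ‖z‖ < 1 → b₀ =ᶠ[𝓝 z] r := fun z hz => by
    filter_upwards [(hlt _).mem_nhds hz] with y hy
    simp [b₀, hχ1 y hy]
  have hχs : ContDiff ℝ 2 fun z => (χ z : ℂ) := ofRealCLM.contDiff.comp χ.contDiff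
  have hbs : ∀ z : ℂ, 1 / 2 < ‖z‖ → ContDiffAt ℝ 2 b₀ z := fun z hz => by
    by_cases h : ‖z‖ < 2
    · exact hχs.contDiffAt.mul (hrs z hz h)
    · exact contDiffAt_const.congr_of_eventuallyEq (hb0 z (by linarith))
  -- Nothing is known about `r` for |z| ≤ 1/2, so the value there is set to zero. This fits
  -- smoothly, since `b₀ = r` is holomorphic for 1/2 < |z| < 1.
  let g : ℂ → ℂ := fun z => if 1 / 2 < ‖z‖ then dbar b₀ z else 0
  have hg1 : ∀ z : ℂ, ‖z‖ < 1 → g z = 0 := fun z hz => by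
    by_cases h : 1 / 2 < ‖z‖
    · rw [show g z = dbar b₀ z from if_pos h, dbar_congr (hb1 z hz)]
      exact dbar_eq_zero (hrd z h (by linarith))
    · exact if_neg h
  have hgs : ContDiff ℝ 1 g := by
    refine contDiff_iff_contDiffAt.2 fun z => ?_
    by_cases h : ‖z‖ < 1
    · refine (contDiffAt_const (c := (0 : ℂ))).congr_of_eventuallyEq ?_
      filter_upwards [(hlt _).mem_nhds h] with y hy using hg1 y hy
    · have hz : 1 / 2 < ‖z‖ := by linarith
      refine (contDiffAt_dbar (hbs z hz)).congr_of_eventuallyEq ?_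
      filter_upwards [(hgt _).mem_nhds hz] with y hy using if_pos hy
  have hgc : HasCompactSupport g := by
    refine HasCompactSupport.intro (isCompact_closedBall (0 : ℂ) (3 / 2)) fun z hz => ?_
    have hz : 3 / 2 < ‖z‖ := by simpa using hz
    rw [show g z = dbar b₀ z from if_pos (by linarith), dbar_congr (hb0 z hz)]
    exact dbar_eq_zero (differentiableAt_const _)
  obtain ⟨u, hu, hdu, hlim⟩ := exists_dbar_eq hgs hgc
  have hur : ∀ z, DifferentiableAt ℝ u z := hu.differentiable one_ne_zero
  have hbd : ∀ z : ℂ, 1 / 2 < ‖z‖ → DifferentiableAt ℂ (fun z => b₀ z - u z) z := fun z hz => by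
    have h1 := (hbs z hz).differentiableAt (by norm_num)
    refine differentiableAt_of_dbar_eq_zero (h1.sub (hur z)) ?_
    rw [dbar_sub h1 (hur z), hdu, show g z = dbar b₀ z from if_pos hz, sub_self]
  -- This is the outer part `b₀ - u` in the coordinate 1/z. It tends to 0 at infinity, so the value
  -- 0 at w = 0 removes the singularity.
  let B : ℂ → ℂ := fun w => if w = 0 then 0 else b₀ w⁻¹ - u w⁻¹
  have hB : DifferentiableOn ℂ B (ball 0 2) := by
    rw [← differentiableOn_compl_singleton_and_continuousAt_iff (ball_mem_nhds 0 two_pos)]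
    constructor
    · rintro w ⟨hw, hw0 : w ≠ 0⟩
      have hw2 : 1 / 2 < ‖w⁻¹‖ := by
        rw [norm_inv, one_div]
        exact inv_strictAnti₀ (norm_pos_iff.2 hw0) (by simpa using hw)
      refine DifferentiableAt.differentiableWithinAt ?_
      refine ((hbd _ hw2).comp w (differentiableAt_inv hw0)).congr_of_eventuallyEq ?_
      filter_upwards [isOpen_ne.mem_nhds hw0] with y hy using if_neg hy
    · rw [← continuousWithinAt_compl_self, ContinuousWithinAt, show B 0 = 0 from if_pos rfl]
      have h1 : Tendsto (fun z => b₀ z - u z) (cocompact ℂ) (𝓝 0) := by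
        have h2 : b₀ =ᶠ[cocompact ℂ] fun _ => 0 := by
          filter_upwards [tendsto_norm_cocompact_atTop.eventually_gt_atTop (3 / 2)] with z hz
          simp [b₀, hχ0 z hz]
        simpa using (tendsto_const_nhds.congr' h2.symm).sub hlim
      rw [← Metric.cobounded_eq_cocompact] at h1
      refine (h1.comp tendsto_inv₀_nhdsNE_zero).congr' ?_
      filter_upwards [self_mem_nhdsWithin] with y hy using (if_neg hy).symm
  -- Since `B` vanishes at 0, its difference quotient is holomorphic and `B w = w * dslope B 0 w`;
  -- this supplies the factor `z⁻¹`.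
  refine ⟨fun z => r z - (b₀ z - u z), dslope B 0, fun z hz => ?_, ?_, fun z h1 h2 => ?_⟩
  · refine DifferentiableAt.differentiableWithinAt ?_
    have hz : ‖z‖ < 2 := by simpa using hz
    -- For |z| < 1 the unknown values of `r` cancel against `b₀ = r`, leaving `u`, which is
    -- holomorphic because `g` vanishes there.
    by_cases h : ‖z‖ < 1
    · have h3 : DifferentiableAt ℂ u z :=
        differentiableAt_of_dbar_eq_zero (hur z) ((hdu z).trans (hg1 z h))
      refine h3.congr_of_eventuallyEq ?_
      filter_upwards [hb1 z h] with y hy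
      rw [hy]; ring
    · exact (hrd z (by linarith) hz).sub (hbd z (by linarith))
  · rwa [differentiableOn_dslope (ball_mem_nhds 0 two_pos)]
  · have hz : z⁻¹ ≠ 0 := inv_ne_zero (norm_pos_iff.1 (by linarith))
    have h3 : z⁻¹ * dslope B 0 z⁻¹ = B z⁻¹ := by
      have := sub_smul_dslope B 0 z⁻¹
      simpa [B] using this
    rw [h3, show B z⁻¹ = _ from if_neg hz, inv_inv]
    ring

end

section

namespace SuperModSheaf

/-! ### Functoriality of the first cohomology -/

section Functoriality

variable {A B C : SuperAlgSheaf}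

/-- A morphism of sheaves of complex vector spaces from the part of parity `p` of `F` to the part of
parity `q` of `G`. -/
structure PartMap (F : SuperModSheaf A) (p : ZMod 2) (G : SuperModSheaf B) (q : ZMod 2) where
  app : ∀ U, F.part p U →ₗ[ℂ] G.part q U
  app_res : ∀ {U V : Opens PLine} (h : V ≤ U) (s : F.part p U),
    app V (F.resPart p h s) = G.resPart q h (app U s)

variable (F : SuperModSheaf A) (p : ZMod 2)

/-- The cohomology class of a cocycle. -/
def cls (𝒰 : PtCover) : Z1 F p 𝒰 →ₗ[ℂ] H1 F p :=
  letI := Classical.decEq PtCover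
  Module.DirectLimit.of ℂ PtCover (H1Cover F p) (refineH1 F p) 𝒰 ∘ₗ Submodule.mkQ _

/-- Intersecting the two neighbourhoods of each point gives a common refinement. -/
instance : IsDirectedOrder PtCover :=
  ⟨fun 𝒰 𝒱 => ⟨⟨fun x => 𝒰.nhd x ⊓ 𝒱.nhd x, fun x => ⟨𝒰.mem x, 𝒱.mem x⟩⟩,
    fun _ => inf_le_left, fun _ => inf_le_right⟩⟩

instance : Nonempty PtCover := ⟨⟨fun _ => ⊤, fun _ => trivial⟩⟩

instance : DirectedSystem (H1Cover F p) fun 𝒰 𝒱 h => refineH1 F p 𝒰 𝒱 h where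
  map_self 𝒰 x := by
    obtain ⟨f, rfl⟩ := Submodule.mkQ_surjective _ x
    refine congrArg (Submodule.mkQ _) (Subtype.ext (funext fun a => funext fun b => ?_))
    exact Subtype.ext (F.res_refl _)
  map_map 𝒰 𝒱 𝒲 h h' x := by
    obtain ⟨f, rfl⟩ := Submodule.mkQ_surjective _ x
    refine congrArg (Submodule.mkQ _) (Subtype.ext (funext fun a => funext fun b => ?_))
    exact F.resPart_resPart p _ _ _

variable {F p}

theorem cls_surjective (x : H1 F p) : ∃ 𝒰 f, cls F p 𝒰 f = x := by
  let _ := Classical.decEq PtCover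
  obtain ⟨𝒰, y, rfl⟩ := Module.DirectLimit.exists_of x
  obtain ⟨f, rfl⟩ := Submodule.mkQ_surjective _ y
  exact ⟨𝒰, f, rfl⟩

theorem cls_refine {𝒰 𝒱 : PtCover} (h : 𝒰 ≤ 𝒱) (f : Z1 F p 𝒰) :
    cls F p 𝒱 ⟨refineC1 F p h f.1, refineC1_mem F p h _ f.2⟩ = cls F p 𝒰 f := by
  let _ := Classical.decEq PtCover
  exact Module.DirectLimit.of_f (f := refineH1 F p) (hij := h) (x := Submodule.mkQ _ f)

theorem cls_eq_zero {𝒰 : PtCover} {f : Z1 F p 𝒰} (g : C0 F p 𝒰) (h : d0 F p 𝒰 g = f.1) :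
    cls F p 𝒰 f = 0 := by
  have h1 : Submodule.mkQ ((LinearMap.range (d0 F p 𝒰)).submoduleOf (Z1 F p 𝒰)) f = 0 := by
    rw [Submodule.mkQ_apply, Submodule.Quotient.mk_eq_zero]
    exact ⟨g, h⟩
  rw [cls, LinearMap.comp_apply, h1, map_zero]

/-- An element of a directed limit vanishes only if it already vanishes at some later stage, here on
a finer covering. -/
theorem exists_of_cls_eq_zero {𝒰 : PtCover} {f : Z1 F p 𝒰} (h : cls F p 𝒰 f = 0) :
    ∃ (𝒱 : PtCover) (h : 𝒰 ≤ 𝒱) (g : C0 F p 𝒱), d0 F p 𝒱 g = refineC1 F p h f.1 := by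
  let _ := Classical.decEq PtCover
  obtain ⟨𝒱, hV, h1⟩ := Module.DirectLimit.of.zero_exact (f := refineH1 F p) h
  have h2 : (⟨refineC1 F p hV f.1, refineC1_mem F p hV _ f.2⟩ : Z1 F p 𝒱) ∈
      (LinearMap.range (d0 F p 𝒱)).submoduleOf (Z1 F p 𝒱) :=
    (Submodule.Quotient.mk_eq_zero _).1 h1
  obtain ⟨g, hg⟩ := h2
  exact ⟨𝒱, hV, g, hg⟩

theorem H1_hom_ext {W : Type} [AddCommMonoid W] [Module ℂ W] {a b : H1 F p →ₗ[ℂ] W}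
    (h : ∀ 𝒰 f, a (cls F p 𝒰 f) = b (cls F p 𝒰 f)) : a = b := by
  ext x
  obtain ⟨𝒰, f, rfl⟩ := cls_surjective x
  exact h 𝒰 f

variable {G : SuperModSheaf B} {q : ZMod 2} {H : SuperModSheaf C} {r : ZMod 2}

namespace PartMap

/-- The map induced on cochains. -/
def mapC1 (φ : PartMap F p G q) (𝒰 : PtCover) : C1 F p 𝒰 →ₗ[ℂ] C1 G q 𝒰 where
  toFun f x y := φ.app _ (f x y)
  map_add' f g := by funext x y; simp
  map_smul' c f := by funext x y; simp

theorem mapC1_mem (φ : PartMap F p G q) (𝒰 : PtCover) :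
    ∀ f ∈ Z1 F p 𝒰, φ.mapC1 𝒰 f ∈ Z1 G q 𝒰 := fun f hf x y z => by
  have := congrArg (φ.app _) (hf x y z)
  simp only [map_add, map_sub, map_zero, φ.app_res] at this
  exact this

/-- The map induced on cocycles. -/
def mapZ1 (φ : PartMap F p G q) (𝒰 : PtCover) : Z1 F p 𝒰 →ₗ[ℂ] Z1 G q 𝒰 :=
  (φ.mapC1 𝒰).restrict (φ.mapC1_mem 𝒰)

/-- The map induced on the cohomology of a covering. -/
def mapCover (φ : PartMap F p G q) (𝒰 : PtCover) : H1Cover F p 𝒰 →ₗ[ℂ] H1Cover G q 𝒰 :=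
  Submodule.mapQ _ _ (φ.mapZ1 𝒰) (by
    rintro ⟨f, hf⟩ ⟨g, hg⟩
    refine ⟨fun x => φ.app _ (g x), ?_⟩
    have hg' : d0 F p 𝒰 g = f := hg
    change _ = φ.mapC1 𝒰 f
    rw [← hg']
    funext x y
    simp [d0, mapC1, φ.app_res])

/-- The map induced on the first cohomology. -/
def mapH1 (φ : PartMap F p G q) : H1 F p →ₗ[ℂ] H1 G q :=
  letI := Classical.decEq PtCover
  Module.DirectLimit.map φ.mapCover fun 𝒰 𝒱 h => by
    refine LinearMap.ext fun x => ?_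
    obtain ⟨f, rfl⟩ := Submodule.mkQ_surjective _ x
    refine congrArg (Submodule.mkQ _) (Subtype.ext (funext fun a => funext fun b => ?_))
    exact φ.app_res _ _

theorem mapH1_cls (φ : PartMap F p G q) (𝒰 : PtCover) (f : Z1 F p 𝒰) :
    φ.mapH1 (cls F p 𝒰 f) = cls G q 𝒰 (φ.mapZ1 𝒰 f) := by
  let _ := Classical.decEq PtCover
  exact Module.DirectLimit.map_apply_of φ.mapCover _ (Submodule.mkQ _ f)

/-- Two inverse morphisms of sheaves induce an isomorphism on the first cohomology. -/
def equivH1 (φ : PartMap F p G q) (ψ : PartMap G q F p)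
    (h1 : ∀ U s, ψ.app U (φ.app U s) = s) (h2 : ∀ U s, φ.app U (ψ.app U s) = s) :
    H1 F p ≃ₗ[ℂ] H1 G q :=
  LinearEquiv.ofLinearMap φ.mapH1 ψ.mapH1
    (H1_hom_ext fun 𝒰 f => by
      rw [LinearMap.comp_apply, mapH1_cls, mapH1_cls]
      exact congrArg _ (Subtype.ext (funext fun x => funext fun y => h2 _ _)))
    (H1_hom_ext fun 𝒰 f => by
      rw [LinearMap.comp_apply, mapH1_cls, mapH1_cls]
      exact congrArg _ (Subtype.ext (funext fun x => funext fun y => h1 _ _)))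

end PartMap

end Functoriality

/-! ### First cohomology of direct sums. -/

section Sums

variable {A : SuperAlgSheaf} (F G : SuperModSheaf A) (p : ZMod 2)

/-- The homogeneous part of a direct sum. -/
def sumPartEquiv (U : Opens PLine) :
    (F.sum G).part p U ≃ₗ[ℂ] F.part p U × G.part p U where
  toFun s := (⟨s.1.1, s.2.1⟩, ⟨s.1.2, s.2.2⟩)
  map_add' _ _ := rfl
  map_smul' _ _ := rfl
  invFun s := ⟨(s.1.1, s.2.1), s.1.2, s.2.2⟩
  left_inv _ := rfl
  right_inv _ := rfl

def sumFst : PartMap (F.sum G) p F p :=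
  ⟨fun U => LinearMap.fst ℂ _ _ ∘ₗ (sumPartEquiv F G p U).toLinearMap, fun _ _ => rfl⟩

def sumSnd : PartMap (F.sum G) p G p :=
  ⟨fun U => LinearMap.snd ℂ _ _ ∘ₗ (sumPartEquiv F G p U).toLinearMap, fun _ _ => rfl⟩

def sumInl : PartMap F p (F.sum G) p :=
  ⟨fun U => (sumPartEquiv F G p U).symm.toLinearMap ∘ₗ LinearMap.inl ℂ _ _, fun h _ =>
    Subtype.ext (Prod.ext rfl (map_zero (G.res h)).symm)⟩

def sumInr : PartMap G p (F.sum G) p :=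
  ⟨fun U => (sumPartEquiv F G p U).symm.toLinearMap ∘ₗ LinearMap.inr ℂ _ _, fun h _ =>
    Subtype.ext (Prod.ext (map_zero (F.res h)).symm rfl)⟩

/-- The first cohomology of a direct sum. -/
def sumH1Equiv : H1 (F.sum G) p ≃ₗ[ℂ] H1 F p × H1 G p :=
  LinearEquiv.ofLinearMap ((sumFst F G p).mapH1.prod (sumSnd F G p).mapH1)
    ((sumInl F G p).mapH1.coprod (sumInr F G p).mapH1)
    (by
      refine LinearMap.prod_ext ?_ ?_
      · refine H1_hom_ext fun 𝒰 f => Prod.ext ?_ ?_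
        · simp only [LinearMap.comp_apply, LinearMap.inl_apply, LinearMap.coprod_apply, map_zero,
            add_zero, LinearMap.prod_apply, Function.prod_apply, PartMap.mapH1_cls]
          rfl
        · simp only [LinearMap.comp_apply, LinearMap.inl_apply, LinearMap.coprod_apply, map_zero,
            add_zero, LinearMap.prod_apply, Function.prod_apply, PartMap.mapH1_cls]
          exact map_zero (cls G p 𝒰)
      · refine H1_hom_ext fun 𝒰 f => Prod.ext ?_ ?_
        · simp only [LinearMap.comp_apply, LinearMap.inr_apply, LinearMap.coprod_apply, map_zero,
            zero_add, LinearMap.prod_apply, Function.prod_apply, PartMap.mapH1_cls]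
          exact map_zero (cls F p 𝒰)
        · simp only [LinearMap.comp_apply, LinearMap.inr_apply, LinearMap.coprod_apply, map_zero,
            zero_add, LinearMap.prod_apply, Function.prod_apply, PartMap.mapH1_cls]
          rfl)
    (by
      refine H1_hom_ext fun 𝒰 f => ?_
      simp only [LinearMap.comp_apply, LinearMap.prod_apply, Function.prod_apply, PartMap.mapH1_cls,
        LinearMap.coprod_apply, LinearMap.id_apply]
      rw [← map_add]
      refine congrArg _ (Subtype.ext (funext fun x => funext fun y => Subtype.ext (Prod.ext ?_ ?_)))
      · exact add_zero _
      · exact zero_add _)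

end Sums

/-! ### Dimensions of cohomology -/

section Dimensions

variable {A B : SuperAlgSheaf}

theorem equiv_prod {M N : Type} [AddCommMonoid M] [AddCommMonoid N] [Module ℂ M] [Module ℂ N]
    {m n : ℕ} (h : Nonempty (M ≃ₗ[ℂ] (Fin m → ℂ))) (h' : Nonempty (N ≃ₗ[ℂ] (Fin n → ℂ))) :
    Nonempty ((M × N) ≃ₗ[ℂ] (Fin (m + n) → ℂ)) := by
  obtain ⟨e⟩ := h
  obtain ⟨e'⟩ := h'
  exact ⟨((e.prodCongr e').trans (LinearEquiv.sumArrowLequivProdArrow _ _ ℂ ℂ).symm).trans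
    (LinearEquiv.funCongrLeft ℂ ℂ finSumFinEquiv.symm)⟩

theorem H0IsoC.sum {F G : SuperModSheaf A} {m n m' n' : ℕ} (h : F.H0IsoC m n)
    (h' : G.H0IsoC m' n') : (F.sum G).H0IsoC (m + m') (n + n') := by
  have h0 := equiv_prod h.1 h'.1
  have h1 := equiv_prod h.2 h'.2
  exact ⟨h0.map (sumPartEquiv F G 0 ⊤).trans, h1.map (sumPartEquiv F G 1 ⊤).trans⟩

theorem H1IsoC.sum {F G : SuperModSheaf A} {m n m' n' : ℕ} (h : F.H1IsoC m n)
    (h' : G.H1IsoC m' n') : (F.sum G).H1IsoC (m + m') (n + n') := by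
  have h0 := equiv_prod h.1 h'.1
  have h1 := equiv_prod h.2 h'.2
  exact ⟨h0.map (sumH1Equiv F G 0).trans, h1.map (sumH1Equiv F G 1).trans⟩

/-- The homogeneous parts of a parity change. -/
def parityMap (F : SuperModSheaf A) {p q : ZMod 2} (h : p + 1 = q) : PartMap F.parity p F q :=
  ⟨fun _ => Submodule.inclusion (le_of_eq (by subst h; rfl)), fun _ _ => rfl⟩

def parityMapInv (F : SuperModSheaf A) {p q : ZMod 2} (h : p + 1 = q) : PartMap F q F.parity p :=
  ⟨fun _ => Submodule.inclusion (le_of_eq (by subst h; rfl)), fun _ _ => rfl⟩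

theorem H0IsoC.parity {F : SuperModSheaf A} {m n : ℕ} (h : F.H0IsoC m n) :
    F.parity.H0IsoC n m := by
  have e : ∀ {p q : ZMod 2}, p + 1 = q → (F.parity.part p ⊤ ≃ₗ[ℂ] F.part q ⊤) := fun h =>
    LinearEquiv.ofEq _ _ (by subst h; rfl)
  exact ⟨h.2.map (e (by decide)).trans, h.1.map (e (by decide)).trans⟩

theorem H1IsoC.parity {F : SuperModSheaf A} {m n : ℕ} (h : F.H1IsoC m n) :
    F.parity.H1IsoC n m := by
  have e : ∀ {p q : ZMod 2}, p + 1 = q → (H1 F.parity p ≃ₗ[ℂ] H1 F q) := fun h =>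
    (parityMap F h).equivH1 (parityMapInv F h) (fun _ _ => rfl) (fun _ _ => rfl)
  exact ⟨h.2.map (e (by decide)).trans, h.1.map (e (by decide)).trans⟩

/-- An isomorphism on homogeneous parts. -/
def Iso.partEquiv {F G : SuperModSheaf A} (e : F.Iso G) (p : ZMod 2) (U : Opens PLine) :
    F.part p U ≃ₗ[ℂ] G.part p U where
  toFun s := ⟨e.equiv U s, (e.equiv_mem U p s).2 s.2⟩
  map_add' s t := Subtype.ext (map_add (e.equiv U) _ _)
  map_smul' c s := Subtype.ext (((e.equiv U).restrictScalars ℂ).map_smul c s.1)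
  invFun s := ⟨(e.equiv U).symm s, (e.equiv_mem U p _).1 (by
    rw [LinearEquiv.apply_symm_apply]; exact s.2)⟩
  left_inv s := Subtype.ext ((e.equiv U).symm_apply_apply _)
  right_inv s := Subtype.ext ((e.equiv U).apply_symm_apply _)

theorem Iso.partEquiv_res {F G : SuperModSheaf A} (e : F.Iso G) (p : ZMod 2) {U V : Opens PLine}
    (h : V ≤ U) (s : F.part p U) :
    e.partEquiv p V (F.resPart p h s) = G.resPart p h (e.partEquiv p U s) :=
  Subtype.ext (e.equiv_res h s.1)

/-- An isomorphism on the first cohomology. -/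
def Iso.equivH1 {F G : SuperModSheaf A} (e : F.Iso G) (p : ZMod 2) : H1 F p ≃ₗ[ℂ] H1 G p :=
  PartMap.equivH1 ⟨fun U => (e.partEquiv p U).toLinearMap, e.partEquiv_res p⟩
    ⟨fun U => (e.partEquiv p U).symm.toLinearMap, fun {U V} h s => by
      refine (e.partEquiv p V).injective ?_
      change e.partEquiv p V ((e.partEquiv p V).symm _) =
        e.partEquiv p V (F.resPart p h ((e.partEquiv p U).symm s))
      rw [e.partEquiv_res, LinearEquiv.apply_symm_apply, LinearEquiv.apply_symm_apply]⟩
    (fun U => (e.partEquiv p U).symm_apply_apply) (fun U => (e.partEquiv p U).apply_symm_apply)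

theorem H0IsoC.of_iso {F G : SuperModSheaf A} (e : F.Iso G) {m n : ℕ} (h : G.H0IsoC m n) :
    F.H0IsoC m n :=
  ⟨h.1.map (e.partEquiv 0 ⊤).trans, h.2.map (e.partEquiv 1 ⊤).trans⟩

theorem H1IsoC.of_iso {F G : SuperModSheaf A} (e : F.Iso G) {m n : ℕ} (h : G.H1IsoC m n) :
    F.H1IsoC m n :=
  ⟨h.1.map (e.equivH1 0).trans, h.2.map (e.equivH1 1).trans⟩

/-- Cohomology, as a graded complex vector space, only sees the sections, their restrictions and
their grading, none of which change under restriction of scalars. It may therefore be computed over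
the structure sheaf of ℙ¹. -/
theorem H0IsoC.of_restrictScalars {φ : A.Hom B} {F : SuperModSheaf B} {m n : ℕ}
    (h : (F.restrictScalars φ).H0IsoC m n) : F.H0IsoC m n := h

theorem H1IsoC.of_restrictScalars {φ : A.Hom B} {F : SuperModSheaf B} {m n : ℕ}
    (h : (F.restrictScalars φ).H1IsoC m n) : F.H1IsoC m n := by
  have e : ∀ p, H1 F p ≃ₗ[ℂ] H1 (F.restrictScalars φ) p := fun p =>
    PartMap.equivH1 (F := F) (G := F.restrictScalars φ) (p := p) (q := p)
      ⟨fun _ => LinearMap.id, fun _ _ => rfl⟩ ⟨fun _ => LinearMap.id, fun _ _ => rfl⟩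
      (fun _ _ => rfl) (fun _ _ => rfl)
  exact ⟨h.1.map (e 0).trans, h.2.map (e 1).trans⟩

end Dimensions

/-! ### Operations on isomorphisms -/

section Isos

variable {A : SuperAlgSheaf}

/-- The identity. -/
def Iso.refl (F : SuperModSheaf A) : F.Iso F :=
  ⟨fun _ => LinearEquiv.refl _ _, fun _ _ => rfl, fun _ _ _ => Iff.rfl⟩

/-- The sum of two isomorphisms. -/
def Iso.sum {F G F' G' : SuperModSheaf A} (e : F.Iso F') (e' : G.Iso G') :
    (F.sum G).Iso (F'.sum G') :=
  ⟨fun U => (e.equiv U).prodCongr (e'.equiv U),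
    fun h s => Prod.ext (e.equiv_res h s.1) (e'.equiv_res h s.2),
    fun U p s => and_congr (e.equiv_mem U p s.1) (e'.equiv_mem U p s.2)⟩

/-- The parity change of an isomorphism. -/
def Iso.parity {F G : SuperModSheaf A} (e : F.Iso G) : F.parity.Iso G.parity :=
  ⟨e.equiv, e.equiv_res, fun U p s => e.equiv_mem U (p + 1) s⟩

end Isos

end SuperModSheaf

end

section

namespace SuperModSheaf

/-! ### Cohomology by means of a covering by two open subsets -/

variable {𝒜 : SuperAlgSheaf} {F : SuperModSheaf 𝒜} {p : ZMod 2}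

theorem part_inf_eq_zero {U : Opens PLine} {s : F.obj U} (h : s ∈ F.part p U)
    (h' : s ∈ F.part (p + 1) U) : s = 0 := by
  rcases zmod2_cases p with rfl | rfl
  · exact Submodule.disjoint_def.1 (F.isCompl U).disjoint s h h'
  · exact Submodule.disjoint_def.1 (F.isCompl U).disjoint s h' h

theorem exists_part_add {U : Opens PLine} (s : F.obj U) (p : ZMod 2) :
    ∃ a ∈ F.part p U, ∃ b ∈ F.part (p + 1) U, a + b = s := by
  have h : s ∈ F.part 0 U ⊔ F.part 1 U := by rw [(F.isCompl U).sup_eq_top]; trivial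
  obtain ⟨a, ha, b, hb, hs⟩ := Submodule.mem_sup.1 h
  rcases zmod2_cases p with rfl | rfl
  · exact ⟨a, ha, b, hb, hs⟩
  · exact ⟨b, hb, a, ha, by rw [add_comm, hs]⟩

theorem resPart_sep {ι : Type} {U : Opens PLine} {V : ι → Opens PLine} (hV : ∀ i, V i ≤ U)
    (hU : U ≤ ⨆ i, V i) {s t : F.part p U}
    (h : ∀ i, F.resPart p (hV i) s = F.resPart p (hV i) t) : s = t := by
  obtain rfl : U = ⨆ i, V i := le_antisymm hU (iSup_le hV)
  obtain ⟨u, -, hu⟩ := F.glue V (fun i => F.res (hV i) s.1) fun i j => by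
    rw [F.res_res, F.res_res]
  refine Subtype.ext ((hu s.1 fun _ => rfl).trans (hu t.1 fun i => ?_).symm)
  exact (congrArg Subtype.val (h i)).symm

/-- The sheaf axiom produces a glued section that is not known to be homogeneous. Its component of
the other parity restricts to zero on every `V i`, so the component of parity `p` alone already
glues the data. -/
theorem resPart_glue {ι : Type} {U : Opens PLine} {V : ι → Opens PLine} (hV : ∀ i, V i ≤ U)
    (hU : U ≤ ⨆ i, V i) (s : ∀ i, F.part p (V i))
    (hs : ∀ i j, F.resPart p inf_le_left (s i) =
      F.resPart p (inf_le_right : V i ⊓ V j ≤ V j) (s j)) :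
    ∃ t : F.part p U, ∀ i, F.resPart p (hV i) t = s i := by
  obtain rfl : U = ⨆ i, V i := le_antisymm hU (iSup_le hV)
  obtain ⟨t, ht, -⟩ := F.glue V (fun i => (s i).1) fun i j => congrArg Subtype.val (hs i j)
  obtain ⟨a, ha, b, hb, rfl⟩ := exists_part_add t p
  refine ⟨⟨a, ha⟩, fun i => Subtype.ext ?_⟩
  have h1 : F.res (hV i) b = (s i).1 - F.res (hV i) a := by rw [← ht i, map_add, add_sub_cancel_left]
  have h2 : F.res (hV i) b = 0 := part_inf_eq_zero (p := p)
    (by rw [h1]; exact sub_mem (s i).2 (F.res_mem _ _ _ ha)) (F.res_mem _ _ _ hb)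
  have h3 := ht i
  rw [map_add, h2, add_zero] at h3
  exact h3

variable (F p) in
/-- Restriction, extended by zero to pairs of open subsets which are not nested. -/
def resOrZero (U V : Opens PLine) : F.part p U →ₗ[ℂ] F.part p V := by
  classical exact if h : V ≤ U then F.resPart p h else 0

theorem resOrZero_of_le {U V : Opens PLine} (h : V ≤ U) (s : F.part p U) :
    resOrZero F p U V s = F.resPart p h s := by
  rw [resOrZero, dif_pos h]

theorem cls_eq_cls {𝒰 : PtCover} {f f' : Z1 F p 𝒰} (g : C0 F p 𝒰)
    (h : d0 F p 𝒰 g = f.1 - f'.1) : cls F p 𝒰 f = cls F p 𝒰 f' := by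
  have h1 : cls F p 𝒰 (f - f') = 0 := cls_eq_zero g h
  rw [← sub_add_cancel f f', map_add, h1, zero_add]

/-! ### Classes defined by sections on the intersection of two open subsets. -/

section TwoSets

variable (A B : Opens PLine) (hAB : ∀ x, x ∈ A ∨ x ∈ B)

open Classical in
/-- The covering by two open subsets, as a covering indexed by the points. -/
def twoCover : PtCover where
  nhd x := if x ∈ A then A else B
  mem x := by
    by_cases h : x ∈ A
    · rwa [if_pos h]
    · rw [if_neg h]; exact (hAB x).resolve_left h

open Classical in
/-- The index of the open subset chosen at a point. -/
def twoIndex (x : PLine) : ℂ := if x ∈ A then 0 else 1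

theorem twoCover_cases (x : PLine) : (twoIndex A x = 0 ∧ (twoCover A B hAB).nhd x = A) ∨
    (twoIndex A x = 1 ∧ (twoCover A B hAB).nhd x = B) := by
  by_cases h : x ∈ A
  · exact Or.inl ⟨if_pos h, if_pos h⟩
  · exact Or.inr ⟨if_neg h, if_neg h⟩

/-- This makes the formula for `twoCochain` meaningful: either the coefficient, a difference of
indices, is zero, or the section on `A ⊓ B` can genuinely be restricted. -/
theorem twoIndex_eq_or_le (x y : PLine) : twoIndex A x = twoIndex A y ∨
    (twoCover A B hAB).nhd x ⊓ (twoCover A B hAB).nhd y ≤ A ⊓ B := by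
  rcases twoCover_cases A B hAB x with ⟨h1, h2⟩ | ⟨h1, h2⟩ <;>
    rcases twoCover_cases A B hAB y with ⟨h3, h4⟩ | ⟨h3, h4⟩
  · exact Or.inl (h1.trans h3.symm)
  · right; rw [h2, h4]
  · right; rw [h2, h4, inf_comm]
  · exact Or.inl (h1.trans h3.symm)

variable (F p)

/-- The cochain on the covering by two open subsets given by a section on the intersection. -/
def twoCochain : F.part p (A ⊓ B) →ₗ[ℂ] C1 F p (twoCover A B hAB) where
  toFun r x y := (twoIndex A y - twoIndex A x) • resOrZero F p (A ⊓ B) _ r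
  map_add' r s := by funext x y; simp
  map_smul' c r := by funext x y; simp [smul_comm c]

variable {F p}

theorem resPart_twoCochain (r : F.part p (A ⊓ B)) (x y : PLine) {W : Opens PLine}
    (h : W ≤ (twoCover A B hAB).nhd x ⊓ (twoCover A B hAB).nhd y) :
    F.resPart p h (twoCochain F p A B hAB r x y) =
      (twoIndex A y - twoIndex A x) • resOrZero F p (A ⊓ B) W r := by
  change F.resPart p h ((twoIndex A y - twoIndex A x) • resOrZero F p (A ⊓ B) _ r) = _
  rw [map_smul]
  rcases twoIndex_eq_or_le A B hAB x y with h1 | h1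
  · rw [h1, sub_self, zero_smul, zero_smul]
  · rw [resOrZero_of_le h1, resOrZero_of_le (h.trans h1), F.resPart_resPart]

/-- The coefficients are differences of indices, so their alternating sum over a triple vanishes. -/
theorem twoCochain_mem (r : F.part p (A ⊓ B)) :
    twoCochain F p A B hAB r ∈ Z1 F p (twoCover A B hAB) := fun x y z => by
  rw [resPart_twoCochain, resPart_twoCochain, resPart_twoCochain, ← sub_smul, ← add_smul]
  rw [show twoIndex A z - twoIndex A y - (twoIndex A z - twoIndex A x) +
    (twoIndex A y - twoIndex A x) = 0 by ring, zero_smul]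

/-- The class given by a section on the intersection. -/
def twoClass : F.part p (A ⊓ B) →ₗ[ℂ] H1 F p :=
  cls F p (twoCover A B hAB) ∘ₗ (twoCochain F p A B hAB).codRestrict _ (twoCochain_mem A B hAB)

/-- The zero-cochain `h` on the intersection of the covering `𝒰` with `A` bounds the cocycle `f`. -/
def Bounds {𝒰 : PtCover} (f : C1 F p 𝒰) (A : Opens PLine)
    (h : ∀ x, F.part p (A ⊓ 𝒰.nhd x)) : Prop :=
  ∀ x y, F.resPart p inf_le_right (f x y) =
    F.resPart p (le_inf inf_le_left (inf_le_right.trans inf_le_right) :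
      A ⊓ (𝒰.nhd x ⊓ 𝒰.nhd y) ≤ A ⊓ 𝒰.nhd y) (h y) -
    F.resPart p (le_inf inf_le_left (inf_le_right.trans inf_le_left)) (h x)

theorem Bounds.resPart_eq {𝒰 : PtCover} {f : C1 F p 𝒰} {A : Opens PLine}
    {h : ∀ x, F.part p (A ⊓ 𝒰.nhd x)} (hf : Bounds f A h) {x y : PLine} {W : Opens PLine}
    (hA : W ≤ A) (hW : W ≤ 𝒰.nhd x ⊓ 𝒰.nhd y) :
    F.resPart p hW (f x y) = F.resPart p (le_inf hA (hW.trans inf_le_right)) (h y) -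
      F.resPart p (le_inf hA (hW.trans inf_le_left)) (h x) := by
  have := congrArg (F.resPart p (le_inf hA hW)) (hf x y)
  rwa [map_sub, F.resPart_resPart, F.resPart_resPart, F.resPart_resPart] at this

/-- A bounding cochain is only determined up to a section over `A`. This freedom is what changes the
section on the intersection by a coboundary. -/
theorem Bounds.sub {𝒰 : PtCover} {f : C1 F p 𝒰} {A : Opens PLine}
    {h : ∀ x, F.part p (A ⊓ 𝒰.nhd x)} (hf : Bounds f A h) (a : F.part p A) :
    Bounds f A fun x => h x - F.resPart p inf_le_left a := fun x y => by
  rw [hf x y, map_sub, map_sub, F.resPart_resPart, F.resPart_resPart, sub_sub_sub_cancel_right]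

/-- If a cocycle is a coboundary on `A` and on `B`, the difference of the bounding cochains is a
section on the intersection. -/
theorem exists_glued_difference {𝒰 : PtCover} {f : C1 F p 𝒰} {A B : Opens PLine}
    {h : ∀ x, F.part p (A ⊓ 𝒰.nhd x)} {k : ∀ x, F.part p (B ⊓ 𝒰.nhd x)} (hf : Bounds f A h)
    (kf : Bounds f B k) : ∃ r : F.part p (A ⊓ B), ∀ x,
      F.resPart p inf_le_left r =
        F.resPart p (inf_le_inf_right _ inf_le_left : A ⊓ B ⊓ 𝒰.nhd x ≤ A ⊓ 𝒰.nhd x) (h x) -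
        F.resPart p (inf_le_inf_right _ inf_le_right) (k x) := by
  refine resPart_glue (fun _ => inf_le_left) (fun x hx => Opens.mem_iSup.2 ⟨x, hx, 𝒰.mem x⟩) _
    fun x y => ?_
  set W := A ⊓ B ⊓ 𝒰.nhd x ⊓ (A ⊓ B ⊓ 𝒰.nhd y)
  have hA : W ≤ A := inf_le_left.trans (inf_le_left.trans inf_le_left)
  have hB : W ≤ B := inf_le_left.trans (inf_le_left.trans inf_le_right)
  have hW : W ≤ 𝒰.nhd x ⊓ 𝒰.nhd y :=
    le_inf (inf_le_left.trans inf_le_right) (inf_le_right.trans inf_le_right)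
  have h1 := (hf.resPart_eq hA hW).symm.trans (kf.resPart_eq hB hW)
  rw [map_sub, map_sub, F.resPart_resPart, F.resPart_resPart, F.resPart_resPart, F.resPart_resPart]
  rw [sub_eq_sub_iff_add_eq_add] at h1 ⊢
  rw [add_comm, ← h1, add_comm]

/-- On a common refinement with the two-set covering, take `h x` or `k x` according to the set
assigned to x. When both points have the same set, the coboundary of this cochain is `f`; when they
have different sets, the discrepancy is `h - k = r` up to sign, which is exactly the cochain of `r`.
-/
theorem cls_eq_twoClass {𝒰 : PtCover} (f : Z1 F p 𝒰)
    {h : ∀ x, F.part p (A ⊓ 𝒰.nhd x)} {k : ∀ x, F.part p (B ⊓ 𝒰.nhd x)} (hf : Bounds f.1 A h)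
    (kf : Bounds f.1 B k) {r : F.part p (A ⊓ B)} (hr : ∀ x, F.resPart p inf_le_left r =
        F.resPart p (inf_le_inf_right _ inf_le_left : A ⊓ B ⊓ 𝒰.nhd x ≤ A ⊓ 𝒰.nhd x) (h x) -
        F.resPart p (inf_le_inf_right _ inf_le_right) (k x)) :
    cls F p 𝒰 f = twoClass A B hAB r := by
  classical
  have hr' : ∀ x, ∀ {W : Opens PLine} (hA : W ≤ A) (hB : W ≤ B) (hx : W ≤ 𝒰.nhd x),
      F.resPart p (le_inf hA hx) (h x) =
        F.resPart p (le_inf hB hx) (k x) + F.resPart p (le_inf hA hB) r := by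
    intro x W hA hB hx
    have := congrArg (F.resPart p (le_inf (le_inf hA hB) hx)) (hr x)
    rw [map_sub, F.resPart_resPart, F.resPart_resPart, F.resPart_resPart] at this
    rw [this, add_sub_cancel]
  obtain ⟨𝒲, hU, hT⟩ := exists_ge_ge 𝒰 (twoCover A B hAB)
  rw [twoClass, LinearMap.comp_apply, ← cls_refine hU, ← cls_refine hT]
  have hcase : ∀ x, ∃ g : F.part p (𝒲.nhd x),
      (twoIndex A x = 0 ∧ ∃ hA : 𝒲.nhd x ≤ A, g = F.resPart p (le_inf hA (hU x)) (h x)) ∨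
      (twoIndex A x = 1 ∧ ∃ hB : 𝒲.nhd x ≤ B, g = F.resPart p (le_inf hB (hU x)) (k x)) := by
    intro x
    rcases twoCover_cases A B hAB x with ⟨h1, h2⟩ | ⟨h1, h2⟩
    · exact ⟨_, Or.inl ⟨h1, h2 ▸ hT x, rfl⟩⟩
    · exact ⟨_, Or.inr ⟨h1, h2 ▸ hT x, rfl⟩⟩
  choose g hg using hcase
  refine cls_eq_cls g (funext fun x => funext fun y => ?_)
  change F.resPart p _ (g y) - F.resPart p _ (g x) =
    F.resPart p (inf_le_inf (hU x) (hU y)) (f.1 x y) -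
      F.resPart p (inf_le_inf (hT x) (hT y)) (twoCochain F p A B hAB r x y)
  rw [resPart_twoCochain]
  have hx : 𝒲.nhd x ⊓ 𝒲.nhd y ≤ 𝒰.nhd x := inf_le_left.trans (hU x)
  have hy : 𝒲.nhd x ⊓ 𝒲.nhd y ≤ 𝒰.nhd y := inf_le_right.trans (hU y)
  rcases hg x with ⟨ix, hx1, gx⟩ | ⟨ix, hx1, gx⟩ <;> rcases hg y with ⟨iy, hy1, gy⟩ | ⟨iy, hy1, gy⟩ <;>
    rw [ix, iy, gx, gy, F.resPart_resPart, F.resPart_resPart]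
  · rw [hf.resPart_eq (inf_le_left.trans hx1)]
    simp
  · rw [hf.resPart_eq (inf_le_left.trans hx1), hr' y (inf_le_left.trans hx1) (inf_le_right.trans hy1) hy,
      resOrZero_of_le (le_inf (inf_le_left.trans hx1) (inf_le_right.trans hy1))]
    simp only [sub_zero, one_smul]
    abel
  · rw [hf.resPart_eq (inf_le_right.trans hy1), hr' x (inf_le_right.trans hy1) (inf_le_left.trans hx1) hx,
      resOrZero_of_le (le_inf (inf_le_right.trans hy1) (inf_le_left.trans hx1))]
    simp only [zero_sub, neg_smul, one_smul]
    abel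
  · rw [kf.resPart_eq (inf_le_left.trans hx1)]
    simp

/-- Over a fine enough covering the cochain of `r` is the coboundary of some `g`, so `g y - g x` is
the difference of the indices times `r`. Correcting each `g x` by the appropriate multiple of `r`
makes the pieces agree on `A`, and likewise on `B`. -/
theorem exists_of_twoClass_eq_zero {r : F.part p (A ⊓ B)} (hr : twoClass A B hAB r = 0) :
    ∃ (a : F.part p A) (b : F.part p B),
      r = F.resPart p inf_le_left a - F.resPart p inf_le_right b := by
  obtain ⟨𝒱, hT, g, hg⟩ := exists_of_cls_eq_zero hr
  have hg' : ∀ x y, ∀ {W : Opens PLine} (h : W ≤ 𝒱.nhd x ⊓ 𝒱.nhd y),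
      F.resPart p (h.trans inf_le_right) (g y) - F.resPart p (h.trans inf_le_left) (g x) =
        (twoIndex A y - twoIndex A x) • resOrZero F p (A ⊓ B) W r := by
    intro x y W h
    have h1 := congrArg (F.resPart p h) (congrFun (congrFun hg x) y)
    change F.resPart p h (F.resPart p _ (g y) - F.resPart p _ (g x)) =
      F.resPart p h (F.resPart p (inf_le_inf (hT x) (hT y)) (twoCochain F p A B hAB r x y)) at h1
    rwa [map_sub, F.resPart_resPart, F.resPart_resPart, F.resPart_resPart,
      resPart_twoCochain] at h1
  have hres : ∀ (c : ℂ) (S : Opens PLine) (x : PLine), (S ⊓ 𝒱.nhd x ≤ A ⊓ B ∨ c = 0) →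
      ∀ {W : Opens PLine} (h : W ≤ S ⊓ 𝒱.nhd x),
      F.resPart p h (c • resOrZero F p (A ⊓ B) _ r) = c • resOrZero F p (A ⊓ B) W r := by
    rintro c S x (h1 | rfl) W h
    · rw [map_smul, resOrZero_of_le h1, resOrZero_of_le (h.trans h1), F.resPart_resPart]
    · rw [zero_smul, zero_smul, map_zero]
  -- The corrected pieces are `g x + (c - twoIndex A x) r`. With c = 0 on `A` and c = 1 on `B`, the
  -- multiple of `r` is nonzero only on pieces inside `A ⊓ B`, where `r` is defined.
  have hglue : ∀ (S : Opens PLine) (c : ℂ),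
      (∀ x, S ⊓ 𝒱.nhd x ≤ A ⊓ B ∨ c - twoIndex A x = 0) →
      ∃ t : F.part p S, ∀ x, ∀ {W : Opens PLine} (h : W ≤ S ⊓ 𝒱.nhd x),
        F.resPart p (h.trans inf_le_left) t = F.resPart p (h.trans inf_le_right) (g x) +
          (c - twoIndex A x) • resOrZero F p (A ⊓ B) W r := by
    intro S c hS
    obtain ⟨t, ht⟩ := resPart_glue (F := F) (p := p) (U := S) (V := fun x => S ⊓ 𝒱.nhd x)
      (fun _ => inf_le_left) (fun x hx => Opens.mem_iSup.2 ⟨x, hx, 𝒱.mem x⟩)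
      (fun x => F.resPart p inf_le_right (g x) +
        (c - twoIndex A x) • resOrZero F p (A ⊓ B) _ r) fun x y => by
        rw [map_add, map_add, hres _ _ _ (hS x), hres _ _ _ (hS y), F.resPart_resPart,
          F.resPart_resPart]
        have h1 := hg' x y (W := S ⊓ 𝒱.nhd x ⊓ (S ⊓ 𝒱.nhd y))
          (le_inf (inf_le_left.trans inf_le_right) (inf_le_right.trans inf_le_right))
        rw [sub_eq_iff_eq_add] at h1
        rw [h1, add_right_comm, ← add_smul, add_comm, sub_add_sub_cancel']
    refine ⟨t, fun x W h => ?_⟩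
    have h1 := congrArg (F.resPart p h) (ht x)
    rwa [map_add, hres _ _ _ (hS x), F.resPart_resPart, F.resPart_resPart] at h1
  have hle : ∀ x, 𝒱.nhd x ≤ A ∧ twoIndex A x = 0 ∨ 𝒱.nhd x ≤ B ∧ twoIndex A x = 1 := by
    intro x
    rcases twoCover_cases A B hAB x with ⟨h1, h2⟩ | ⟨h1, h2⟩
    · exact Or.inl ⟨h2 ▸ hT x, h1⟩
    · exact Or.inr ⟨h2 ▸ hT x, h1⟩
  obtain ⟨b, hb⟩ := hglue A 0 fun x => by
    rcases hle x with ⟨h1, h2⟩ | ⟨h1, h2⟩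
    · right; rw [h2, sub_zero]
    · left; exact inf_le_inf_left _ h1
  obtain ⟨a, ha⟩ := hglue B 1 fun x => by
    rcases hle x with ⟨h1, h2⟩ | ⟨h1, h2⟩
    · left; rw [inf_comm A]; exact inf_le_inf_left _ h1
    · right; rw [h2, sub_self]
  -- The section glued on `B` exceeds the one glued on `A` by `(1 - 0) r`, hence the signs.
  refine ⟨-b, -a, resPart_sep (V := fun x => A ⊓ B ⊓ 𝒱.nhd x) (fun _ => inf_le_left)
    (fun x hx => Opens.mem_iSup.2 ⟨x, hx, 𝒱.mem x⟩) fun x => ?_⟩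
  rw [map_neg, map_neg, map_sub, map_neg, map_neg, F.resPart_resPart, F.resPart_resPart,
    hb x (inf_le_inf_right _ inf_le_left), ha x (inf_le_inf_right _ inf_le_right),
    resOrZero_of_le inf_le_left, sub_smul, sub_smul, one_smul, zero_smul]
  abel

/-- The first cohomology, by means of a covering by two open subsets on which every cocycle is a
coboundary. -/
theorem H1_equiv_of_twoCover (hAB : ∀ x, x ∈ A ∨ x ∈ B)
    (hA : ∀ 𝒰, ∀ f ∈ Z1 F p 𝒰, ∃ h : ∀ x, F.part p (A ⊓ 𝒰.nhd x), Bounds f A h)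
    (hB : ∀ 𝒰, ∀ f ∈ Z1 F p 𝒰, ∃ h : ∀ x, F.part p (B ⊓ 𝒰.nhd x), Bounds f B h)
    {W : Type} [AddCommGroup W] [Module ℂ W] (T : W →ₗ[ℂ] F.part p (A ⊓ B))
    (hs : ∀ r, ∃ w a b, r = T w + (F.resPart p inf_le_left a - F.resPart p inf_le_right b))
    (hi : ∀ w a b, T w = F.resPart p inf_le_left a - F.resPart p inf_le_right b → w = 0) :
    Nonempty (H1 F p ≃ₗ[ℂ] W) := by
  refine ⟨(LinearEquiv.ofBijective (twoClass A B hAB ∘ₗ T) ⟨?_, fun c => ?_⟩).symm⟩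
  · refine (injective_iff_map_eq_zero _).2 fun w hw => ?_
    obtain ⟨a, b, h⟩ := exists_of_twoClass_eq_zero A B hAB hw
    exact hi w a b h
  · obtain ⟨𝒰, f, rfl⟩ := cls_surjective c
    obtain ⟨h, hf⟩ := hA 𝒰 f.1 f.2
    obtain ⟨k, kf⟩ := hB 𝒰 f.1 f.2
    obtain ⟨r, hr⟩ := exists_glued_difference hf kf
    obtain ⟨w, a, b, hw⟩ := hs r
    -- Subtracting a and b from the bounding cochains replaces `r` by `r - (a - b) = T w`.
    refine ⟨w, (cls_eq_twoClass A B hAB f (hf.sub a) (kf.sub b) fun x => ?_).symm⟩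
    have h1 := hr x
    rw [hw, map_add, map_sub, F.resPart_resPart, F.resPart_resPart] at h1
    rw [map_sub, map_sub, F.resPart_resPart, F.resPart_resPart, eq_sub_of_add_eq h1]
    abel

end TwoSets

end SuperModSheaf

end

section

open Metric Filter

/-! ### Holomorphic functions on discs -/

theorem eq_zero_of_punctured {g : ℂ → ℂ} (hg : DifferentiableOn ℂ g (ball 0 2))
    (h : ∀ z ∈ ball (0 : ℂ) 2, z ≠ 0 → g z = 0) : ∀ z ∈ ball (0 : ℂ) 2, g z = 0 := by
  intro z hz
  rcases eq_or_ne z 0 with rfl | hz0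
  · have h0 : ContinuousAt g 0 := (hg.differentiableAt (isOpen_ball.mem_nhds hz)).continuousAt
    have h1 : Tendsto g (𝓝[≠] 0) (𝓝 0) := by
      refine tendsto_const_nhds.congr' ?_
      filter_upwards [self_mem_nhdsWithin, nhdsWithin_le_nhds (isOpen_ball.mem_nhds hz)] with y hy hy'
      exact (h y hy' hy).symm
    exact tendsto_nhds_unique (h0.tendsto.mono_left nhdsWithin_le_nhds) h1
  · exact h z hz hz0

/-- Iterated difference quotients at 0 peel off one coefficient at a time. The identity is
algebraic, so it holds for every z and not only in the disc; holomorphy of the remainder is claimed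
on the disc alone. -/
theorem exists_taylor {f : ℂ → ℂ} (hf : DifferentiableOn ℂ f (ball 0 2)) (N : ℕ) :
    ∃ (c : Fin N → ℂ) (g : ℂ → ℂ), DifferentiableOn ℂ g (ball 0 2) ∧
      ∀ z, f z = ∑ j, c j * z ^ (j : ℕ) + z ^ N * g z := by
  induction N with
  | zero => exact ⟨Fin.elim0, f, hf, fun z => by simp⟩
  | succ N ih =>
    obtain ⟨c, g, hg, h⟩ := ih
    refine ⟨Fin.snoc c (g 0), dslope g 0,
      (Complex.differentiableOn_dslope (ball_mem_nhds 0 two_pos)).2 hg, fun z => ?_⟩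
    have h1 := sub_smul_dslope g 0 z
    rw [sub_zero, smul_eq_mul] at h1
    rw [h, Fin.sum_univ_castSucc]
    simp only [Fin.snoc_castSucc, Fin.snoc_last, Fin.val_castSucc, Fin.val_last]
    rw [pow_succ]
    linear_combination -z ^ N * h1

/-- Evaluation at 0 gives the constant coefficient; dividing by z gives the same problem with one
coefficient fewer, first off the origin and then, by continuity, at it. -/
theorem taylor_unique {N : ℕ} {c : Fin N → ℂ} {g : ℂ → ℂ} (hg : DifferentiableOn ℂ g (ball 0 2))
    (h : ∀ z ∈ ball (0 : ℂ) 2, ∑ j, c j * z ^ (j : ℕ) + z ^ N * g z = 0) : c = 0 := by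
  induction N with
  | zero => exact funext fun j => j.elim0
  | succ N ih =>
    have h0 : c 0 = 0 := by
      have := h 0 (mem_ball_self two_pos)
      rw [Fin.sum_univ_succ] at this
      simpa using this
    have h1 := ih (c := fun j => c j.succ) (eq_zero_of_punctured ?_ fun z hz hz0 => ?_)
    · funext j
      refine Fin.cases h0 (fun i => congrFun h1 i) j
    · refine DifferentiableOn.add ?_ ((differentiableOn_id.pow N).mul hg)
      exact (Differentiable.fun_sum fun j _ => by fun_prop).differentiableOn
    · have h2 := h z hz
      rw [Fin.sum_univ_succ, h0] at h2
      refine (mul_eq_zero.1 (?_ : z * _ = 0)).resolve_left hz0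
      rw [← h2, mul_add, Finset.mul_sum]
      simp only [Fin.val_succ, pow_succ, zero_mul, zero_add]
      congr 1
      · exact Finset.sum_congr rfl fun j _ => by ring
      · ring

theorem inv_mem_ball_two {z : ℂ} (hz : 1 / 2 < ‖z‖) : z⁻¹ ∈ ball (0 : ℂ) 2 := by
  rw [mem_ball_zero_iff, norm_inv]
  exact inv_lt_of_inv_lt₀ two_pos (by rwa [← one_div])

/-- Liouville's theorem on the projective line, covered by two discs. -/
theorem eq_zero_of_glue {a d : ℂ → ℂ} (ha : DifferentiableOn ℂ a (ball 0 2))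
    (hd : DifferentiableOn ℂ d (ball 0 2))
    (h : ∀ z : ℂ, 1 / 2 < ‖z‖ → ‖z‖ < 2 → a z = z⁻¹ * d z⁻¹) :
    (∀ z ∈ ball (0 : ℂ) 2, a z = 0) ∧ ∀ w ∈ ball (0 : ℂ) 2, d w = 0 := by
  -- The two functions patch to an entire function. The factor `z⁻¹` makes it tend to 0 at infinity,
  -- so it vanishes by Liouville's theorem.
  let E : ℂ → ℂ := fun z => if ‖z‖ < 2 then a z else z⁻¹ * d z⁻¹
  have hE0 : ∀ z, ‖z‖ < 2 → E z = a z := fun z hz => if_pos hz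
  have hE1 : ∀ z, 1 / 2 < ‖z‖ → E z = z⁻¹ * d z⁻¹ := fun z hz => by
    by_cases h2 : ‖z‖ < 2
    · rw [hE0 z h2, h z hz h2]
    · exact if_neg h2
  have hE : Differentiable ℂ E := by
    intro z
    by_cases hz : ‖z‖ < 2
    · refine (ha.differentiableAt (isOpen_ball.mem_nhds (by simpa using hz))).congr_of_eventuallyEq ?_
      filter_upwards [(isOpen_lt continuous_norm continuous_const).mem_nhds hz] with y hy
      exact hE0 y hy
    · have hz1 : 1 / 2 < ‖z‖ := by linarith
      have hz0 : z ≠ 0 := norm_pos_iff.1 (by linarith)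
      have h1 := (hd.differentiableAt (isOpen_ball.mem_nhds (inv_mem_ball_two hz1))).comp z
        (differentiableAt_inv hz0)
      refine ((differentiableAt_inv hz0).mul h1).congr_of_eventuallyEq ?_
      filter_upwards [(isOpen_lt continuous_const continuous_norm).mem_nhds hz1] with y hy
      exact hE1 y hy
  have hlim : Tendsto E (cocompact ℂ) (𝓝 0) := by
    have h0 : Tendsto (fun z : ℂ => z⁻¹) (cocompact ℂ) (𝓝 0) := by
      rw [← Metric.cobounded_eq_cocompact]; exact tendsto_inv₀_cobounded
    have h1 : Tendsto d (𝓝 0) (𝓝 (d 0)) :=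
      (hd.differentiableAt (ball_mem_nhds 0 two_pos)).continuousAt.tendsto
    have h2 := h0.mul (h1.comp h0)
    rw [zero_mul] at h2
    refine h2.congr' ?_
    filter_upwards [tendsto_norm_cocompact_atTop.eventually_gt_atTop (1 / 2)] with z hz
    exact (hE1 z hz).symm
  have hz : ∀ z, E z = 0 := fun z => hE.apply_eq_of_tendsto_cocompact z hlim
  refine ⟨fun z h => ?_, eq_zero_of_punctured hd fun w hw hw0 => ?_⟩
  · rw [← hE0 z (by simpa using h), hz]
  · have h1 : 1 / 2 < ‖w⁻¹‖ := by
      rw [norm_inv, one_div]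
      exact inv_strictAnti₀ (norm_pos_iff.2 hw0) (by simpa using hw)
    have h2 := hE1 _ h1
    rw [hz, inv_inv] at h2
    exact (mul_eq_zero.1 h2.symm).resolve_left hw0

/-! ### Sections of `O(n)` as pairs of functions -/

/-- A holomorphic function, as an element of the algebra `Hol S`. -/
def Hol.of (S : Opens ℂ) (f : ℂ → ℂ) (hf : DifferentiableOn ℂ f S) : Hol S :=
  ⟨fun z => f z, hf.congr fun _ hz => extz_of_mem _ hz⟩

theorem Hol.extz_of {S : Opens ℂ} {f : ℂ → ℂ} (hf : DifferentiableOn ℂ f S) {z : ℂ} (hz : z ∈ S) :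
    extz (Hol.of S f hf).1 z = f z := extz_of_mem _ hz

theorem Hol.ext_extz {S : Opens ℂ} {f g : Hol S} (h : ∀ z ∈ S, extz f.1 z = extz g.1 z) :
    f = g := Subtype.ext (funext fun z => by
  rw [← extz_of_mem f.1 z.2, ← extz_of_mem g.1 z.2, h z z.2])

/-- Evaluation at a point. -/
def Hol.eval {S : Opens ℂ} (z : S) : Hol S →ₐ[ℂ] ℂ :=
  (Pi.evalAlgHom ℂ (fun _ : S => ℂ) z).comp (holSubalgebra S).val

theorem Hol.eval_coordUnit_zpow (n : ℤ) (w : Cstar) :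
    Hol.eval w ((Hol.coordUnit ^ n : (Hol Cstar)ˣ) : Hol Cstar) = (w : ℂ) ^ n := by
  have h : ((Units.map (Hol.eval w : Hol Cstar →* ℂ) (Hol.coordUnit ^ n) : ℂˣ) : ℂ) =
      (w : ℂ) ^ n := by
    rw [map_zpow, Units.val_zpow_eq_zpow_val]
    rfl
  exact h

/-- Pointwise form of the transition rule, which turns later verifications into identities between
complex numbers. -/
theorem mem_OnPair_iff {n : ℤ} {V : Opens PLine} {f : Hol (ch0 V) × Hol (ch1 V)} :
    f ∈ OnPair n V ↔ ∀ w ∈ ov V, extz f.2.1 w = w ^ n * extz f.1.1 w⁻¹ := by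
  have h : ∀ w (hw : w ∈ ov V), (Hol.ov1 V f.2).1 ⟨w, hw⟩ = extz f.2.1 w ∧
      (Hol.ovC V ((Hol.coordUnit ^ n : (Hol Cstar)ˣ) : Hol Cstar) * Hol.ov0 V f.1).1 ⟨w, hw⟩ =
        w ^ n * extz f.1.1 w⁻¹ := fun w hw => by
    constructor
    · exact (extz_of_mem f.2.1 (show w ∈ ch1 V from hw.2)).symm
    · rw [← Hol.eval_coordUnit_zpow n ⟨w, hw.1⟩, extz_of_mem _ (inv_mem_ch0 w hw)]
      rfl
  constructor
  · intro hf w hw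
    rw [← (h w hw).1, ← (h w hw).2]
    exact congrFun (congrArg Subtype.val hf) ⟨w, hw⟩
  · intro hf
    refine Subtype.ext (funext fun w => ?_)
    rw [(h w w.2).1, (h w w.2).2]
    exact hf w w.2

theorem extz_add {S : Opens ℂ} (f g : S → ℂ) (z : ℂ) : extz (f + g) z = extz f z + extz g z := by
  by_cases h : z ∈ S
  · simp [extz_of_mem _ h]
  · simp [extz, h]

theorem extz_smul {S : Opens ℂ} (c : ℂ) (f : S → ℂ) (z : ℂ) : extz (c • f) z = c * extz f z := by
  by_cases h : z ∈ S
  · simp [extz_of_mem _ h]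
  · simp [extz, h]

namespace On

variable {n : ℤ} {V : Opens PLine}

/-- The function of `z` given by a section of `O(n)`. -/
def fn0 (z : ℂ) : On n V →ₗ[ℂ] ℂ where
  toFun s := extz s.1.1.1 z
  map_add' s t := extz_add s.1.1.1 t.1.1.1 z
  map_smul' c s := extz_smul c s.1.1.1 z

/-- The function of `w` given by a section of `O(n)`. -/
def fn1 (w : ℂ) : On n V →ₗ[ℂ] ℂ where
  toFun s := extz s.1.2.1 w
  map_add' s t := extz_add s.1.2.1 t.1.2.1 w
  map_smul' c s := extz_smul c s.1.2.1 w

theorem differentiableOn_fn0 (s : On n V) : DifferentiableOn ℂ (fun z => fn0 z s) (ch0 V) :=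
  s.1.1.2

theorem differentiableOn_fn1 (s : On n V) : DifferentiableOn ℂ (fun w => fn1 w s) (ch1 V) :=
  s.1.2.2

theorem fn1_eq (s : On n V) {w : ℂ} (h0 : w ≠ 0) (hw : w ∈ ch1 V) :
    fn1 w s = w ^ n * fn0 w⁻¹ s := mem_OnPair_iff.1 s.2 w ⟨h0, hw⟩

theorem fn0_eq (s : On n V) {z : ℂ} (h0 : z ≠ 0) (hz : z ∈ ch0 V) :
    fn0 z s = z ^ n * fn1 z⁻¹ s := by
  have hz' : z⁻¹ ∈ ch1 V := by
    change chart1 z⁻¹ ∈ V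
    rw [chart1_of_ne (inv_ne_zero h0), inv_inv]; exact hz
  rw [fn1_eq s (inv_ne_zero h0) hz', inv_inv, inv_zpow, mul_inv_cancel_left₀ (zpow_ne_zero n h0)]

theorem fn0_res {U : Opens PLine} (h : V ≤ U) (s : On n U) {z : ℂ} (hz : z ∈ ch0 V) :
    fn0 z (On.res h s) = fn0 z s :=
  (extz_of_mem _ hz).trans (extz_of_mem _ (ch0_mono h hz)).symm

theorem fn1_res {U : Opens PLine} (h : V ≤ U) (s : On n U) {w : ℂ} (hw : w ∈ ch1 V) :
    fn1 w (On.res h s) = fn1 w s :=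
  (extz_of_mem _ hw).trans (extz_of_mem _ (ch1_mono h hw)).symm

theorem ext_fn {s t : On n V} (h0 : ∀ z ∈ ch0 V, fn0 z s = fn0 z t)
    (h1 : ∀ w ∈ ch1 V, fn1 w s = fn1 w t) : s = t :=
  Subtype.ext (Prod.ext (Hol.ext_extz h0) (Hol.ext_extz h1))

/-- The section given by two functions. -/
def mk (f g : ℂ → ℂ) (hf : DifferentiableOn ℂ f (ch0 V)) (hg : DifferentiableOn ℂ g (ch1 V))
    (h : ∀ w ∈ ov V, g w = w ^ n * f w⁻¹) : On n V :=
  ⟨(Hol.of _ f hf, Hol.of _ g hg), mem_OnPair_iff.2 fun w hw => by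
    rw [Hol.extz_of hg hw.2, Hol.extz_of hf (inv_mem_ch0 w hw), h w hw]⟩

theorem fn0_mk {f g : ℂ → ℂ} (hf : DifferentiableOn ℂ f (ch0 V)) (hg : DifferentiableOn ℂ g (ch1 V))
    (h : ∀ w ∈ ov V, g w = w ^ n * f w⁻¹) {z : ℂ} (hz : z ∈ ch0 V) : fn0 z (mk f g hf hg h) = f z :=
  Hol.extz_of hf hz

theorem fn1_mk {f g : ℂ → ℂ} (hf : DifferentiableOn ℂ f (ch0 V)) (hg : DifferentiableOn ℂ g (ch1 V))
    (h : ∀ w ∈ ov V, g w = w ^ n * f w⁻¹) {w : ℂ} (hw : w ∈ ch1 V) : fn1 w (mk f g hf hg h) = g w :=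
  Hol.extz_of hg hw

theorem ne_zero_of_mem_ch1 (hV : OnePoint.infty ∉ V) {w : ℂ} (hw : w ∈ ch1 V) : w ≠ 0 := by
  rintro rfl
  exact hV (by simpa [chart1] using (show chart1 0 ∈ V from hw))

theorem ne_zero_of_mem_ch0 (hV : ((0 : ℂ) : PLine) ∉ V) {z : ℂ} (hz : z ∈ ch0 V) : z ≠ 0 := by
  rintro rfl
  exact hV hz

/-- An open subset that misses infinity lies in the chart `U₀`, so the function of z carries the
whole section. -/
theorem ext_fn0 (hV : OnePoint.infty ∉ V) {s t : On n V}
    (h0 : ∀ z ∈ ch0 V, fn0 z s = fn0 z t) : s = t :=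
  ext_fn h0 fun w hw => by
    have hw0 := ne_zero_of_mem_ch1 hV hw
    rw [fn1_eq s hw0 hw, fn1_eq t hw0 hw, h0 _ (inv_mem_ch0 w ⟨hw0, hw⟩)]

theorem ext_fn1 (hV : ((0 : ℂ) : PLine) ∉ V) {s t : On n V}
    (h1 : ∀ w ∈ ch1 V, fn1 w s = fn1 w t) : s = t :=
  ext_fn (fun z hz => by
    have hz0 := ne_zero_of_mem_ch0 hV hz
    have hz' : z⁻¹ ∈ ch1 V := by
      change chart1 z⁻¹ ∈ V
      rw [chart1_of_ne (inv_ne_zero hz0), inv_inv]; exact hz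
    rw [fn0_eq s hz0 hz, fn0_eq t hz0 hz, h1 _ hz']) h1

/-- The section over an open subset of the chart `U₀` given by a function of `z`. -/
theorem exists_fn0 (hV : OnePoint.infty ∉ V) {f : ℂ → ℂ} (hf : DifferentiableOn ℂ f (ch0 V)) :
    ∃ s : On n V, ∀ z ∈ ch0 V, fn0 z s = f z := by
  refine ⟨mk f (fun w => w ^ n * f w⁻¹) hf (fun w hw => ?_) fun w _ => rfl, fun z hz => fn0_mk _ _ _ hz⟩
  have hw0 := ne_zero_of_mem_ch1 hV hw
  have h1 := hf.differentiableAt ((ch0 V).isOpen.mem_nhds (inv_mem_ch0 w ⟨hw0, hw⟩))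
  exact ((differentiableAt_zpow.2 (Or.inl hw0)).mul
    (h1.comp w (differentiableAt_inv hw0))).differentiableWithinAt

/-- The section over an open subset of the chart `U₁` given by a function of `w`. -/
theorem exists_fn1 (hV : ((0 : ℂ) : PLine) ∉ V) {f : ℂ → ℂ} (hf : DifferentiableOn ℂ f (ch1 V)) :
    ∃ s : On n V, ∀ w ∈ ch1 V, fn1 w s = f w := by
  refine ⟨mk (fun z => z ^ n * f z⁻¹) f (fun z hz => ?_) hf fun w hw => ?_, fun z hz => fn1_mk _ _ _ hz⟩
  · have hz0 := ne_zero_of_mem_ch0 hV hz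
    have hz' : z⁻¹ ∈ ch1 V := by
      change chart1 z⁻¹ ∈ V
      rw [chart1_of_ne (inv_ne_zero hz0), inv_inv]; exact hz
    have h1 := hf.differentiableAt ((ch1 V).isOpen.mem_nhds hz')
    exact ((differentiableAt_zpow.2 (Or.inl hz0)).mul
      (h1.comp z (differentiableAt_inv hz0))).differentiableWithinAt
  · rw [inv_inv, inv_zpow, mul_inv_cancel_left₀ (zpow_ne_zero n hw.1)]

end On

end

section

open Metric Filter

/-! ### Cohomology of `O(n)` -/

/-- The disc `|z| < 2` in the chart `U₀`. -/
def disc0 : Opens PLine :=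
  ⟨(fun z : ℂ => (z : PLine)) '' ball 0 2, OnePoint.isOpenEmbedding_coe.isOpenMap _ isOpen_ball⟩

/-- The disc `|w| < 2` in the chart `U₁`. -/
def disc1 : Opens PLine :=
  ⟨((fun z : ℂ => (z : PLine)) '' closedBall 0 (1 / 2))ᶜ,
    ((isCompact_closedBall _ _).image OnePoint.continuous_coe).isClosed.isOpen_compl⟩

theorem mem_ch0_disc0 {z : ℂ} : z ∈ ch0 disc0 ↔ ‖z‖ < 2 := by
  change (z : PLine) ∈ (fun z : ℂ => (z : PLine)) '' ball 0 2 ↔ _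
  rw [OnePoint.coe_injective.mem_set_image, mem_ball_zero_iff]

theorem mem_ch0_disc1 {z : ℂ} : z ∈ ch0 disc1 ↔ 1 / 2 < ‖z‖ := by
  change ¬ (z : PLine) ∈ (fun z : ℂ => (z : PLine)) '' closedBall 0 (1 / 2) ↔ _
  rw [OnePoint.coe_injective.mem_set_image, mem_closedBall_zero_iff, not_le]

theorem infty_notMem_disc0 : OnePoint.infty ∉ disc0 := by
  rintro ⟨z, -, hz⟩
  exact OnePoint.coe_ne_infty z hz

theorem infty_mem_disc1 : OnePoint.infty ∈ disc1 := by
  rintro ⟨z, -, hz⟩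
  exact OnePoint.coe_ne_infty z hz

theorem zero_notMem_disc1 : ((0 : ℂ) : PLine) ∉ disc1 := fun h => by
  have := mem_ch0_disc1.1 (show (0 : ℂ) ∈ ch0 disc1 from h)
  norm_num at this

theorem infty_notMem_inf {V : Opens PLine} : OnePoint.infty ∉ disc0 ⊓ V := fun h =>
  infty_notMem_disc0 h.1

theorem zero_notMem_inf {V : Opens PLine} : ((0 : ℂ) : PLine) ∉ disc1 ⊓ V := fun h =>
  zero_notMem_disc1 h.1

theorem mem_ch1_disc1 {w : ℂ} : w ∈ ch1 disc1 ↔ ‖w‖ < 2 := by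
  rcases eq_or_ne w 0 with rfl | hw
  · have h : chart1 0 = OnePoint.infty := if_pos rfl
    refine iff_of_true ?_ (by simp)
    change chart1 0 ∈ disc1
    rw [h]; exact infty_mem_disc1
  · change chart1 w ∈ disc1 ↔ _
    rw [chart1_of_ne hw]
    refine mem_ch0_disc1.trans ?_
    rw [norm_inv, one_div, inv_lt_inv₀ two_pos (norm_pos_iff.2 hw)]

theorem disc_cover (x : PLine) : x ∈ disc0 ∨ x ∈ disc1 := by
  induction x using OnePoint.rec with
  | infty => exact Or.inr infty_mem_disc1
  | coe z =>
    rcases lt_or_ge ‖z‖ 2 with h | h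
    · exact Or.inl (mem_ch0_disc0.2 h)
    · exact Or.inr (mem_ch0_disc1.2 (by linarith))

theorem coe_ch0_disc0 : (ch0 disc0 : Set ℂ) = ball 0 2 :=
  Set.ext fun _ => mem_ch0_disc0.trans mem_ball_zero_iff.symm

theorem coe_ch1_disc1 : (ch1 disc1 : Set ℂ) = ball 0 2 :=
  Set.ext fun _ => mem_ch1_disc1.trans mem_ball_zero_iff.symm

theorem coe_mem_iff_mem_ch1 {V : Opens PLine} {z : ℂ} (hz : z ≠ 0) :
    z ∈ ch0 V ↔ z⁻¹ ∈ ch1 V := by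
  change _ ↔ chart1 z⁻¹ ∈ V
  rw [chart1_of_ne (inv_ne_zero hz), inv_inv]
  exact Iff.rfl

/-- The sections of `O(n)`, as homogeneous sections of parity zero. -/
def onPart (n : ℤ) (V : Opens PLine) : On n V ≃ₗ[ℂ] (sheafO n).part 0 V :=
  (LinearEquiv.ofTop _ (evenPart_zero (On n V))).symm

theorem onPart_symm_res {n : ℤ} {U V : Opens PLine} (h : V ≤ U) (s : (sheafO n).part 0 U) :
    (onPart n V).symm ((sheafO n).resPart 0 h s) = On.res h ((onPart n U).symm s) := rfl

theorem cocycle_on {n : ℤ} {𝒰 : PtCover} {f : SuperModSheaf.C1 (sheafO n) 0 𝒰}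
    (hf : f ∈ SuperModSheaf.Z1 (sheafO n) 0 𝒰) (x y z : PLine) :
    On.res (le_inf (inf_le_left.trans inf_le_right) inf_le_right :
        𝒰.nhd x ⊓ 𝒰.nhd y ⊓ 𝒰.nhd z ≤ 𝒰.nhd y ⊓ 𝒰.nhd z) ((onPart n _).symm (f y z))
      - On.res (le_inf (inf_le_left.trans inf_le_left) inf_le_right :
        𝒰.nhd x ⊓ 𝒰.nhd y ⊓ 𝒰.nhd z ≤ 𝒰.nhd x ⊓ 𝒰.nhd z) ((onPart n _).symm (f x z))
      + On.res (inf_le_left :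
        𝒰.nhd x ⊓ 𝒰.nhd y ⊓ 𝒰.nhd z ≤ 𝒰.nhd x ⊓ 𝒰.nhd y) ((onPart n _).symm (f x y)) = 0 := by
  have := congrArg (onPart n _).symm (hf x y z)
  rwa [map_add, map_sub, map_zero] at this

/-- In the coordinate z the cocycle becomes a cocycle of holomorphic functions for the covering of
the plane by the sets `ch0 (𝒰.nhd x)`. The Cousin problem is solved on the disc of radius 2, and the
solutions are read back as sections, `disc0` being inside one chart. -/
theorem bounds_disc0 (n : ℤ) (𝒰 : PtCover) (f : SuperModSheaf.C1 (sheafO n) 0 𝒰)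
    (hf : f ∈ SuperModSheaf.Z1 (sheafO n) 0 𝒰) :
    ∃ h : ∀ x, (sheafO n).part 0 (disc0 ⊓ 𝒰.nhd x), SuperModSheaf.Bounds f disc0 h := by
  obtain ⟨h, hh, hd⟩ := exists_holomorphic_splitting (fun x => (ch0 (𝒰.nhd x) : Set ℂ))
    (fun x => (ch0 (𝒰.nhd x)).isOpen) (fun z => ⟨z, 𝒰.mem z⟩)
    (fun x y z => On.fn0 z ((onPart n _).symm (f x y)))
    (fun x y => On.differentiableOn_fn0 ((onPart n _).symm (f x y)))
    (fun x y z t ht => by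
      have h1 := congrArg (On.fn0 t) (cocycle_on hf x y z)
      rw [map_add, map_sub, map_zero] at h1
      have ht' : t ∈ ch0 (𝒰.nhd x ⊓ 𝒰.nhd y ⊓ 𝒰.nhd z) := ht
      rwa [On.fn0_res _ _ ht', On.fn0_res _ _ ht', On.fn0_res _ _ ht'] at h1) two_pos
  have hs : ∀ x, ∃ s : On n (disc0 ⊓ 𝒰.nhd x), ∀ z ∈ ch0 (disc0 ⊓ 𝒰.nhd x), On.fn0 z s = h x z :=
    fun x => On.exists_fn0 infty_notMem_inf ((hh x).mono fun z hz => ⟨hz.2, by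
      rw [← coe_ch0_disc0]; exact hz.1⟩)
  choose s hs using hs
  refine ⟨fun x => onPart n _ (s x), fun x y => (onPart n _).symm.injective ?_⟩
  rw [map_sub, onPart_symm_res, onPart_symm_res, onPart_symm_res, LinearEquiv.symm_apply_apply,
    LinearEquiv.symm_apply_apply]
  refine On.ext_fn0 infty_notMem_inf fun z hz => ?_
  rw [map_sub, On.fn0_res _ _ hz, On.fn0_res _ _ hz, On.fn0_res _ _ hz, hs x z ⟨hz.1, hz.2.1⟩,
    hs y z ⟨hz.1, hz.2.2⟩]
  exact (hd x y z hz.2).symm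

/-- The same argument in the coordinate w, where points of the plane are sent to the sphere by
`chart1`. -/
theorem bounds_disc1 (n : ℤ) (𝒰 : PtCover) (f : SuperModSheaf.C1 (sheafO n) 0 𝒰)
    (hf : f ∈ SuperModSheaf.Z1 (sheafO n) 0 𝒰) :
    ∃ h : ∀ x, (sheafO n).part 0 (disc1 ⊓ 𝒰.nhd x), SuperModSheaf.Bounds f disc1 h := by
  obtain ⟨h, hh, hd⟩ := exists_holomorphic_splitting (fun x => (ch1 (𝒰.nhd x) : Set ℂ))
    (fun x => (ch1 (𝒰.nhd x)).isOpen) (fun z => ⟨chart1 z, 𝒰.mem (chart1 z)⟩)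
    (fun x y z => On.fn1 z ((onPart n _).symm (f x y)))
    (fun x y => On.differentiableOn_fn1 ((onPart n _).symm (f x y)))
    (fun x y z t ht => by
      have h1 := congrArg (On.fn1 t) (cocycle_on hf x y z)
      rw [map_add, map_sub, map_zero] at h1
      have ht' : t ∈ ch1 (𝒰.nhd x ⊓ 𝒰.nhd y ⊓ 𝒰.nhd z) := ht
      rwa [On.fn1_res _ _ ht', On.fn1_res _ _ ht', On.fn1_res _ _ ht'] at h1) two_pos
  have hs : ∀ x, ∃ s : On n (disc1 ⊓ 𝒰.nhd x), ∀ z ∈ ch1 (disc1 ⊓ 𝒰.nhd x), On.fn1 z s = h x z :=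
    fun x => On.exists_fn1 zero_notMem_inf ((hh x).mono fun z hz => ⟨hz.2, by
      rw [← coe_ch1_disc1]; exact hz.1⟩)
  choose s hs using hs
  refine ⟨fun x => onPart n _ (s x), fun x y => (onPart n _).symm.injective ?_⟩
  rw [map_sub, onPart_symm_res, onPart_symm_res, onPart_symm_res, LinearEquiv.symm_apply_apply,
    LinearEquiv.symm_apply_apply]
  refine On.ext_fn1 zero_notMem_inf fun z hz => ?_
  rw [map_sub, On.fn1_res _ _ hz, On.fn1_res _ _ hz, On.fn1_res _ _ hz, hs x z ⟨hz.1, hz.2.1⟩,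
    hs y z ⟨hz.1, hz.2.2⟩]
  exact (hd x y z hz.2).symm

/-- The section `∑ⱼ cⱼ z^(-(j+1))` of `O(n)` over the annulus. -/
theorem exists_tails (n : ℤ) (N : ℕ) : ∃ T : (Fin N → ℂ) →ₗ[ℂ] On n (disc0 ⊓ disc1),
    ∀ c, ∀ z ∈ ch0 (disc0 ⊓ disc1), On.fn0 z (T c) = ∑ j, c j * (z⁻¹) ^ ((j : ℕ) + 1) := by
  have h : ∀ c : Fin N → ℂ, ∃ s : On n (disc0 ⊓ disc1), ∀ z ∈ ch0 (disc0 ⊓ disc1),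
      On.fn0 z s = ∑ j, c j * (z⁻¹) ^ ((j : ℕ) + 1) := fun c => by
    refine On.exists_fn0 infty_notMem_inf fun z hz => DifferentiableAt.differentiableWithinAt ?_
    have hz0 : z ≠ 0 := On.ne_zero_of_mem_ch0 zero_notMem_disc1 hz.2
    exact DifferentiableAt.fun_sum fun j _ => ((differentiableAt_inv hz0).pow _).const_mul _
  choose T hT using h
  refine ⟨⟨⟨T, fun c d => On.ext_fn0 infty_notMem_inf fun z hz => ?_⟩, fun c d => On.ext_fn0 infty_notMem_inf fun z hz => ?_⟩, hT⟩
  · rw [map_add, hT _ z hz, hT _ z hz, hT _ z hz, ← Finset.sum_add_distrib]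
    exact Finset.sum_congr rfl fun j _ => by rw [Pi.add_apply]; ring
  · change On.fn0 z (T (c • d)) = On.fn0 z (c • T d)
    rw [map_smul, hT _ z hz, hT _ z hz, smul_eq_mul, Finset.mul_sum]
    exact Finset.sum_congr rfl fun j _ => by rw [Pi.smul_apply, smul_eq_mul]; ring

/-- Split off the part holomorphic in the disc |z| < 2, and expand the rest in powers of 1/z up to
order N. The remainder is `z^(-1-N) g(1/z)`, which equals `zⁿ` times the value at w = 1/z of `wᵐ
g(w)` with m = N + 1 + n. As m ≥ 0, it extends to a section of O(n) over the other disc. -/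
theorem exists_annulus_splitting {n : ℤ} {N : ℕ} (hN : 0 ≤ (N : ℤ) + 1 + n)
    {T : (Fin N → ℂ) →ₗ[ℂ] On n (disc0 ⊓ disc1)} (hT : ∀ c, ∀ z ∈ ch0 (disc0 ⊓ disc1),
      On.fn0 z (T c) = ∑ j, c j * (z⁻¹) ^ ((j : ℕ) + 1)) (r : On n (disc0 ⊓ disc1)) :
    ∃ c a b, r = T c + (On.res inf_le_left a - On.res inf_le_right b) := by
  obtain ⟨a, d, ha, hd, h⟩ := exists_laurent_splitting (r := fun z => On.fn0 z r)
    ((On.differentiableOn_fn0 r).mono fun z hz => ⟨mem_ch0_disc0.2 hz.2, mem_ch0_disc1.2 hz.1⟩)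
  obtain ⟨c, g, hg, hc⟩ := exists_taylor hd N
  obtain ⟨m, hm⟩ := Int.eq_ofNat_of_zero_le hN
  obtain ⟨sa, hsa⟩ := On.exists_fn0 (n := n) infty_notMem_disc0 (f := a)
    (by rw [coe_ch0_disc0]; exact ha)
  -- The sign is there because the coboundary is `a - b`.
  obtain ⟨sb, hsb⟩ := On.exists_fn1 (n := n) zero_notMem_disc1 (f := fun w => -(w ^ m * g w))
    (by rw [coe_ch1_disc1]; exact ((differentiableOn_id.pow m).mul hg).neg)
  refine ⟨c, sa, sb, On.ext_fn0 infty_notMem_inf fun z hz => ?_⟩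
  have hz0 : z ≠ 0 := On.ne_zero_of_mem_ch0 zero_notMem_disc1 hz.2
  rw [map_add, map_sub, hT c z hz, On.fn0_res _ _ hz, On.fn0_res _ _ hz, hsa z hz.1,
    On.fn0_eq sb hz0 hz.2, hsb _ ((coe_mem_iff_mem_ch1 hz0).1 hz.2),
    h z (mem_ch0_disc1.1 hz.2) (mem_ch0_disc0.1 hz.1), hc, mul_add, Finset.mul_sum]
  have h1 : z ^ n * (z⁻¹) ^ m = z⁻¹ * z⁻¹ ^ N := by
    rw [← zpow_natCast, ← zpow_natCast, inv_zpow', inv_zpow', ← zpow_add₀ hz0,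
      ← zpow_neg_one, ← zpow_add₀ hz0]
    congr 1
    have hm' : (N : ℤ) + 1 + n = m := hm
    omega
  have h2 : ∀ j : Fin N, z⁻¹ * (c j * z⁻¹ ^ (j : ℕ)) = c j * z⁻¹ ^ ((j : ℕ) + 1) := fun j => by
    rw [pow_succ]; ring
  rw [Finset.sum_congr rfl fun j _ => h2 j]
  linear_combination -(g z⁻¹) * h1

/-- The relation says that a function on the disc |z| < 2 equals `z⁻¹ d(z⁻¹)`, where `d` has Taylor
coefficients `c` and remainder given by `b`. This uses `zⁿ = z^(-1-N)`. Liouville's theorem gives `d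
= 0`, hence `c = 0`. -/
theorem tail_unique {n : ℤ} {N : ℕ} (hN : (N : ℤ) + 1 + n = 0)
    {T : (Fin N → ℂ) →ₗ[ℂ] On n (disc0 ⊓ disc1)} (hT : ∀ c, ∀ z ∈ ch0 (disc0 ⊓ disc1),
      On.fn0 z (T c) = ∑ j, c j * (z⁻¹) ^ ((j : ℕ) + 1)) (c : Fin N → ℂ) (a : On n disc0)
    (b : On n disc1) (h : T c = On.res inf_le_left a - On.res inf_le_right b) : c = 0 := by
  have hb : DifferentiableOn ℂ (fun w => On.fn1 w b) (ball 0 2) := by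
    rw [← coe_ch1_disc1]; exact On.differentiableOn_fn1 b
  have hd : DifferentiableOn ℂ (fun w => ∑ j : Fin N, c j * w ^ (j : ℕ) + w ^ N * On.fn1 w b)
      (ball 0 2) := by
    refine DifferentiableOn.add ?_ ((differentiableOn_id.pow N).mul hb)
    exact (Differentiable.fun_sum fun j _ => by fun_prop).differentiableOn
  refine taylor_unique hb (eq_zero_of_glue (a := fun z => On.fn0 z a)
    (by rw [← coe_ch0_disc0]; exact On.differentiableOn_fn0 a) hd fun z h1 h2 => ?_).2
  have hz : z ∈ ch0 (disc0 ⊓ disc1) := ⟨mem_ch0_disc0.2 h2, mem_ch0_disc1.2 h1⟩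
  have hz0 : z ≠ 0 := On.ne_zero_of_mem_ch0 zero_notMem_disc1 hz.2
  have h3 := congrArg (On.fn0 z) h
  rw [map_sub, hT c z hz, On.fn0_res _ _ hz, On.fn0_res _ _ hz, On.fn0_eq b hz0 hz.2] at h3
  have h4 : z ^ n = z⁻¹ * z⁻¹ ^ N := by
    rw [← zpow_natCast, inv_zpow', ← zpow_neg_one, ← zpow_add₀ hz0]
    congr 1
    omega
  rw [h4] at h3
  rw [mul_add, Finset.mul_sum]
  have h5 : ∀ j : Fin N, z⁻¹ * (c j * z⁻¹ ^ (j : ℕ)) = c j * z⁻¹ ^ ((j : ℕ) + 1) := fun j => by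
    rw [pow_succ]; ring
  rw [Finset.sum_congr rfl fun j _ => h5 j]
  linear_combination -h3

/-- Representatives are the Laurent tails with exponents from -1 down to n + 1: lower exponents
extend over `disc1`, nonnegative ones over `disc0`. -/
theorem H1_sheafO_even (n : ℤ) :
    Nonempty ((sheafO n).H1 0 ≃ₗ[ℂ] (Fin (-1 - n).toNat → ℂ)) := by
  obtain ⟨T, hT⟩ := exists_tails n (-1 - n).toNat
  refine SuperModSheaf.H1_equiv_of_twoCover disc0 disc1 disc_cover (bounds_disc0 n)
    (bounds_disc1 n) ((onPart n _).toLinearMap ∘ₗ T) (fun r => ?_) fun c a b h => ?_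
  · obtain ⟨c, a, b, h⟩ := exists_annulus_splitting (by omega) hT ((onPart n _).symm r)
    refine ⟨c, onPart n _ a, onPart n _ b, (onPart n _).symm.injective ?_⟩
    rw [h]; rfl
  · rcases le_or_gt (-1 - n) 0 with hn | hn
    · funext j
      have := j.2
      omega
    · exact tail_unique (by omega) hT c ((onPart n _).symm a) ((onPart n _).symm b)
        (congrArg (onPart n _).symm h)

theorem subsingleton_part_one (n : ℤ) (V : Opens PLine) : Subsingleton ((sheafO n).part 1 V) :=
  ⟨fun s t => Subtype.ext ((eq_zero_of_mem_evenPart (M := On n V) s.2).trans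
    (eq_zero_of_mem_evenPart (M := On n V) t.2).symm)⟩

theorem H1IsoC_sheafO (n : ℤ) : (sheafO n).H1IsoC (-1 - n).toNat 0 := by
  refine ⟨H1_sheafO_even n, ?_⟩
  have h : ∀ c : (sheafO n).H1 1, c = 0 := fun c => by
    obtain ⟨𝒰, f, rfl⟩ := SuperModSheaf.cls_surjective c
    have hf : f = 0 := Subtype.ext (funext fun x => funext fun y =>
      (subsingleton_part_one n _).elim _ _)
    rw [hf, map_zero]
  have : Subsingleton ((sheafO n).H1 1) := ⟨fun a b => (h a).trans (h b).symm⟩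
  exact ⟨0⟩

/-! ### Global sections of O(n). -/

/-- The global section `∑ⱼ cⱼ zʲ` of `O(n)`. -/
theorem exists_polynomials (n : ℤ) (N : ℕ) (hN : N = (n + 1).toNat) :
    ∃ T : (Fin N → ℂ) →ₗ[ℂ] On n ⊤,
      (∀ c z, On.fn0 z (T c) = ∑ j, c j * z ^ (j : ℕ)) ∧
      ∀ c w, On.fn1 w (T c) = ∑ j, c j * w ^ (N - 1 - (j : ℕ)) := by
  have h : ∀ c : Fin N → ℂ, ∃ s : On n ⊤, (∀ z, On.fn0 z s = ∑ j, c j * z ^ (j : ℕ)) ∧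
      ∀ w, On.fn1 w s = ∑ j, c j * w ^ (N - 1 - (j : ℕ)) := fun c => by
    refine ⟨On.mk (fun z => ∑ j, c j * z ^ (j : ℕ)) (fun w => ∑ j, c j * w ^ (N - 1 - (j : ℕ)))
      (Differentiable.fun_sum fun j _ => by fun_prop).differentiableOn
      (Differentiable.fun_sum fun j _ => by fun_prop).differentiableOn fun w hw => ?_,
      fun z => On.fn0_mk _ _ _ trivial, fun w => On.fn1_mk _ _ _ trivial⟩
    rw [Finset.mul_sum]
    refine Finset.sum_congr rfl fun j _ => ?_
    -- The existence of an index j < N forces N = n + 1, so `wⁿ w⁻ʲ = w^(N-1-j)` and the natural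
    -- subtraction is exact.
    have hj := j.2
    rw [← zpow_natCast, ← zpow_natCast, inv_zpow', mul_left_comm, ← zpow_add₀ hw.1]
    congr 2
    omega
  choose T h0 h1 using h
  refine ⟨⟨⟨T, fun c d => On.ext_fn (fun z _ => ?_) fun w _ => ?_⟩,
    fun c d => On.ext_fn (fun z _ => ?_) fun w _ => ?_⟩, h0, h1⟩
  · rw [map_add, h0, h0, h0, ← Finset.sum_add_distrib]
    exact Finset.sum_congr rfl fun j _ => by rw [Pi.add_apply]; ring
  · rw [map_add, h1, h1, h1, ← Finset.sum_add_distrib]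
    exact Finset.sum_congr rfl fun j _ => by rw [Pi.add_apply]; ring
  · change On.fn0 z (T (c • d)) = On.fn0 z (c • T d)
    rw [map_smul, h0, h0, smul_eq_mul, Finset.mul_sum]
    exact Finset.sum_congr rfl fun j _ => by rw [Pi.smul_apply, smul_eq_mul]; ring
  · change On.fn1 w (T (c • d)) = On.fn1 w (c • T d)
    rw [map_smul, h1, h1, smul_eq_mul, Finset.mul_sum]
    exact Finset.sum_congr rfl fun j _ => by rw [Pi.smul_apply, smul_eq_mul]; ring

/-- A point outside one of the discs lies in the other one, where the transition rule determines its
value. -/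
theorem On.eq_zero_of_discs {n : ℤ} {s : On n ⊤} (h0 : ∀ z ∈ ball (0 : ℂ) 2, On.fn0 z s = 0)
    (h1 : ∀ w ∈ ball (0 : ℂ) 2, On.fn1 w s = 0) : s = 0 := by
  have hlt : ∀ z : ℂ, z ∉ ball (0 : ℂ) 2 → z ≠ 0 ∧ z⁻¹ ∈ ball (0 : ℂ) 2 := fun z hz => by
    have hz : 2 ≤ ‖z‖ := by simpa using hz
    exact ⟨norm_pos_iff.1 (by linarith), inv_mem_ball_two (by linarith)⟩
  refine On.ext_fn (fun z _ => ?_) fun w _ => ?_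
  · rw [map_zero]
    by_cases hz : z ∈ ball (0 : ℂ) 2
    · exact h0 z hz
    · rw [On.fn0_eq s (hlt z hz).1 trivial, h1 _ (hlt z hz).2, mul_zero]
  · rw [map_zero]
    by_cases hw : w ∈ ball (0 : ℂ) 2
    · exact h1 w hw
    · rw [On.fn1_eq s (hlt w hw).1 trivial, h0 _ (hlt w hw).2, mul_zero]

theorem H0_sheafO_even (n : ℤ) : Nonempty (On n ⊤ ≃ₗ[ℂ] (Fin (n + 1).toNat → ℂ)) := by
  set N := (n + 1).toNat with hN
  obtain ⟨T, h0, h1⟩ := exists_polynomials n N hN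
  refine ⟨(LinearEquiv.ofBijective T ⟨?_, fun s => ?_⟩).symm⟩
  · refine (injective_iff_map_eq_zero _).2 fun c hc => ?_
    refine taylor_unique (g := fun _ => 0) (differentiableOn_const 0) fun z _ => ?_
    rw [mul_zero, add_zero, ← h0, hc, map_zero]
  · have hs0 : DifferentiableOn ℂ (fun z => On.fn0 z s) (ball 0 2) :=
      (On.differentiableOn_fn0 s).mono fun _ _ => trivial
    have hs1 : ∀ s : On n ⊤, DifferentiableOn ℂ (fun z => On.fn1 z s) (ball 0 2) := fun s =>
      (On.differentiableOn_fn1 s).mono fun _ _ => trivial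
    obtain ⟨c, g, hg, hc⟩ := exists_taylor hs0 N
    -- Here m is 0 when n ≥ -1 and -n - 1 when n is smaller, so both cases are treated together.
    obtain ⟨m, hm⟩ := Int.eq_ofNat_of_zero_le (show 0 ≤ (N : ℤ) - n - 1 by omega)
    have hm' : (N : ℤ) - n - 1 = m := hm
    have hfn0 : ∀ z, On.fn0 z (s - T c) = z ^ N * g z := fun z => by
      rw [map_sub, hc, h0, add_sub_cancel_left]
    -- After subtraction of the Taylor polynomial, the remainder `z^N g(z)` becomes `w^(n-N) g(1/w)
    -- = w⁻¹ (w⁻¹)ᵐ g(1/w)` in the other chart. Liouville's theorem applies with the roles of z and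
    -- w exchanged.
    have hz := eq_zero_of_glue (hs1 (s - T c)) (d := fun z => z ^ m * g z)
      ((differentiableOn_id.pow m).mul hg) fun w hw _ => by
        have hw0 : w ≠ 0 := norm_pos_iff.1 (by linarith)
        rw [On.fn1_eq (s - T c) hw0 trivial, hfn0, ← mul_assoc, ← mul_assoc]
        congr 1
        rw [← zpow_natCast, ← zpow_natCast, inv_zpow', inv_zpow', ← zpow_add₀ hw0,
          ← zpow_neg_one, ← zpow_add₀ hw0]
        congr 1
        omega
    refine ⟨c, (sub_eq_zero.1 (On.eq_zero_of_discs (eq_zero_of_punctured ?_ ?_) hz.1)).symm⟩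
    · exact (On.differentiableOn_fn0 _).mono fun _ _ => trivial
    · intro z hz' hz0
      have h3 := hz.2 z hz'
      rw [hfn0, (mul_eq_zero.1 h3).resolve_left (pow_ne_zero m hz0), mul_zero]

theorem H0IsoC_sheafO (n : ℤ) : (sheafO n).H0IsoC (n + 1).toNat 0 := by
  refine ⟨(H0_sheafO_even n).map (onPart n ⊤).symm.trans, ?_⟩
  have := subsingleton_part_one n ⊤
  exact ⟨0⟩

end

section

/-! ### Values of superfunctions -/

theorem extz_eq_eval {S : Opens ℂ} (f : Hol S) {w : ℂ} (hw : w ∈ S) :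
    extz f.1 w = Hol.eval ⟨w, hw⟩ f := extz_of_mem f.1 hw

theorem Hol.eval_ov0 {V : Opens PLine} (f : Hol (ch0 V)) (w : ov V) :
    Hol.eval w (Hol.ov0 V f) = extz f.1 (w : ℂ)⁻¹ :=
  (extz_of_mem f.1 (inv_mem_ch0 w w.2)).symm

theorem Hol.eval_ov1 {V : Opens PLine} (f : Hol (ch1 V)) (w : ov V) :
    Hol.eval w (Hol.ov1 V f) = extz f.1 w :=
  (extz_of_mem f.1 (show (w : ℂ) ∈ ch1 V from w.2.2)).symm

theorem Hol.eval_ovC {V : Opens PLine} (f : Hol Cstar) (w : ov V) :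
    Hol.eval w (Hol.ovC V f) = extz f.1 w :=
  (extz_of_mem f.1 (show (w : ℂ) ∈ Cstar from w.2.1)).symm

theorem Hol.ext_eval {S : Opens ℂ} {f g : Hol S} (h : ∀ w, Hol.eval w f = Hol.eval w g) : f = g :=
  Subtype.ext (funext h)

theorem extz_coordTheta {w : ℂ} (hw : w ∈ Cstar) : extz coordTheta.snd.1 w = -(w⁻¹) ^ 2 :=
  extz_of_mem _ hw

/-- Pointwise form of the gluing: the even coefficient is a function on ℙ¹, while the odd one
acquires the factor `-w⁻²` from `θ = -ψ/w²`. -/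
theorem mem_oPiSubalgebra_iff {V : Opens PLine} {f : SF (ch0 V) × SF (ch1 V)} :
    f ∈ oPiSubalgebra V ↔ ∀ w ∈ ov V, extz f.2.fst.1 w = extz f.1.fst.1 w⁻¹ ∧
      extz f.2.snd.1 w = -(w⁻¹) ^ 2 * extz f.1.snd.1 w⁻¹ := by
  rw [mem_oPiSubalgebra]
  constructor
  · intro h w hw
    have h0 := congrArg (fun x => Hol.eval ⟨w, hw⟩ (TrivSqZeroExt.fst x)) h
    have h1 := congrArg (fun x => Hol.eval ⟨w, hw⟩ (TrivSqZeroExt.snd x)) h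
    simp only [SF.ov1, SF.ov0, SF.fst_res, SF.snd_res, SF.fst_pull, SF.snd_pull, map_mul] at h0 h1
    rw [Hol.eval_ov0, Hol.eval_ovC, extz_coordTheta hw.1] at h1
    rw [Hol.eval_ov0] at h0
    refine ⟨(Hol.eval_ov1 _ ⟨w, hw⟩).symm.trans h0, ?_⟩
    rw [mul_comm]
    exact (Hol.eval_ov1 _ ⟨w, hw⟩).symm.trans h1
  · intro h
    refine TrivSqZeroExt.ext (Hol.ext_eval fun w => ?_) (Hol.ext_eval fun w => ?_)
    · simp only [SF.ov1, SF.ov0, SF.fst_res, SF.fst_pull]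
      rw [Hol.eval_ov0]
      exact (Hol.eval_ov1 _ w).trans (h w w.2).1
    · simp only [SF.ov1, SF.ov0, SF.snd_res, SF.snd_pull, map_mul]
      rw [Hol.eval_ov0, Hol.eval_ovC, extz_coordTheta w.2.1, mul_comm]
      exact (Hol.eval_ov1 _ w).trans (h w w.2).2

/-! ### The change of coordinates and the big cells -/

theorem isUnit_coordW : IsUnit coordW :=
  TrivSqZeroExt.isUnit_iff_isUnit_fst.2 Hol.coordUnit.isUnit

theorem Hol.coordInv_mul_coord : Hol.coordInv * Hol.coord Cstar = 1 :=
  (mul_comm _ _).trans Hol.coord_mul_coordInv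

/-- The first and third columns of `bigCell0` form an identity matrix, so `g` must consist of the
first and third columns of `bigCell1`. The other two columns, already in the first row, then give `w
z - ψ θ = 1` and `w θ + ψ z = 0`. A product of two odd functions vanishes, so these equations
determine z and θ. -/
theorem row_equivalent_iff {z θ : SF Cstar} (hz : z ∈ dpart (Hol Cstar) (Hol Cstar) 0)
    (hθ : θ ∈ dpart (Hol Cstar) (Hol Cstar) 1) :
    (∃ g : Matrix (Fin 2) (Fin 2) (SF Cstar), IsEvenMat par11 g ∧ IsUnit g ∧
      bigCell1 coordW coordPsi = g * bigCell0 z θ) ↔ z = coordZ ∧ θ = coordTheta := by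
  rw [mem_dpart_zero] at hz
  rw [mem_dpart_one] at hθ
  constructor
  · rintro ⟨g, -, -, h⟩
    have e : ∀ i k, bigCell1 coordW coordPsi i k = (g * bigCell0 z θ) i k := fun i k => by rw [h]
    have e00 := e 0 0
    have e02 := e 0 2
    have e01 := e 0 1
    have e03 := e 0 3
    simp [bigCell0, bigCell1, Matrix.mul_apply, Fin.sum_univ_two] at e00 e02 e01 e03
    rw [← e00, ← e02] at e01 e03
    have h1 := congrArg TrivSqZeroExt.fst e01
    have h2 := congrArg TrivSqZeroExt.snd e03
    simp [coordW, coordPsi, SF.fst_mk, SF.snd_mk] at h1 h2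
    have hz1 : z.fst = Hol.coordInv := by
      linear_combination (-Hol.coordInv) * h1 - z.fst * Hol.coordInv_mul_coord
    refine ⟨TrivSqZeroExt.ext hz1 hz, TrivSqZeroExt.ext hθ ?_⟩
    rw [hz1] at h2
    change θ.snd = -Hol.coordInv ^ 2
    linear_combination (-Hol.coordInv) * h2 - θ.snd * Hol.coordInv_mul_coord
  · rintro ⟨rfl, rfl⟩
    have hev : IsEvenMat par11 !![coordW, coordPsi; -coordPsi, coordW] :=
      isEvenMat_par11.2 ⟨⟨mem_dpart_zero.2 rfl, mem_dpart_one.2 rfl⟩,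
        neg_mem (mem_dpart_one.2 rfl), mem_dpart_zero.2 rfl⟩
    refine ⟨_, hev, hev.isUnit_iff.2 ⟨isUnit_coordW, isUnit_coordW⟩, ?_⟩
    have h := Hol.coord_mul_coordInv
    ext i k
    · fin_cases i <;> fin_cases k <;>
        simp [bigCell0, bigCell1, Matrix.mul_apply, Fin.sum_univ_two, coordW, coordPsi, coordZ,
          coordTheta, SF.fst_mk, h]
    · fin_cases i <;> fin_cases k <;>
        simp [bigCell0, bigCell1, Matrix.mul_apply, Fin.sum_univ_two, coordW, coordPsi, coordZ,
          coordTheta, SF.fst_mk, SF.snd_mk] <;>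
        first | linear_combination Hol.coordInv * h | linear_combination (-Hol.coordInv) * h

/-! ### Transition matrices -/

theorem deriv_neg_coordInv_sq : Hol.deriv (-Hol.coordInv ^ 2) = 2 * Hol.coordInv ^ 3 := by
  refine Subtype.ext (funext fun z => ?_)
  have hz : (z : ℂ) ≠ 0 := z.2
  have h : extz (-Hol.coordInv ^ 2 : Hol Cstar).1 =ᶠ[𝓝 (z : ℂ)] fun y => -(y⁻¹) ^ 2 := by
    filter_upwards [Cstar.isOpen.mem_nhds z.2] with y hy
    exact extz_of_mem _ hy
  change _root_.deriv (extz (-Hol.coordInv ^ 2 : Hol Cstar).1) z = 2 * ((z : ℂ)⁻¹) ^ 3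
  have h1 : HasDerivAt (fun y : ℂ => -(y⁻¹) ^ 2) (2 * ((z : ℂ)⁻¹) ^ 3) z := by
    refine (((hasDerivAt_inv hz).fun_pow 2).fun_neg).congr_deriv ?_
    push_cast
    field_simp
  rw [h.deriv_eq, h1.deriv]

open TrivSqZeroExt (inl inr)

/-- The two diagonal entries agree because the factor in `θ = -ψ/w²` is precisely the derivative of
1/w. This coincidence is the source of the Calabi–Yau property. -/
theorem jac_eq : jac = !![inl (-Hol.coordInv ^ 2), 0; inr (2 * Hol.coordInv ^ 3),
    inl (-Hol.coordInv ^ 2)] := by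
  have h0 := deriv_coordInv
  have h1 := deriv_neg_coordInv_sq
  have h2 : Hol.deriv (0 : Hol Cstar) = 0 := deriv_zero_eq
  ext i j
  · fin_cases i <;> fin_cases j <;>
      simp [jac, SF.dEven, SF.dOdd, coordZ, coordTheta, SF.fst_mk, SF.snd_mk, h0, h2]
  · fin_cases i <;> fin_cases j <;>
      simp [jac, SF.dEven, SF.dOdd, coordZ, coordTheta, SF.fst_mk, SF.snd_mk, h1, h2]

theorem matPiCotangent_eq : matPiCotangent = !![inl (-Hol.coordInv ^ 2),
    inr (2 * Hol.coordInv ^ 3); 0, inl (-Hol.coordInv ^ 2)] := by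
  rw [matPiCotangent, matCotangent, jac_eq]
  rfl

/-- Supertransposition moves the odd entry of the inverse Jacobian above the diagonal, without a
sign as it starts below it; the parity transpose moves it back below. -/
theorem matPiTangent_eq : matPiTangent = !![inl (-Hol.coord Cstar ^ 2), 0;
    inr (-(2 * Hol.coord Cstar)), inl (-Hol.coord Cstar ^ 2)] := by
  have h := Hol.coord_mul_coordInv
  have hinv : jac⁻¹ = !![inl (-Hol.coord Cstar ^ 2), 0; inr (-(2 * Hol.coord Cstar)),
      inl (-Hol.coord Cstar ^ 2)] := by
    refine Matrix.inv_eq_right_inv ?_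
    rw [jac_eq]
    have h2 : Hol.coordInv ^ 2 * Hol.coord Cstar ^ 2 = 1 := by
      linear_combination (Hol.coord Cstar * Hol.coordInv + 1) * h
    ext i j
    · fin_cases i <;> fin_cases j <;> simp [Matrix.mul_apply, Fin.sum_univ_two, h2]
    · fin_cases i <;> fin_cases j <;> simp [Matrix.mul_apply, Fin.sum_univ_two]
      linear_combination (-2 * Hol.coordInv * (Hol.coord Cstar * Hol.coordInv)) * h
  rw [matPiTangent, matTangent, matCotangent, hinv]
  ext i j
  · fin_cases i <;> fin_cases j <;> simp [superTranspose, parityTranspose]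
  · fin_cases i <;> fin_cases j <;> simp [superTranspose, parityTranspose]

/-- The odd entry sits in the row of the even frame vector, so raising that vector to the power k +
1 produces the factor k + 1. -/
theorem symPow_matPiCotangent (k : ℕ) : symPow k matPiCotangent =
    !![inl ((-Hol.coordInv ^ 2) ^ (k + 1)),
        inr ((k + 1) * (-Hol.coordInv ^ 2) ^ k * (2 * Hol.coordInv ^ 3));
      0, inl ((-Hol.coordInv ^ 2) ^ (k + 1))] := by
  rw [matPiCotangent_eq]
  ext i j
  · fin_cases i <;> fin_cases j <;> simp [symPow, pow_succ]
  · fin_cases i <;> fin_cases j <;> simp [symPow]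
    ring

/-- Here the odd entry sits in the row of the odd frame vector, which occurs at most once in a
monomial. It therefore appears without a combinatorial factor. -/
theorem symPow_matPiTangent (k : ℕ) : symPow k matPiTangent =
    !![inl ((-Hol.coord Cstar ^ 2) ^ (k + 1)), 0;
      inr ((-Hol.coord Cstar ^ 2) ^ k * -(2 * Hol.coord Cstar)),
      inl ((-Hol.coord Cstar ^ 2) ^ (k + 1))] := by
  rw [matPiTangent_eq]
  ext i j
  · fin_cases i <;> fin_cases j <;> simp [symPow, pow_succ]
  · fin_cases i <;> fin_cases j <;> simp [symPow]
    ring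

/-- For a `1|1` supermatrix over one odd variable the Berezinian is the quotient of the diagonal
entries, and these coincide. -/
theorem berezinian_matPiCotangent : berezinian matPiCotangent = 1 := by
  obtain ⟨-, h11⟩ := isEvenMat_piCotangent.isUnit_iff.1 isUnit_piCotangent
  rw [berezinian_of_even isEvenMat_piCotangent]
  have h : matPiCotangent 0 0 = matPiCotangent 1 1 := by rw [matPiCotangent_eq]; rfl
  rw [h, Ring.mul_inverse_cancel _ h11]

theorem Bundle.twist_eq {a : SF Cstar} (ha : a ∈ dpart (Hol Cstar) (Hol Cstar) 0) (hu : IsUnit a)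
    (h : a = 1) (E : Bundle) : E.twist a ha hu = E := by
  subst h
  obtain ⟨ι, par, g, even, unit⟩ := E
  simp [Bundle.twist]

/-- The twist multiplies the transition matrix by 1, so the two bundles are equal and not merely
isomorphic; integral forms can be rewritten as symmetric powers. -/
theorem berTensor_eq (E : Bundle) : berTensor E = E :=
  Bundle.twist_eq _ _ (by rw [berezinian_matPiCotangent, Ring.inverse_one]) E

end

section

open TrivSqZeroExt (inl inr)

/-! ### The structure sheaf and the Berezinian sheaf -/

/-- An isomorphism which maps homogeneous sections to homogeneous sections of the same parity. -/
def SuperModSheaf.Iso.ofMem {A : SuperAlgSheaf} {F G : SuperModSheaf A}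
    (e : ∀ U, F.obj U ≃ₗ[A.obj U] G.obj U)
    (hres : ∀ {U V : Opens PLine} (h : V ≤ U) (s : F.obj U), e V (F.res h s) = G.res h (e U s))
    (hmem : ∀ U p, ∀ s ∈ F.part p U, e U s ∈ G.part p U) : F.Iso G where
  equiv := e
  equiv_res := hres
  equiv_mem U p s := by
    refine ⟨fun h => ?_, hmem U p s⟩
    obtain ⟨a, ha, b, hb, rfl⟩ := exists_part_add s p
    -- The image of the component b of the other parity lies in both homogeneous parts, so it is
    -- zero.
    have h1 : e U b = e U (a + b) - e U a := by rw [map_add, add_sub_cancel_left]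
    have h2 : e U b = 0 := part_inf_eq_zero (p := p)
      (by rw [h1]; exact sub_mem h (hmem U p a ha)) (hmem U (p + 1) b hb)
    rw [(e U).map_eq_zero_iff.1 h2, add_zero]
    exact ha

theorem OPi.fst_mem {V : Opens PLine} (f : OPi V) :
    ((f.1.1.fst, f.1.2.fst) : Hol (ch0 V) × Hol (ch1 V)) ∈ opSubalgebra V :=
  mem_opSubalgebra_iff.2 (mem_OnPair_iff.2 fun w hw => by
    rw [zpow_zero, one_mul]; exact (mem_oPiSubalgebra_iff.1 f.2 w hw).1)

/-- The odd coefficient transforms with `-w⁻²`; changing its sign in the chart `U₁` turns this into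
the transition function of O(-2). -/
theorem OPi.snd_mem {V : Opens PLine} (f : OPi V) :
    ((f.1.1.snd, -f.1.2.snd) : Hol (ch0 V) × Hol (ch1 V)) ∈ OnPair (-2) V :=
  mem_OnPair_iff.2 fun w hw => by
    have h := (mem_oPiSubalgebra_iff.1 f.2 w hw).2
    have h1 : w ∈ ch1 V := hw.2
    rw [extz_eq_eval _ h1, map_neg, ← extz_eq_eval _ h1, h, zpow_neg, zpow_ofNat, inv_pow]
    ring

/-- The superfunction `f + g θ` given by a function `f` and a section `g` of `O(-2)`. -/
def OPi.ofParts {V : Opens PLine} (f : OP V) (g : On (-2) V) : OPi V :=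
  ⟨(SF.mk f.1.1 g.1.1, SF.mk f.1.2 (-g.1.2)), mem_oPiSubalgebra_iff.2 fun w hw => by
    have hf := mem_OnPair_iff.1 (mem_opSubalgebra_iff.1 f.2) w hw
    have hg := mem_OnPair_iff.1 g.2 w hw
    have h1 : w ∈ ch1 V := hw.2
    rw [zpow_zero, one_mul] at hf
    refine ⟨hf, ?_⟩
    rw [SF.snd_mk, SF.snd_mk, extz_eq_eval _ h1, map_neg, ← extz_eq_eval _ h1, hg, zpow_neg,
      zpow_ofNat, inv_pow]
    ring⟩

/-- The `Π`-projective line is the split supermanifold determined by `(ℙ¹, O(-2))`. -/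
def isoSplit : sheafOPi.Iso (sheafSplit (-2)) where
  equiv V :=
    { toFun := fun f => ((⟨_, OPi.fst_mem f⟩, ⟨_, OPi.snd_mem f⟩) : OP V × On (-2) V)
      invFun := fun f => OPi.ofParts (TrivSqZeroExt.fst f) (TrivSqZeroExt.snd f)
      left_inv := fun f => Subtype.ext (Prod.ext rfl (TrivSqZeroExt.ext rfl (neg_neg _)))
      right_inv := fun f => Prod.ext rfl (Subtype.ext (Prod.ext rfl (neg_neg _)))
      map_mul' := fun f g => by
        refine TrivSqZeroExt.ext rfl (Subtype.ext (Prod.ext ?_ ?_))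
        · change f.1.1.fst * g.1.1.snd + f.1.1.snd * g.1.1.fst =
            f.1.1.fst * g.1.1.snd + g.1.1.fst * f.1.1.snd
          ring
        · change -(f.1.2.fst * g.1.2.snd + f.1.2.snd * g.1.2.fst) =
            f.1.2.fst * -g.1.2.snd + g.1.2.fst * -f.1.2.snd
          ring
      map_add' := fun f g => by
        refine TrivSqZeroExt.ext rfl (Subtype.ext (Prod.ext rfl ?_))
        exact neg_add _ _
      commutes' := fun c => TrivSqZeroExt.ext rfl (Subtype.ext (Prod.ext rfl neg_zero)) }
  equiv_res {U V} h f := by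
    refine TrivSqZeroExt.ext ?_ ?_
    · refine Eq.trans ?_ (fst_splitRes h _).symm
      exact Subtype.ext (Prod.ext (SF.fst_res _ _) (SF.fst_res _ _))
    · refine Eq.trans ?_ (snd_splitRes h _).symm
      refine Subtype.ext (Prod.ext (SF.snd_res _ _) ?_)
      exact (congrArg Neg.neg (SF.snd_res _ _)).trans (map_neg (Hol.res (ch1_mono h)) _).symm
  equiv_mem V p f := by
    rcases zmod2_cases p with rfl | rfl
    · refine Iff.trans mem_dpart_zero (Iff.trans ?_
        (and_congr mem_dpart_zero mem_dpart_zero).symm)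
      exact Subtype.ext_iff.trans (Prod.ext_iff.trans (and_congr Iff.rfl neg_eq_zero))
    · refine Iff.trans mem_dpart_one (Iff.trans ?_
        (and_congr mem_dpart_one mem_dpart_one).symm)
      exact Subtype.ext_iff.trans Prod.ext_iff

theorem mem_evenPart_zero {M : Type} [AddCommGroup M] [Module ℂ M] (s : M) :
    s ∈ evenPart M 0 := by rw [evenPart_zero]; trivial

theorem mem_evenPart_of_eq_zero {M : Type} [AddCommGroup M] [Module ℂ M] {s : M} (h : s = 0)
    (p : ZMod 2) : s ∈ evenPart M p := by rw [h]; exact zero_mem _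

/-- The structure sheaf of the `Π`-projective line as a sheaf of modules on the projective line. -/
def isoTriv : (sheafTriv.restrictScalars projHom).Iso ((sheafO 0).sum (sheafO (-2)).parity) :=
  SuperModSheaf.Iso.ofMem
    (fun V =>
      { toFun := fun f : OPi V => ((⟨_, mem_opSubalgebra_iff.1 (OPi.fst_mem f)⟩,
          ⟨_, OPi.snd_mem f⟩) : On 0 V × On (-2) V)
        map_add' := fun f g => Prod.ext rfl (Subtype.ext (Prod.ext rfl (neg_add _ _)))
        map_smul' := fun (a : OP V) (f : OPi V) => by
          refine Prod.ext rfl (Subtype.ext (Prod.ext ?_ ?_))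
          · change (inl a.1.1 * f.1.1 : SF (ch0 V)).snd = a.1.1 * f.1.1.snd
            simp
          · change -(inl a.1.2 * f.1.2 : SF (ch1 V)).snd = a.1.2 * -f.1.2.snd
            simp
        invFun := fun f : On 0 V × On (-2) V =>
          OPi.ofParts ⟨f.1.1, mem_opSubalgebra_iff.2 f.1.2⟩ f.2
        left_inv := fun f => Subtype.ext (Prod.ext rfl (TrivSqZeroExt.ext rfl (neg_neg _)))
        right_inv := fun f => Prod.ext rfl (Subtype.ext (Prod.ext rfl (neg_neg _))) })
    (fun {U V} h f => by
      refine Prod.ext ?_ ?_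
      · exact Subtype.ext (Prod.ext (SF.fst_res _ _) (SF.fst_res _ _))
      · refine Subtype.ext (Prod.ext (SF.snd_res _ _) ?_)
        exact (congrArg Neg.neg (SF.snd_res _ _)).trans (map_neg (Hol.res (ch1_mono h)) _).symm)
    (fun V p f hf => by
      rcases zmod2_cases p with rfl | rfl
      · refine ⟨mem_evenPart_zero (M := On 0 V) _,
          mem_evenPart_of_eq_zero (M := On (-2) V) (Subtype.ext (Prod.ext ?_ ?_)) _⟩
        · exact mem_dpart_zero.1 hf.1
        · exact neg_eq_zero.2 (mem_dpart_zero.1 hf.2)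
      · have h0 : f.1.1.fst = 0 := mem_dpart_one.1 hf.1
        have h1 : f.1.2.fst = 0 := mem_dpart_one.1 hf.2
        exact ⟨mem_evenPart_of_eq_zero (M := On 0 V) (Subtype.ext (Prod.ext h0 h1)) _,
          mem_evenPart_zero (M := On (-2) V) _⟩)

theorem mem_trivial_iff {V : Opens PLine} {s : Bundle.trivial.Coef V} :
    s ∈ Bundle.trivial.secSubmodule V ↔ s () ∈ oPiSubalgebra V := by
  have h : ∀ j, ∑ i, SF.ov0 V (s i).1 * SF.ovC V (Bundle.trivial.g i j) = SF.ov0 V (s ()).1 := by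
    intro j
    have h1 : Bundle.trivial.g () j = 1 := Matrix.one_apply_eq _
    refine (Fintype.sum_unique (ι := Unit) _).trans ?_
    change SF.ov0 V (s ()).1 * SF.ovC V (Bundle.trivial.g () j) = _
    rw [h1, map_one, mul_one]
  rw [mem_oPiSubalgebra]
  constructor
  · intro hs; rw [← h ()]; exact hs ()
  · intro hs j; rw [h j]; exact hs

/-- The structure sheaf, as a bundle and as a sheaf of modules over itself. -/
def isoTrivial : Bundle.trivial.sheaf.Iso sheafTriv :=
  SuperModSheaf.Iso.ofMem
    (fun V =>
      { toFun := fun s : Bundle.trivial.Sec V => (⟨s.1 (), mem_trivial_iff.1 s.2⟩ : OPi V)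
        map_add' := fun _ _ => rfl
        map_smul' := fun _ _ => rfl
        invFun := fun f : OPi V => ⟨fun _ => f.1, mem_trivial_iff.2 f.2⟩
        left_inv := fun _ => rfl
        right_inv := fun _ => rfl })
    (fun _ _ => rfl)
    (fun V p s hs => by
      have h := hs ()
      rwa [show Bundle.trivial.par () = 0 from rfl, add_zero] at h)

theorem sheafBer_eq : sheafBer = Bundle.trivial.sheaf := by rw [sheafBer, berTensor_eq]

theorem nonempty_isoBer : Nonempty (sheafBer.Iso sheafTriv) := by
  rw [sheafBer_eq]; exact ⟨isoTrivial⟩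

theorem sheafIntegral_eq (k : ℕ) : sheafIntegral k = sheafSymPiTangent k := by
  rw [sheafIntegral, berTensor_eq]; rfl

end

section

open TrivSqZeroExt (inl inr)

/-! ### Locally free sheaves of rank `1|1` with triangular transition matrix -/

/-- The bundle of rank `1|1` with the given transition matrix. -/
def rankTwo (g : Matrix (Fin 2) (Fin 2) (SF Cstar)) (he : IsEvenMat par11 g) (hu : IsUnit g) :
    Bundle where
  ι := Fin 2
  par := par11
  g := g
  even := he
  unit := hu

/-- A transition matrix with diagonal entries `ε wᵐ` and with off-diagonal entries `0` and
`- ε c wᵐ⁻¹ ψ`, the latter in position `(i, j)`. -/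
structure IsTriangular (g : Matrix (Fin 2) (Fin 2) (SF Cstar)) (i j : Fin 2) (ε c : ℂ) (m : ℤ) :
    Prop where
  ne : i ≠ j
  sq : ε * ε = 1
  ne_zero : c ≠ 0
  diag : ∀ w ∈ Cstar, extz (g i i).fst.1 w = ε * w ^ m
  diag' : g j j = g i i
  snd_diag : (g i i).snd = 0
  lower : g j i = 0
  fst_upper : (g i j).fst = 0
  snd_upper : ∀ w ∈ Cstar, extz (g i j).snd.1 w = -(ε * c * w ^ (m - 1))

theorem eval_fst_column {V : Opens PLine} {x y : SF (ch0 V)} {a b : SF Cstar} (w : ov V) :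
    Hol.eval w (SF.ov0 V x * SF.ovC V a + SF.ov0 V y * SF.ovC V b).fst =
      extz x.fst.1 (w : ℂ)⁻¹ * extz a.fst.1 w + extz y.fst.1 (w : ℂ)⁻¹ * extz b.fst.1 w := by
  have h : ∀ a, (SF.ovC V a).fst = Hol.ovC V a.fst := fun a => SF.fst_res _ _
  simp only [TrivSqZeroExt.fst_add, TrivSqZeroExt.fst_mul, map_add, map_mul, SF.ov0, SF.fst_pull, h]
  rw [Hol.eval_ov0, Hol.eval_ov0, Hol.eval_ovC, Hol.eval_ovC]

theorem eval_snd_column {V : Opens PLine} {x y : SF (ch0 V)} {a b : SF Cstar} (w : ov V) :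
    Hol.eval w (SF.ov0 V x * SF.ovC V a + SF.ov0 V y * SF.ovC V b).snd =
      (extz x.fst.1 (w : ℂ)⁻¹ * extz a.snd.1 w +
        extz x.snd.1 (w : ℂ)⁻¹ * -((w : ℂ)⁻¹) ^ 2 * extz a.fst.1 w) +
      (extz y.fst.1 (w : ℂ)⁻¹ * extz b.snd.1 w +
        extz y.snd.1 (w : ℂ)⁻¹ * -((w : ℂ)⁻¹) ^ 2 * extz b.fst.1 w) := by
  have h : ∀ a, (SF.ovC V a).fst = Hol.ovC V a.fst := fun a => SF.fst_res _ _
  have h' : ∀ a, (SF.ovC V a).snd = Hol.ovC V a.snd := fun a => SF.snd_res _ _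
  simp only [TrivSqZeroExt.snd_add, TrivSqZeroExt.snd_mul, map_add, map_mul, SF.ov0, SF.fst_pull,
    SF.snd_pull, h, h', smul_eq_mul, MulOpposite.smul_eq_mul_unop, MulOpposite.unop_op]
  simp only [Hol.eval_ov0, Hol.eval_ovC, extz_coordTheta w.2.1]

theorem extz_zero {S : Opens ℂ} (z : ℂ) : extz (0 : Hol S).1 z = 0 := by
  by_cases h : z ∈ S
  · exact extz_of_mem _ h
  · exact dif_neg h

theorem zpow_mul_inv_sq {w : ℂ} (hw : w ≠ 0) (m : ℤ) : w ^ m * w⁻¹ ^ 2 = w ^ (m - 2) := by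
  rw [zpow_sub₀ hw, zpow_ofNat, inv_pow, div_eq_mul_inv]

section Triangular

variable {g : Matrix (Fin 2) (Fin 2) (SF Cstar)} {he : IsEvenMat par11 g} {hu : IsUnit g}
  {i j : Fin 2} {ε c : ℂ} {m : ℤ}

/-- Each coefficient is expanded in the odd variable. The even coefficient at `j` and the odd one at
`i` transform on their own, like O(m) and, up to sign, O(m-2). The even coefficient at `i` and the
odd one at `j` are coupled by a nonzero multiple of `wᵐ⁻¹`: they form an extension of O(m) by
O(m-2). -/
theorem IsTriangular.glue_iff (h : IsTriangular g i j ε c m) {V : Opens PLine}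
    {s : Fin 2 → SF (ch0 V) × SF (ch1 V)} :
    (∀ l, SF.ov1 V (s l).2 = ∑ k, SF.ov0 V (s k).1 * SF.ovC V (g k l)) ↔ ∀ w ∈ ov V,
      (extz (s i).2.fst.1 w = ε * w ^ m * extz (s i).1.fst.1 w⁻¹ ∧
      extz (s i).2.snd.1 w = -(ε * w ^ (m - 2) * extz (s i).1.snd.1 w⁻¹)) ∧
      (extz (s j).2.fst.1 w = ε * w ^ m * extz (s j).1.fst.1 w⁻¹ ∧
      extz (s j).2.snd.1 w = -(ε * w ^ (m - 2) * extz (s j).1.snd.1 w⁻¹) -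
        ε * c * w ^ (m - 1) * extz (s i).1.fst.1 w⁻¹) := by
  -- The indices `i`, `j` are 0 and 1 in one of the two orders; this treats the upper and lower
  -- triangular cases at once.
  have hsum : ∀ f : Fin 2 → SF (ov V), ∑ l, f l = f i + f j := fun f => by
    have hne := h.ne
    revert hne
    fin_cases i <;> fin_cases j <;> simp [Fin.sum_univ_two, add_comm]
  have hall : ∀ P : Fin 2 → Prop, (∀ l, P l) ↔ P i ∧ P j := fun P => by
    have hne := h.ne
    revert hne
    fin_cases i <;> fin_cases j <;> simp [Fin.forall_fin_two, and_comm]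
  have hcol : ∀ l, (SF.ov1 V (s l).2 = ∑ k, SF.ov0 V (s k).1 * SF.ovC V (g k l)) ↔
      ∀ w ∈ ov V, extz (s l).2.fst.1 w =
        extz (s i).1.fst.1 w⁻¹ * extz (g i l).fst.1 w +
          extz (s j).1.fst.1 w⁻¹ * extz (g j l).fst.1 w ∧
        extz (s l).2.snd.1 w =
          (extz (s i).1.fst.1 w⁻¹ * extz (g i l).snd.1 w +
            extz (s i).1.snd.1 w⁻¹ * -(w⁻¹) ^ 2 * extz (g i l).fst.1 w) +
          (extz (s j).1.fst.1 w⁻¹ * extz (g j l).snd.1 w +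
            extz (s j).1.snd.1 w⁻¹ * -(w⁻¹) ^ 2 * extz (g j l).fst.1 w) := by
    intro l
    rw [hsum]
    have e0 : ∀ w : ov V, Hol.eval w (SF.ov1 V (s l).2).fst = extz (s l).2.fst.1 w := fun w => by
      rw [← Hol.eval_ov1]; exact congrArg _ (SF.fst_res _ _)
    have e1 : ∀ w : ov V, Hol.eval w (SF.ov1 V (s l).2).snd = extz (s l).2.snd.1 w := fun w => by
      rw [← Hol.eval_ov1]; exact congrArg _ (SF.snd_res _ _)
    constructor
    · intro hs w hw
      rw [← e0 ⟨w, hw⟩, ← e1 ⟨w, hw⟩, hs, eval_fst_column, eval_snd_column]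
      exact ⟨rfl, rfl⟩
    · intro hs
      refine TrivSqZeroExt.ext (Hol.ext_eval fun w => ?_) (Hol.ext_eval fun w => ?_)
      · rw [e0, eval_fst_column]; exact (hs w w.2).1
      · rw [e1, eval_snd_column]; exact (hs w w.2).2
  refine (hall fun l => SF.ov1 V (s l).2 = ∑ k, SF.ov0 V (s k).1 * SF.ovC V (g k l)).trans ?_
  rw [hcol, hcol, ← forall₂_and]
  refine forall₂_congr fun w hw => ?_
  rw [h.diag', h.snd_diag, h.lower, h.fst_upper, h.diag w hw.1, h.snd_upper w hw.1,
    TrivSqZeroExt.fst_zero, TrivSqZeroExt.snd_zero]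
  simp only [extz_zero, mul_zero, add_zero, zero_add, ← zpow_mul_inv_sq hw.1]
  refine and_congr (and_congr ?_ ?_) (and_congr ?_ ?_) <;> refine Eq.congr_right ?_ <;> ring

theorem IsTriangular.mem_sec_iff (h : IsTriangular g i j ε c m) {V : Opens PLine}
    {s : Fin 2 → SF (ch0 V) × SF (ch1 V)} :
    s ∈ (rankTwo g he hu).secSubmodule V ↔ ∀ w ∈ ov V,
      (extz (s i).2.fst.1 w = ε * w ^ m * extz (s i).1.fst.1 w⁻¹ ∧
      extz (s i).2.snd.1 w = -(ε * w ^ (m - 2) * extz (s i).1.snd.1 w⁻¹)) ∧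
      (extz (s j).2.fst.1 w = ε * w ^ m * extz (s j).1.fst.1 w⁻¹ ∧
      extz (s j).2.snd.1 w = -(ε * w ^ (m - 2) * extz (s j).1.snd.1 w⁻¹) -
        ε * c * w ^ (m - 1) * extz (s i).1.fst.1 w⁻¹) := h.glue_iff

/-- A constant function. -/
abbrev Hol.const {S : Opens ℂ} (a : ℂ) : Hol S := algebraMap ℂ (Hol S) a

theorem Hol.extz_const {S : Opens ℂ} (a : ℂ) {w : ℂ} (hw : w ∈ S) :
    extz (Hol.const a : Hol S).1 w = a := by
  rw [extz_eq_eval _ hw]; exact (Hol.eval ⟨w, hw⟩).commutes a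

theorem Hol.extz_mul {S : Opens ℂ} (f g : Hol S) (z : ℂ) :
    extz (f * g).1 z = extz f.1 z * extz g.1 z := by
  by_cases h : z ∈ S
  · rw [extz_eq_eval _ h, map_mul, ← extz_eq_eval, ← extz_eq_eval]
  · simp [extz, h]

theorem Hol.extz_sub {S : Opens ℂ} (f g : Hol S) (z : ℂ) :
    extz (f - g).1 z = extz f.1 z - extz g.1 z := by
  by_cases h : z ∈ S
  · rw [extz_eq_eval _ h, map_sub, ← extz_eq_eval, ← extz_eq_eval]
  · simp [extz, h]

theorem Hol.extz_add {S : Opens ℂ} (f g : Hol S) (z : ℂ) :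
    extz (f + g).1 z = extz f.1 z + extz g.1 z := by
  by_cases h : z ∈ S
  · rw [extz_eq_eval _ h, map_add, ← extz_eq_eval, ← extz_eq_eval]
  · simp [extz, h]

theorem Hol.extz_neg {S : Opens ℂ} (f : Hol S) (z : ℂ) : extz (-f).1 z = -extz f.1 z := by
  by_cases h : z ∈ S
  · rw [extz_eq_eval _ h, map_neg, ← extz_eq_eval]
  · simp [extz, h]

theorem Hol.extz_coord {S : Opens ℂ} {w : ℂ} (hw : w ∈ S) : extz (Hol.coord S).1 w = w :=
  extz_of_mem _ hw

theorem zpow_eq_mul {w : ℂ} (hw : w ≠ 0) (m : ℤ) : w ^ m = w ^ (m - 1) * w := by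
  rw [← zpow_add_one₀ hw, sub_add_cancel]

theorem zpow_eq_mul' {w : ℂ} (hw : w ≠ 0) (m : ℤ) : w ^ (m - 1) = w ^ (m - 2) * w := by
  rw [← zpow_add_one₀ hw]; congr 1; ring

variable {V : Opens PLine}

/-- The four line bundles which make up a bundle with triangular transition matrix. -/
abbrev OnQuad (m : ℤ) (V : Opens PLine) : Type :=
  (On (m - 1) V × On (m - 1) V) × (On m V × On (m - 2) V)

/-- The components of a section. -/
def IsTriangular.split (h : IsTriangular g i j ε c m)
    (s : Fin 2 → SF (ch0 V) × SF (ch1 V)) (hs : s ∈ (rankTwo g he hu).secSubmodule V) :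
    OnQuad m V :=
  -- Write f for the even coefficient at `i` and h for the odd one at `j`. In the chart `U₀` the two
  -- sections of O(m-1) are h and `z h + c f`. In the chart `U₁` the corresponding expressions are
  -- `-ε (w h' + c f')` and `-ε h'`, because the coupling term in h' is cancelled, respectively
  -- completed, by the right power of w.
  ((⟨((s j).1.snd, Hol.coord _ * -(Hol.const ε * (s j).2.snd) -
      Hol.const c * (Hol.const ε * (s i).2.fst)), mem_OnPair_iff.2 fun w hw => by
      obtain ⟨⟨h1, -⟩, -, h2⟩ := h.mem_sec_iff.1 hs w hw
      have hw1 : w ∈ ch1 V := hw.2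
      simp only [Hol.extz_sub, Hol.extz_mul, Hol.extz_neg, Hol.extz_const _ hw1, Hol.extz_coord hw1, h1, h2]
      rw [zpow_eq_mul hw.1 m, zpow_eq_mul' hw.1 m]
      linear_combination (w ^ (m - 2) * w * extz (s j).1.snd.1 w⁻¹) * h.sq⟩,
    ⟨(Hol.coord _ * (s j).1.snd + Hol.const c * (s i).1.fst, -(Hol.const ε * (s j).2.snd)),
      mem_OnPair_iff.2 fun w hw => by
      obtain ⟨⟨h1, -⟩, -, h2⟩ := h.mem_sec_iff.1 hs w hw
      have hw1 : w ∈ ch1 V := hw.2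
      have hw0 := inv_mem_ch0 w hw
      have hw2 : w * w⁻¹ = 1 := mul_inv_cancel₀ hw.1
      simp only [Hol.extz_add, Hol.extz_mul, Hol.extz_neg, Hol.extz_const _ hw1, Hol.extz_const _ hw0,
        Hol.extz_coord hw0, h2]
      rw [zpow_eq_mul' hw.1 m]
      linear_combination (w ^ (m - 2) * extz (s j).1.snd.1 w⁻¹ +
        c * (w ^ (m - 2) * w) * extz (s i).1.fst.1 w⁻¹) * h.sq -
        w ^ (m - 2) * extz (s j).1.snd.1 w⁻¹ * hw2⟩),
   (⟨((s j).1.fst, Hol.const ε * (s j).2.fst), mem_OnPair_iff.2 fun w hw => by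
      obtain ⟨-, h1, -⟩ := h.mem_sec_iff.1 hs w hw
      have hw1 : w ∈ ch1 V := hw.2
      simp only [Hol.extz_mul, Hol.extz_const _ hw1, h1]
      linear_combination w ^ m * extz (s j).1.fst.1 w⁻¹ * h.sq⟩,
    ⟨((s i).1.snd, -(Hol.const ε * (s i).2.snd)), mem_OnPair_iff.2 fun w hw => by
      obtain ⟨⟨-, h1⟩, -⟩ := h.mem_sec_iff.1 hs w hw
      have hw1 : w ∈ ch1 V := hw.2
      simp only [Hol.extz_neg, Hol.extz_mul, Hol.extz_const _ hw1, h1]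
      linear_combination w ^ (m - 2) * extz (s i).1.snd.1 w⁻¹ * h.sq⟩))

/-- The coefficients of the section with the given components, in the frame vector `i`. -/
def splitInv0 (ε c : ℂ) (t : OnQuad m V) : SF (ch0 V) × SF (ch1 V) :=
  -- The even entry is f, solved from the components h and `z h + c f`; this is where the extension
  -- class has to be nonzero. In the second chart the same elimination uses `ε² = 1`.
  (SF.mk (Hol.const c⁻¹ * (t.1.2.1.1 - Hol.coord _ * t.1.1.1.1)) t.2.2.1.1,
    SF.mk (Hol.const ε * (Hol.const c⁻¹ * (Hol.coord _ * t.1.2.1.2 - t.1.1.1.2)))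
      (-(Hol.const ε * t.2.2.1.2)))

/-- The coefficients of the section with the given components, in the frame vector `j`. -/
def splitInv1 (ε : ℂ) (t : OnQuad m V) : SF (ch0 V) × SF (ch1 V) :=
  (SF.mk t.2.1.1.1 t.1.1.1.1,
    SF.mk (Hol.const ε * t.2.1.1.2) (-(Hol.const ε * t.1.2.1.2)))

/-- The section with the given components. -/
def splitInv (i : Fin 2) (ε c : ℂ) (t : OnQuad m V) : Fin 2 → SF (ch0 V) × SF (ch1 V) :=
  fun k => if k = i then splitInv0 ε c t else splitInv1 ε t

theorem splitInv_self (t : OnQuad m V) : splitInv i ε c t i = splitInv0 ε c t := if_pos rfl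

theorem splitInv_of_ne (hij : i ≠ j) (t : OnQuad m V) : splitInv i ε c t j = splitInv1 ε t :=
  if_neg hij.symm

theorem IsTriangular.splitInv_mem (h : IsTriangular g i j ε c m) (t : OnQuad m V) :
    splitInv i ε c t ∈ (rankTwo g he hu).secSubmodule V := by
  refine h.mem_sec_iff.2 fun w hw => ?_
  rw [splitInv_self, splitInv_of_ne h.ne]
  have hw1 : w ∈ ch1 V := hw.2
  have hw0 := inv_mem_ch0 w hw
  have hw2 : w * w⁻¹ = 1 := mul_inv_cancel₀ hw.1
  have hc : c * c⁻¹ = 1 := mul_inv_cancel₀ h.ne_zero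
  have h1 := mem_OnPair_iff.1 t.1.1.2 w hw
  have h2 := mem_OnPair_iff.1 t.1.2.2 w hw
  have h3 := mem_OnPair_iff.1 t.2.1.2 w hw
  have h4 := mem_OnPair_iff.1 t.2.2.2 w hw
  simp only [splitInv0, splitInv1, SF.fst_mk, SF.snd_mk, Hol.extz_sub, Hol.extz_mul, Hol.extz_neg,
    Hol.extz_const _ hw1, Hol.extz_const _ hw0, Hol.extz_coord hw1, Hol.extz_coord hw0, h1, h2, h3,
    h4]
  rw [zpow_eq_mul hw.1 m, zpow_eq_mul' hw.1 m]
  refine ⟨⟨?_, ?_⟩, ?_, ?_⟩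
  · linear_combination ε * c⁻¹ * (w ^ (m - 2) * w) * extz t.1.1.1.1.1 w⁻¹ * hw2
  · ring
  · ring
  · linear_combination ε * (w ^ (m - 2) * w) *
      (extz t.1.2.1.1.1 w⁻¹ - w⁻¹ * extz t.1.1.1.1.1 w⁻¹) * hc -
      ε * w ^ (m - 2) * extz t.1.1.1.1.1 w⁻¹ * hw2

end Triangular

end

/-! ### The splitting into line bundles as an isomorphism of graded sheaves. -/

section

open TrivSqZeroExt (inl inr)

section Triangular

variable {g : Matrix (Fin 2) (Fin 2) (SF Cstar)} {he : IsEvenMat par11 g} {hu : IsUnit g}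
  {i j : Fin 2} {ε c : ℂ} {m : ℤ} {V : Opens PLine}

theorem Hol.const_mul_const {S : Opens ℂ} {a b : ℂ} (h : a * b = 1) :
    (Hol.const a * Hol.const b : Hol S) = 1 := by
  rw [← map_mul, h, map_one]

theorem IsTriangular.splitInv_split (h : IsTriangular g i j ε c m)
    {s : Fin 2 → SF (ch0 V) × SF (ch1 V)} (hs : s ∈ (rankTwo g he hu).secSubmodule V) :
    splitInv i ε c (h.split s hs) = s := by
  have h0 : (Hol.const c * Hol.const c⁻¹ : Hol (ch0 V)) = 1 :=
    Hol.const_mul_const (mul_inv_cancel₀ h.ne_zero)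
  have h1 : (Hol.const c * Hol.const c⁻¹ : Hol (ch1 V)) = 1 :=
    Hol.const_mul_const (mul_inv_cancel₀ h.ne_zero)
  have hε : (Hol.const ε * Hol.const ε : Hol (ch1 V)) = 1 := Hol.const_mul_const h.sq
  have hi : splitInv0 ε c (h.split s hs) = s i := by
    refine Prod.ext (TrivSqZeroExt.ext ?_ rfl) (TrivSqZeroExt.ext ?_ ?_)
    · change Hol.const c⁻¹ * ((Hol.coord _ * (s j).1.snd + Hol.const c * (s i).1.fst) -
        Hol.coord _ * (s j).1.snd) = (s i).1.fst
      linear_combination (s i).1.fst * h0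
    · change Hol.const ε * (Hol.const c⁻¹ * (Hol.coord _ * -(Hol.const ε * (s j).2.snd) -
        (Hol.coord _ * -(Hol.const ε * (s j).2.snd) -
          Hol.const c * (Hol.const ε * (s i).2.fst)))) = (s i).2.fst
      linear_combination Hol.const ε * Hol.const ε * (s i).2.fst * h1 + (s i).2.fst * hε
    · change -(Hol.const ε * -(Hol.const ε * (s i).2.snd)) = (s i).2.snd
      linear_combination (s i).2.snd * hε
  have hj : splitInv1 ε (h.split s hs) = s j := by
    refine Prod.ext rfl (TrivSqZeroExt.ext ?_ ?_)
    · change Hol.const ε * (Hol.const ε * (s j).2.fst) = (s j).2.fst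
      linear_combination (s j).2.fst * hε
    · change -(Hol.const ε * -(Hol.const ε * (s j).2.snd)) = (s j).2.snd
      linear_combination (s j).2.snd * hε
  funext k
  by_cases hk : k = i
  · rw [hk, splitInv_self, hi]
  · have hk' : k = j := by
      have := h.ne
      omega
    rw [hk', splitInv_of_ne h.ne, hj]

theorem IsTriangular.split_splitInv (h : IsTriangular g i j ε c m) (t : OnQuad m V) :
    h.split (splitInv i ε c t) (h.splitInv_mem (he := he) (hu := hu) t) = t := by
  have h0 : (Hol.const c * Hol.const c⁻¹ : Hol (ch0 V)) = 1 :=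
    Hol.const_mul_const (mul_inv_cancel₀ h.ne_zero)
  have h1 : (Hol.const c * Hol.const c⁻¹ : Hol (ch1 V)) = 1 :=
    Hol.const_mul_const (mul_inv_cancel₀ h.ne_zero)
  have hε : (Hol.const ε * Hol.const ε : Hol (ch1 V)) = 1 := Hol.const_mul_const h.sq
  have hi := splitInv_self (i := i) (ε := ε) (c := c) t
  have hj := splitInv_of_ne (ε := ε) (c := c) h.ne t
  refine Prod.ext (Prod.ext (Subtype.ext (Prod.ext ?_ ?_)) (Subtype.ext (Prod.ext ?_ ?_)))
    (Prod.ext (Subtype.ext (Prod.ext ?_ ?_)) (Subtype.ext (Prod.ext ?_ ?_))) <;>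
    simp only [split, hi, hj, splitInv0, splitInv1, SF.fst_mk, SF.snd_mk]
  · linear_combination Hol.coord (ch1 V) * t.1.2.1.2 * hε -
      Hol.const ε * Hol.const ε * (Hol.coord (ch1 V) * t.1.2.1.2 - t.1.1.1.2) * h1 -
      (Hol.coord (ch1 V) * t.1.2.1.2 - t.1.1.1.2) * hε
  · linear_combination (t.1.2.1.1 - Hol.coord (ch0 V) * t.1.1.1.1) * h0
  · linear_combination t.1.2.1.2 * hε
  · linear_combination t.2.1.1.2 * hε
  · linear_combination t.2.2.1.2 * hε

/-- The sections of a bundle with triangular transition matrix. -/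
def IsTriangular.equiv (h : IsTriangular g i j ε c m) (V : Opens PLine) :
    ((rankTwo g he hu).sheaf.restrictScalars projHom).obj V ≃ₗ[sheafOP.obj V]
      (((sheafO (m - 1)).sum (sheafO (m - 1))).sum ((sheafO m).sum (sheafO (m - 2)))).obj V where
  toFun := fun s : (rankTwo g he hu).Sec V => h.split s.1 s.2
  map_add' := fun (s t : (rankTwo g he hu).Sec V) => by
    refine Prod.ext (Prod.ext (Subtype.ext (Prod.ext rfl ?_)) (Subtype.ext (Prod.ext ?_ ?_)))
      (Prod.ext (Subtype.ext (Prod.ext rfl ?_)) (Subtype.ext (Prod.ext rfl ?_)))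
    · change Hol.coord _ * -(Hol.const ε * ((s.1 j).2.snd + (t.1 j).2.snd)) -
        Hol.const c * (Hol.const ε * ((s.1 i).2.fst + (t.1 i).2.fst)) =
        (Hol.coord _ * -(Hol.const ε * (s.1 j).2.snd) -
          Hol.const c * (Hol.const ε * (s.1 i).2.fst)) +
        (Hol.coord _ * -(Hol.const ε * (t.1 j).2.snd) -
          Hol.const c * (Hol.const ε * (t.1 i).2.fst))
      ring
    · change Hol.coord _ * ((s.1 j).1.snd + (t.1 j).1.snd) +
        Hol.const c * ((s.1 i).1.fst + (t.1 i).1.fst) =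
        (Hol.coord _ * (s.1 j).1.snd + Hol.const c * (s.1 i).1.fst) +
        (Hol.coord _ * (t.1 j).1.snd + Hol.const c * (t.1 i).1.fst)
      ring
    · change -(Hol.const ε * ((s.1 j).2.snd + (t.1 j).2.snd)) =
        -(Hol.const ε * (s.1 j).2.snd) + -(Hol.const ε * (t.1 j).2.snd)
      ring
    · change Hol.const ε * ((s.1 j).2.fst + (t.1 j).2.fst) =
        Hol.const ε * (s.1 j).2.fst + Hol.const ε * (t.1 j).2.fst
      ring
    · change -(Hol.const ε * ((s.1 i).2.snd + (t.1 i).2.snd)) =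
        -(Hol.const ε * (s.1 i).2.snd) + -(Hol.const ε * (t.1 i).2.snd)
      ring
  map_smul' := fun (a : OP V) (s : (rankTwo g he hu).Sec V) => by
    have f0 : ∀ (a : Hol (ch0 V)) (x : SF (ch0 V)), (inl a * x).fst = a * x.fst := fun a x => by
      simp
    have s0 : ∀ (a : Hol (ch0 V)) (x : SF (ch0 V)), (inl a * x).snd = a * x.snd := fun a x => by
      simp
    have f1 : ∀ (a : Hol (ch1 V)) (x : SF (ch1 V)), (inl a * x).fst = a * x.fst := fun a x => by
      simp
    have s1 : ∀ (a : Hol (ch1 V)) (x : SF (ch1 V)), (inl a * x).snd = a * x.snd := fun a x => by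
      simp
    refine Prod.ext (Prod.ext (Subtype.ext (Prod.ext (s0 _ _) ?_))
      (Subtype.ext (Prod.ext ?_ ?_)))
      (Prod.ext (Subtype.ext (Prod.ext (f0 _ _) ?_)) (Subtype.ext (Prod.ext (s0 _ _) ?_)))
    · change Hol.coord _ * -(Hol.const ε * (inl a.1.2 * (s.1 j).2 : SF (ch1 V)).snd) -
        Hol.const c * (Hol.const ε * (inl a.1.2 * (s.1 i).2 : SF (ch1 V)).fst) =
        a.1.2 * (Hol.coord _ * -(Hol.const ε * (s.1 j).2.snd) -
          Hol.const c * (Hol.const ε * (s.1 i).2.fst))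
      rw [s1, f1]; ring
    · change Hol.coord _ * (inl a.1.1 * (s.1 j).1 : SF (ch0 V)).snd +
        Hol.const c * (inl a.1.1 * (s.1 i).1 : SF (ch0 V)).fst =
        a.1.1 * (Hol.coord _ * (s.1 j).1.snd + Hol.const c * (s.1 i).1.fst)
      rw [s0, f0]; ring
    · change -(Hol.const ε * (inl a.1.2 * (s.1 j).2 : SF (ch1 V)).snd) =
        a.1.2 * -(Hol.const ε * (s.1 j).2.snd)
      rw [s1]; ring
    · change Hol.const ε * (inl a.1.2 * (s.1 j).2 : SF (ch1 V)).fst =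
        a.1.2 * (Hol.const ε * (s.1 j).2.fst)
      rw [f1]; ring
    · change -(Hol.const ε * (inl a.1.2 * (s.1 i).2 : SF (ch1 V)).snd) =
        a.1.2 * -(Hol.const ε * (s.1 i).2.snd)
      rw [s1]; ring
  invFun := fun t : OnQuad m V =>
    (⟨splitInv i ε c t, h.splitInv_mem t⟩ : (rankTwo g he hu).Sec V)
  left_inv := fun s : (rankTwo g he hu).Sec V => Subtype.ext (h.splitInv_split s.2)
  right_inv := fun t : OnQuad m V => h.split_splitInv t

theorem IsTriangular.equiv_res (h : IsTriangular g i j ε c m) {U V : Opens PLine} (hV : V ≤ U)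
    (s : ((rankTwo g he hu).sheaf.restrictScalars projHom).obj U) :
    h.equiv V (((rankTwo g he hu).sheaf.restrictScalars projHom).res hV s) =
      (((sheafO (m - 1)).sum (sheafO (m - 1))).sum ((sheafO m).sum (sheafO (m - 2)))).res hV
        (h.equiv U s) := by
  let x : Fin 2 → SF (ch0 U) × SF (ch1 U) := Subtype.val (p := (· ∈ (rankTwo g he hu).secSubmodule U)) s
  have rc : ∀ a, Hol.res (ch1_mono hV) (Hol.const a) = Hol.const a :=
    fun a => (Hol.res (ch1_mono hV)).commutes a
  have rc0 : ∀ a, Hol.res (ch0_mono hV) (Hol.const a) = Hol.const a :=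
    fun a => (Hol.res (ch0_mono hV)).commutes a
  have rz : Hol.res (ch1_mono hV) (Hol.coord _) = Hol.coord _ := rfl
  have rz0 : Hol.res (ch0_mono hV) (Hol.coord _) = Hol.coord _ := rfl
  refine Prod.ext (Prod.ext (Subtype.ext (Prod.ext (SF.snd_res _ _) ?_))
    (Subtype.ext (Prod.ext ?_ ?_)))
    (Prod.ext (Subtype.ext (Prod.ext (SF.fst_res _ _) ?_))
      (Subtype.ext (Prod.ext (SF.snd_res _ _) ?_)))
  · change Hol.coord _ * -(Hol.const ε * (SF.res (ch1_mono hV) (x j).2).snd) -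
        Hol.const c * (Hol.const ε * (SF.res (ch1_mono hV) (x i).2).fst) =
      Hol.res (ch1_mono hV) (Hol.coord _ * -(Hol.const ε * (x j).2.snd) -
        Hol.const c * (Hol.const ε * (x i).2.fst))
    simp only [map_sub, map_mul, map_neg, rc, rz, SF.fst_res, SF.snd_res]
  · change Hol.coord _ * (SF.res (ch0_mono hV) (x j).1).snd +
        Hol.const c * (SF.res (ch0_mono hV) (x i).1).fst =
      Hol.res (ch0_mono hV) (Hol.coord _ * (x j).1.snd + Hol.const c * (x i).1.fst)
    simp only [map_add, map_mul, rc0, rz0, SF.fst_res, SF.snd_res]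
  · change -(Hol.const ε * (SF.res (ch1_mono hV) (x j).2).snd) =
      Hol.res (ch1_mono hV) (-(Hol.const ε * (x j).2.snd))
    simp only [map_neg, map_mul, rc, SF.snd_res]
  · change Hol.const ε * (SF.res (ch1_mono hV) (x j).2).fst =
      Hol.res (ch1_mono hV) (Hol.const ε * (x j).2.fst)
    simp only [map_mul, rc, SF.fst_res]
  · change -(Hol.const ε * (SF.res (ch1_mono hV) (x i).2).snd) =
      Hol.res (ch1_mono hV) (-(Hol.const ε * (x i).2.snd))
    simp only [map_neg, map_mul, rc, SF.snd_res]

/-- The first pair of components only involves the even coefficient at `i` and the odd coefficient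
at `j`. Both vanish for the parity in question, as the two frame vectors have opposite parities. -/
theorem IsTriangular.equiv_fst_eq_zero (h : IsTriangular g i j ε c m)
    {s : (rankTwo g he hu).Sec V} {p : ZMod 2} (hp : p + par11 i = 1) (hp' : p + par11 j = 0)
    (hs : s ∈ (rankTwo g he hu).partSec p V) : (h.split s.1 s.2).1 = 0 := by
  have hi := hs i
  have hj := hs j
  change (s.1 i).1 ∈ dpart (Hol (ch0 V)) (Hol (ch0 V)) (p + par11 i) ∧
    (s.1 i).2 ∈ dpart (Hol (ch1 V)) (Hol (ch1 V)) (p + par11 i) at hi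
  change (s.1 j).1 ∈ dpart (Hol (ch0 V)) (Hol (ch0 V)) (p + par11 j) ∧
    (s.1 j).2 ∈ dpart (Hol (ch1 V)) (Hol (ch1 V)) (p + par11 j) at hj
  rw [hp, mem_dpart_one, mem_dpart_one] at hi
  rw [hp', mem_dpart_zero, mem_dpart_zero] at hj
  refine Prod.ext (Subtype.ext (Prod.ext hj.1 ?_)) (Subtype.ext (Prod.ext ?_ ?_)) <;>
    simp only [split, hi, hj, mul_zero, neg_zero, sub_zero, add_zero] <;> rfl

/-- The complementary case: the second pair only involves the odd coefficient at `i` and the even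
one at `j`. -/
theorem IsTriangular.equiv_snd_eq_zero (h : IsTriangular g i j ε c m)
    {s : (rankTwo g he hu).Sec V} {p : ZMod 2} (hp : p + par11 i = 0) (hp' : p + par11 j = 1)
    (hs : s ∈ (rankTwo g he hu).partSec p V) : (h.split s.1 s.2).2 = 0 := by
  have hi := hs i
  have hj := hs j
  change (s.1 i).1 ∈ dpart (Hol (ch0 V)) (Hol (ch0 V)) (p + par11 i) ∧
    (s.1 i).2 ∈ dpart (Hol (ch1 V)) (Hol (ch1 V)) (p + par11 i) at hi
  change (s.1 j).1 ∈ dpart (Hol (ch0 V)) (Hol (ch0 V)) (p + par11 j) ∧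
    (s.1 j).2 ∈ dpart (Hol (ch1 V)) (Hol (ch1 V)) (p + par11 j) at hj
  rw [hp, mem_dpart_zero, mem_dpart_zero] at hi
  rw [hp', mem_dpart_one, mem_dpart_one] at hj
  refine Prod.ext (Subtype.ext (Prod.ext hj.1 ?_)) (Subtype.ext (Prod.ext hi.1 ?_)) <;>
    simp only [split, hi, hj, mul_zero, neg_zero] <;> rfl

end Triangular

/-- A bundle whose transition matrix is upper triangular. -/
def IsTriangular.isoUpper {g : Matrix (Fin 2) (Fin 2) (SF Cstar)} {he : IsEvenMat par11 g}
    {hu : IsUnit g} {ε c : ℂ} {m : ℤ} (h : IsTriangular g 0 1 ε c m) :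
    ((rankTwo g he hu).sheaf.restrictScalars projHom).Iso
      (((sheafO (m - 1)).sum (sheafO (m - 1))).sum
        ((sheafO m).sum (sheafO (m - 2))).parity) :=
  SuperModSheaf.Iso.ofMem h.equiv h.equiv_res fun V p s hs => by
    rcases zmod2_cases p with rfl | rfl
    · have h0 := h.equiv_snd_eq_zero (p := 0) rfl rfl hs
      exact ⟨⟨mem_evenPart_zero (M := On (m - 1) V) _, mem_evenPart_zero (M := On (m - 1) V) _⟩,
        ⟨mem_evenPart_of_eq_zero (M := On m V) (congrArg Prod.fst h0) _,
          mem_evenPart_of_eq_zero (M := On (m - 2) V) (congrArg Prod.snd h0) _⟩⟩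
    · have h0 := h.equiv_fst_eq_zero (p := 1) rfl rfl hs
      exact ⟨⟨mem_evenPart_of_eq_zero (M := On (m - 1) V) (congrArg Prod.fst h0) _,
          mem_evenPart_of_eq_zero (M := On (m - 1) V) (congrArg Prod.snd h0) _⟩,
        ⟨mem_evenPart_zero (M := On m V) _, mem_evenPart_zero (M := On (m - 2) V) _⟩⟩

/-- A bundle whose transition matrix is lower triangular. -/
def IsTriangular.isoLower {g : Matrix (Fin 2) (Fin 2) (SF Cstar)} {he : IsEvenMat par11 g}
    {hu : IsUnit g} {ε c : ℂ} {m : ℤ} (h : IsTriangular g 1 0 ε c m) :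
    ((rankTwo g he hu).sheaf.restrictScalars projHom).Iso
      (((sheafO (m - 1)).sum (sheafO (m - 1))).parity.sum
        ((sheafO m).sum (sheafO (m - 2)))) :=
  SuperModSheaf.Iso.ofMem h.equiv h.equiv_res fun V p s hs => by
    rcases zmod2_cases p with rfl | rfl
    · have h0 := h.equiv_fst_eq_zero (p := 0) rfl rfl hs
      exact ⟨⟨mem_evenPart_of_eq_zero (M := On (m - 1) V) (congrArg Prod.fst h0) _,
          mem_evenPart_of_eq_zero (M := On (m - 1) V) (congrArg Prod.snd h0) _⟩,
        ⟨mem_evenPart_zero (M := On m V) _, mem_evenPart_zero (M := On (m - 2) V) _⟩⟩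
    · have h0 := h.equiv_snd_eq_zero (p := 1) rfl rfl hs
      exact ⟨⟨mem_evenPart_zero (M := On (m - 1) V) _, mem_evenPart_zero (M := On (m - 1) V) _⟩,
        ⟨mem_evenPart_of_eq_zero (M := On m V) (congrArg Prod.fst h0) _,
          mem_evenPart_of_eq_zero (M := On (m - 2) V) (congrArg Prod.snd h0) _⟩⟩

end

section

open TrivSqZeroExt (inl inr)

/-! ### Symmetric powers of the tangent and cotangent sheaves -/

/-- The diagonal `(-w⁻²)^(k+1)` gives the sign and the exponent m. The odd entry `(k+1) (-w⁻²)^k · 2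
w⁻³` has exponent m - 1, and comparing its coefficient with `-ε c` gives `c = 2(k+1)`. -/
theorem isTriangular_symPow_piCotangent (k : ℕ) : IsTriangular (symPow k matPiCotangent) 0 1
    ((-1) ^ (k + 1)) (2 * ((k + 1 : ℕ) : ℂ)) (-2 * ((k + 1 : ℕ) : ℤ)) := by
  have e : symPow k matPiCotangent = _ := symPow_matPiCotangent k
  have hi : ∀ w (hw : w ∈ Cstar), Hol.eval ⟨w, hw⟩ Hol.coordInv = w⁻¹ := fun _ _ => rfl
  have hz : ∀ w : ℂ, w ^ (-2 * ((k + 1 : ℕ) : ℤ)) = (w⁻¹) ^ (2 * (k + 1)) := fun w => by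
    rw [neg_mul, zpow_neg, inv_pow, ← zpow_natCast]; push_cast; rfl
  constructor
  · decide
  · rw [← mul_pow]; simp
  · simp [Nat.cast_add_one_ne_zero]
  · intro w hw
    rw [extz_eq_eval _ hw, e, hz]
    change Hol.eval ⟨w, hw⟩ ((-Hol.coordInv ^ 2) ^ (k + 1)) = _
    rw [map_pow, map_neg, map_pow, hi, neg_pow, ← pow_mul]
  · rw [e]; rfl
  · rw [e]; rfl
  · rw [e]; rfl
  · rw [e]; rfl
  · intro w hw
    rw [extz_eq_eval _ hw, e, zpow_sub_one₀ hw, hz]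
    change Hol.eval ⟨w, hw⟩ (((k : Hol Cstar) + 1) * (-Hol.coordInv ^ 2) ^ k *
      (2 * Hol.coordInv ^ 3)) = _
    simp only [map_mul, map_add, map_pow, map_neg, hi, map_natCast, map_one, map_ofNat]
    rw [neg_pow]
    push_cast
    ring

/-- The diagonal is `(-w²)^(k+1)` and the odd entry `(-w²)^k · (-2w)`, whence `c = -2` for every k.
-/
theorem isTriangular_symPow_piTangent (k : ℕ) : IsTriangular (symPow k matPiTangent) 1 0
    ((-1) ^ (k + 1)) (-2) (2 * ((k + 1 : ℕ) : ℤ)) := by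
  have e : symPow k matPiTangent = _ := symPow_matPiTangent k
  have hi : ∀ w (hw : w ∈ Cstar), Hol.eval ⟨w, hw⟩ (Hol.coord _) = w := fun _ _ => rfl
  have hz : ∀ w : ℂ, w ^ (2 * ((k + 1 : ℕ) : ℤ)) = w ^ (2 * (k + 1)) := fun w => by
    rw [← zpow_natCast]; push_cast; rfl
  constructor
  · decide
  · rw [← mul_pow]; simp
  · simp
  · intro w hw
    rw [extz_eq_eval _ hw, e, hz]
    change Hol.eval ⟨w, hw⟩ ((-Hol.coord _ ^ 2) ^ (k + 1)) = _
    rw [map_pow, map_neg, map_pow, hi, neg_pow, ← pow_mul]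
  · rw [e]; rfl
  · rw [e]; rfl
  · rw [e]; rfl
  · rw [e]; rfl
  · intro w hw
    have hw0 : w ≠ 0 := hw
    rw [extz_eq_eval _ hw, e, zpow_sub_one₀ hw, hz]
    change Hol.eval ⟨w, hw⟩ ((-Hol.coord _ ^ 2) ^ k * -(2 * Hol.coord _)) = _
    simp only [map_mul, map_pow, map_neg, hi, map_ofNat]
    rw [neg_pow]
    field_simp
    ring

/-- The sheaf `Sym^k Π T*` as a sheaf of modules on the projective line. -/
def isoSymPiCotangent (k : ℕ) :
    ((sheafSymPiCotangent (k + 1)).restrictScalars projHom).Iso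
      (((sheafO (-2 * ((k + 1 : ℕ) : ℤ) - 1)).sum (sheafO (-2 * ((k + 1 : ℕ) : ℤ) - 1))).sum
        ((sheafO (-2 * ((k + 1 : ℕ) : ℤ))).sum (sheafO (-2 * ((k + 1 : ℕ) : ℤ) - 2))).parity) :=
  (isTriangular_symPow_piCotangent k).isoUpper

/-- The sheaf `Sym^k Π T` as a sheaf of modules on the projective line. -/
def isoSymPiTangent (k : ℕ) :
    ((sheafSymPiTangent (k + 1)).restrictScalars projHom).Iso
      (((sheafO (2 * ((k + 1 : ℕ) : ℤ) - 1)).sum (sheafO (2 * ((k + 1 : ℕ) : ℤ) - 1))).parity.sum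
        ((sheafO (2 * ((k + 1 : ℕ) : ℤ))).sum (sheafO (2 * ((k + 1 : ℕ) : ℤ) - 2)))) :=
  (isTriangular_symPow_piTangent k).isoLower

/-! ### Dimension counts for the symmetric powers and the structure sheaf. -/

theorem H0IsoC_sheafO_of_eq {n : ℤ} {a : ℕ} (h : (n + 1).toNat = a) : (sheafO n).H0IsoC a 0 :=
  h ▸ H0IsoC_sheafO n

theorem H1IsoC_sheafO_of_eq {n : ℤ} {a : ℕ} (h : (-1 - n).toNat = a) : (sheafO n).H1IsoC a 0 :=
  h ▸ H1IsoC_sheafO n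

theorem H0IsoC_symPiCotangent (k : ℕ) : (sheafSymPiCotangent (k + 1)).H0IsoC 0 0 := by
  have h1 : (sheafO (-2 * ((k + 1 : ℕ) : ℤ) - 1)).H0IsoC 0 0 := H0IsoC_sheafO_of_eq (by omega)
  have h2 : (sheafO (-2 * ((k + 1 : ℕ) : ℤ))).H0IsoC 0 0 := H0IsoC_sheafO_of_eq (by omega)
  have h3 : (sheafO (-2 * ((k + 1 : ℕ) : ℤ) - 2)).H0IsoC 0 0 := H0IsoC_sheafO_of_eq (by omega)
  exact .of_restrictScalars (.of_iso (isoSymPiCotangent k) ((h1.sum h1).sum (h2.sum h3).parity))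

/-- With K = k + 1, the two copies of O(-2K-1) contribute 2K each to the even part, while O(-2K) and
O(-2K-2) contribute 2K-1 and 2K+1 to the odd part. -/
theorem H1IsoC_symPiCotangent (k : ℕ) :
    (sheafSymPiCotangent (k + 1)).H1IsoC (4 * (k + 1)) (4 * (k + 1)) := by
  have h1 : (sheafO (-2 * ((k + 1 : ℕ) : ℤ) - 1)).H1IsoC (2 * (k + 1)) 0 :=
    H1IsoC_sheafO_of_eq (by omega)
  have h2 : (sheafO (-2 * ((k + 1 : ℕ) : ℤ))).H1IsoC (2 * k + 1) 0 :=
    H1IsoC_sheafO_of_eq (by omega)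
  have h3 : (sheafO (-2 * ((k + 1 : ℕ) : ℤ) - 2)).H1IsoC (2 * k + 3) 0 :=
    H1IsoC_sheafO_of_eq (by omega)
  have h := (h1.sum h1).sum (h2.sum h3).parity
  rw [show 2 * (k + 1) + 2 * (k + 1) + (0 + 0) = 4 * (k + 1) by omega,
    show 0 + 0 + (2 * k + 1 + (2 * k + 3)) = 4 * (k + 1) by omega] at h
  exact .of_restrictScalars (.of_iso (isoSymPiCotangent k) h)

/-- With K = k + 1, the odd part comes from two copies of O(2K-1), each of dimension 2K; the even
part comes from O(2K) and O(2K-2), of dimensions 2K+1 and 2K-1. -/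
theorem H0IsoC_symPiTangent (k : ℕ) :
    (sheafSymPiTangent (k + 1)).H0IsoC (4 * (k + 1)) (4 * (k + 1)) := by
  have h1 : (sheafO (2 * ((k + 1 : ℕ) : ℤ) - 1)).H0IsoC (2 * (k + 1)) 0 :=
    H0IsoC_sheafO_of_eq (by omega)
  have h2 : (sheafO (2 * ((k + 1 : ℕ) : ℤ))).H0IsoC (2 * k + 3) 0 :=
    H0IsoC_sheafO_of_eq (by omega)
  have h3 : (sheafO (2 * ((k + 1 : ℕ) : ℤ) - 2)).H0IsoC (2 * k + 1) 0 :=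
    H0IsoC_sheafO_of_eq (by omega)
  have h := (h1.sum h1).parity.sum (h2.sum h3)
  rw [show 0 + 0 + (2 * k + 3 + (2 * k + 1)) = 4 * (k + 1) by omega,
    show 2 * (k + 1) + 2 * (k + 1) + (0 + 0) = 4 * (k + 1) by omega] at h
  exact .of_restrictScalars (.of_iso (isoSymPiTangent k) h)

/-- All the degrees are nonnegative, so no Laurent tail survives. -/
theorem H1IsoC_symPiTangent (k : ℕ) : (sheafSymPiTangent (k + 1)).H1IsoC 0 0 := by
  have h1 : (sheafO (2 * ((k + 1 : ℕ) : ℤ) - 1)).H1IsoC 0 0 := H1IsoC_sheafO_of_eq (by omega)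
  have h2 : (sheafO (2 * ((k + 1 : ℕ) : ℤ))).H1IsoC 0 0 := H1IsoC_sheafO_of_eq (by omega)
  have h3 : (sheafO (2 * ((k + 1 : ℕ) : ℤ) - 2)).H1IsoC 0 0 := H1IsoC_sheafO_of_eq (by omega)
  exact .of_restrictScalars (.of_iso (isoSymPiTangent k) ((h1.sum h1).parity.sum (h2.sum h3)))

/-- The constants come from O, and O(-2) has no global sections; dually, the only class in H¹ is
that of O(-2), made odd by the parity change. -/
theorem H0IsoC_triv : sheafTriv.H0IsoC 1 0 := by
  have h0 : (sheafO 0).H0IsoC 1 0 := H0IsoC_sheafO_of_eq rfl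
  have h2 : (sheafO (-2)).H0IsoC 0 0 := H0IsoC_sheafO_of_eq rfl
  exact .of_restrictScalars (.of_iso isoTriv (h0.sum h2.parity))

theorem H1IsoC_triv : sheafTriv.H1IsoC 0 1 := by
  have h0 : (sheafO 0).H1IsoC 0 0 := H1IsoC_sheafO_of_eq rfl
  have h2 : (sheafO (-2)).H1IsoC 1 0 := H1IsoC_sheafO_of_eq rfl
  exact .of_restrictScalars (.of_iso isoTriv (h0.sum h2.parity))

theorem nonempty_isoLHS_zero :
    Nonempty ((sheafLHS 0).Iso ((sheafTriv.sum sheafTriv.parity).sum sheafTriv)) := by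
  obtain ⟨e⟩ := nonempty_isoBer
  exact ⟨((SuperModSheaf.Iso.refl sheafTriv).sum e.parity).sum e⟩

theorem sheafLHS_neg (k : ℕ) : sheafLHS (-((k + 1 : ℕ) : ℤ)) =
    (sheafSymPiTangent (k + 1)).parity.sum (sheafSymPiTangent (k + 1)) := by
  rw [← sheafIntegral_eq]; rfl

end

end PiLine

end

theorem mainTheorem6 :
    -- the change of coordinates of the `Π`-projective line is the one which is determined by the
    -- big cells, up to row operations
    (∀ z ∈ PiLine.dpart (PiLine.Hol PiLine.Cstar) (PiLine.Hol PiLine.Cstar) 0,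
      ∀ θ ∈ PiLine.dpart (PiLine.Hol PiLine.Cstar) (PiLine.Hol PiLine.Cstar) 1,
      (∃ g : Matrix (Fin 2) (Fin 2) (PiLine.SF PiLine.Cstar),
        PiLine.IsEvenMat PiLine.par11 g ∧ IsUnit g ∧
        PiLine.bigCell1 PiLine.coordW PiLine.coordPsi = g * PiLine.bigCell0 z θ) ↔
      z = PiLine.coordZ ∧ θ = PiLine.coordTheta) ∧
    -- it is the split supermanifold `(ℙ¹, O(-2))`, and its Berezinian is trivial
    Nonempty (PiLine.sheafOPi.Iso (PiLine.sheafSplit (-2))) ∧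
    Nonempty (PiLine.sheafBer.Iso PiLine.sheafTriv) ∧
    -- the sheaves `Sym^k Π T*`
    (∀ k : ℕ, 1 ≤ k →
      Nonempty (((PiLine.sheafSymPiCotangent k).restrictScalars PiLine.projHom).Iso
        (((PiLine.sheafO (-2 * (k : ℤ) - 1)).sum (PiLine.sheafO (-2 * (k : ℤ) - 1))).sum
          ((PiLine.sheafO (-2 * (k : ℤ))).sum (PiLine.sheafO (-2 * (k : ℤ) - 2))).parity)) ∧
      (PiLine.sheafSymPiCotangent k).H0IsoC 0 0 ∧
      (PiLine.sheafSymPiCotangent k).H1IsoC (4 * k) (4 * k)) ∧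
    -- the Large Hilbert Space in positive degrees
    (∀ k : ℕ, 1 ≤ k →
      Nonempty ((PiLine.sheafLHS k).Iso (PiLine.sheafSymPiCotangent k)) ∧
      (PiLine.sheafLHS k).H0IsoC 0 0 ∧
      (PiLine.sheafLHS k).H1IsoC (4 * k) (4 * k)) ∧
    -- the Large Hilbert Space in degree zero
    Nonempty ((PiLine.sheafLHS 0).Iso
      ((PiLine.sheafTriv.sum PiLine.sheafTriv.parity).sum PiLine.sheafTriv)) ∧
    PiLine.sheafTriv.H0IsoC 1 0 ∧
    PiLine.sheafTriv.H1IsoC 0 1 ∧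
    (PiLine.sheafLHS 0).H0IsoC (1 + 0 + 1) (0 + 1 + 0) ∧
    (PiLine.sheafLHS 0).H1IsoC (0 + 1 + 0) (1 + 0 + 1) ∧
    -- the Large Hilbert Space in negative degrees
    (∀ k : ℕ, 1 ≤ k →
      Nonempty ((PiLine.sheafLHS (-k)).Iso
        ((PiLine.sheafSymPiTangent k).parity.sum (PiLine.sheafSymPiTangent k))) ∧
      (PiLine.sheafSymPiTangent k).H0IsoC (4 * k) (4 * k) ∧
      (PiLine.sheafSymPiTangent k).H1IsoC 0 0 ∧
      (PiLine.sheafLHS (-k)).H0IsoC (4 * k + 4 * k) (4 * k + 4 * k) ∧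
      (PiLine.sheafLHS (-k)).H1IsoC 0 0) := by
  refine ⟨fun z hz θ hθ => PiLine.row_equivalent_iff hz hθ, ⟨PiLine.isoSplit⟩,
    PiLine.nonempty_isoBer, fun k hk => ?_, fun k hk => ?_, PiLine.nonempty_isoLHS_zero,
    PiLine.H0IsoC_triv, PiLine.H1IsoC_triv, ?_, ?_, fun k hk => ?_⟩
  -- Writing the degree as a successor selects the `1|1` branch in the definition of the symmetric
  -- powers.
  · obtain ⟨k, rfl⟩ := Nat.exists_eq_add_of_le' hk
    exact ⟨⟨PiLine.isoSymPiCotangent k⟩, PiLine.H0IsoC_symPiCotangent k,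
      PiLine.H1IsoC_symPiCotangent k⟩
  · obtain ⟨k, rfl⟩ := Nat.exists_eq_add_of_le' hk
    exact ⟨⟨PiLine.SuperModSheaf.Iso.refl _⟩, PiLine.H0IsoC_symPiCotangent k,
      PiLine.H1IsoC_symPiCotangent k⟩
  · obtain ⟨e⟩ := PiLine.nonempty_isoLHS_zero
    exact .of_iso e ((PiLine.H0IsoC_triv.sum PiLine.H0IsoC_triv.parity).sum PiLine.H0IsoC_triv)
  · obtain ⟨e⟩ := PiLine.nonempty_isoLHS_zero
    exact .of_iso e ((PiLine.H1IsoC_triv.sum PiLine.H1IsoC_triv.parity).sum PiLine.H1IsoC_triv)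
  · obtain ⟨k, rfl⟩ := Nat.exists_eq_add_of_le' hk
    have h0 := PiLine.H0IsoC_symPiTangent k
    have h1 := PiLine.H1IsoC_symPiTangent k
    rw [PiLine.sheafLHS_neg]
    exact ⟨⟨PiLine.SuperModSheaf.Iso.refl _⟩, h0, h1, h0.parity.sum h0, h1.parity.sum h1⟩
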